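/- Let $N\ge 1$, let $d_1,\dots,d_N\ge 1$ be integers, $g=\sum_i d_i$, and put $d_0=d_{N+1}=g$. Indices $i$ run through $\mathbb Z/(N+1)\mathbb Z$. Let $V_i=\mathbb A^{2g}$ with its direct factor $\Omega_i=\mathbb A^g$ spanned by the first $g$ basis vectors, let $P\subset \mathrm{GL}_{2g}$ be the parabolic subgroup of block upper triangular matrices (blocks of size $g$), and let $\mathfrak P$ be its Lie algebra. Let $\mu^{P,N}$ be the closed subscheme of $(\mathfrak P\setminus\{0\})^{N+1}\times\mathbb A^1_t$ of tuples $(\Pi_0,\dots,\Pi_N,t)$, $\Pi_i:V_i\to V_{i-1}$, all of whose cyclic products $\Pi_j\Pi_{j+1}\cdots\Pi_{j+N}$ equal $t\cdot\mathrm{Id}_{2g}$. Let $P^{N+1}$ act on it by $(h_i)_i\cdot(\Pi_i)_i=(h_{i-1}^{-1}\Pi_ih_i)_i$. Let $\mu^{P,N}_{(d_i)}$ be the open subscheme on which, for every $i$, the minors of size $2g-d_i$ of $\Pi_i$ generate the unit ideal. Write $$\Pi_0=\begin{pmatrix}A&B\\0&C\end{pmatrix},\qquad \Pi_1\cdots\Pi_N=\begin{pmatrix}A'&B'\\0&C'\end{pmatrix},$$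 and let $\mu^{P,N}_{\rm bl}\to\mu^{P,N}$ be the blow-up along the ideals generated by the minors of size $k$ of $A$ and along those generated by the minors of size $k$ of $A'$, for all $1\le k\le g-1$ (that is, along the product of these ideals). Let $\Sigma^{g,N}$ be the $\mu^{P,N}$-scheme classifying, over a point $(\Pi_i)_i$ of $\mu^{P,N}$, pairs of nondegenerate alternating pairings $(\ ,\ )_0$ on $V_0$ and $(\ ,\ )_N$ on $V_N$ such that $\Omega_0$, resp. $\Omega_N$, is totally isotropic and $(\Pi_0x,y)_N=(x,\Pi_1\cdots\Pi_Ny)_0$ for all $x\in V_0$, $y\in V_N$. Put $\Sigma^{g,N}_{(d_i)}=\Sigma^{g,N}\times_{\mu^{P,N}}\mu^{P,N}_{(d_i)}$. For a $\mathbb Z[t]$-scheme $X$ let $X^+$ be the closed subscheme defined by the ideal sheaf of sections killed by a power of $t$. Then the morphism $$f:(\Sigma^{g,N}_{(d_i)}\times_{\mu^{P,N}}\mu^{P,N}_{\rm bl})^+\longrightarrow(\mu^{P,N}_{\rm bl})^+$$ induced by the second projection is smooth. Moreover every point of $(\mu^{P,N}_{\rm bl})^+$ lying over $\mu^{P,N}_{(d_i)}$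 has an open neighbourhood $U$ such that: - some $h\in P^{N+1}(U)$ translates the tuple $(\Pi_i)_i|_U$ into one for which the blocks $B$ and $B'$ are both invertible; - $f^{-1}(U)\to U$ is surjective, and $f^{-1}(U)$ is isomorphic over $U$ to the open subscheme of the affine space $\mathbb A_U^{g(3g-1)/2}$ on which some function $F$ on $\mathbb A_U^{g(3g-1)/2}$ is invertible. -/

import Mathlib

open CategoryTheory CategoryTheory.Limits AlgebraicGeometry Polynomial

noncomputable section

namespace Genestier

/-! ### Killing `t`-torsion -/

section Plus

/-- The ideal of all elements of `A` killed by some power of `a`. -/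
def powerTorsion {A : Type} [CommRing A] (a : A) : Ideal A where
  carrier := {s | ∃ n : ℕ, a ^ n * s = 0}
  zero_mem' := ⟨0, by simp⟩
  add_mem' := by
    rintro x y ⟨n, hn⟩ ⟨k, hk⟩
    refine ⟨n + k, ?_⟩
    have e : a ^ (n + k) * (x + y) = a ^ k * (a ^ n * x) + a ^ n * (a ^ k * y) := by ring
    rw [e, hn, hk]; simp
  smul_mem' := by
    rintro c x ⟨n, hn⟩
    refine ⟨n, ?_⟩
    have e : a ^ n * (c • x) = c * (a ^ n * x) := by simp only [smul_eq_mul]; ring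
    rw [e, hn, mul_zero]

theorem mem_powerTorsion {A : Type} [CommRing A] {a s : A} :
    s ∈ powerTorsion a ↔ ∃ n : ℕ, a ^ n * s = 0 := Iff.rfl

theorem powerTorsion_map_away {A B : Type} [CommRing A] [CommRing B] [Algebra A B]
    (f : A) [IsLocalization.Away f B] (a : A) :
    (powerTorsion a).map (algebraMap A B) = powerTorsion (algebraMap A B a) := by
  apply le_antisymm
  · rw [Ideal.map_le_iff_le_comap]
    rintro s ⟨n, hn⟩
    exact ⟨n, by rw [← map_pow, ← map_mul, hn, map_zero]⟩
  · rintro s ⟨n, hn⟩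
    obtain ⟨⟨x, y⟩, hxy⟩ := IsLocalization.surj (Submonoid.powers f) s
    have h0 : algebraMap A B (a ^ n * x) = algebraMap A B 0 := by
      rw [map_mul, map_pow, ← hxy, ← mul_assoc, hn, zero_mul, map_zero]
    obtain ⟨c, hc⟩ := (IsLocalization.eq_iff_exists (Submonoid.powers f) B).1 h0
    have hmem : (c : A) * x ∈ powerTorsion a := ⟨n, by rw [mul_zero] at hc; rw [← hc]; ring⟩
    have h1 : algebraMap A B (c * x) ∈ (powerTorsion a).map (algebraMap A B) :=
      Ideal.mem_map_of_mem _ hmem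
    rw [map_mul, ← hxy] at h1
    have hu : IsUnit (algebraMap A B c * algebraMap A B y) :=
      (IsLocalization.map_units B c).mul (IsLocalization.map_units B y)
    have e : algebraMap A B c * (s * algebraMap A B y)
        = (algebraMap A B c * algebraMap A B y) * s := by ring
    rw [e] at h1
    exact (Ideal.unit_mul_mem_iff_mem _ hu).1 h1

/-- The affine line `Spec ℤ[t]`. -/
abbrev A1 : Scheme.{0} := Spec (.of ℤ[X])

/-- The function `t` on a `ℤ[t]`-scheme. -/
def tFun {Y : Scheme.{0}} (p : Y ⟶ A1) : Γ(Y, ⊤) :=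
  p.appTop.hom ((Scheme.ΓSpecIso (.of ℤ[X])).inv.hom (X : ℤ[X]))

/-- The function `t` restricted to an open subset. -/
def tFunOn {Y : Scheme.{0}} (p : Y ⟶ A1) (U : Y.Opens) : Γ(Y, U) :=
  (Y.presheaf.map (homOfLE (le_top : U ≤ ⊤)).op).hom (tFun p)

theorem tFunOn_map {Y : Scheme.{0}} (p : Y ⟶ A1) {U V : Y.Opens} (h : V ≤ U) :
    (Y.presheaf.map (homOfLE h).op).hom (tFunOn p U) = tFunOn p V := by
  simp only [tFunOn]
  rw [← CommRingCat.comp_apply, ← Functor.map_comp]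
  rfl

/-- The ideal sheaf of sections killed by a power of `t`. -/
def torsIdeal {Y : Scheme.{0}} (p : Y ⟶ A1) : Y.IdealSheafData where
  ideal U := powerTorsion (tFunOn p U)
  map_ideal_basicOpen U f := by
    let _ : Algebra Γ(Y, U) Γ(Y, Y.affineBasicOpen f) :=
      (Y.presheaf.map (homOfLE (Y.basicOpen_le f)).op).hom.toAlgebra
    have _ : IsLocalization.Away f Γ(Y, Y.affineBasicOpen f) :=
      U.2.isLocalization_of_eq_basicOpen _ _ rfl
    have h := powerTorsion_map_away (B := Γ(Y, Y.affineBasicOpen f)) f (tFunOn p U)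
    have h2 : algebraMap Γ(Y, U) Γ(Y, Y.affineBasicOpen f) (tFunOn p U)
        = tFunOn p (Y.affineBasicOpen f) := tFunOn_map p (Y.basicOpen_le f)
    rw [h2] at h
    exact h

/-- `Y⁺`, the closed subscheme of the `ℤ[t]`-scheme `Y` obtained by killing the `t`-torsion. -/
def plus {Y : Scheme.{0}} (p : Y ⟶ A1) : Scheme.{0} := (torsIdeal p).subscheme

/-- The closed immersion `Y⁺ ⟶ Y`. -/
def plusι {Y : Scheme.{0}} (p : Y ⟶ A1) : plus p ⟶ Y := (torsIdeal p).subschemeι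

theorem torsIdeal_le_map {Z Y : Scheme.{0}} (q : Z ⟶ A1) (p : Y ⟶ A1) (f : Z ⟶ Y)
    (hf : f ≫ p = q) : torsIdeal p ≤ (torsIdeal q).map f := by
  have ht : ∀ U : Y.Opens, (f.app U).hom (tFunOn p U) = tFunOn q (f ⁻¹ᵁ U) := by
    intro U
    subst hf
    simp only [tFunOn, tFun]
    rw [← CommRingCat.comp_apply, f.naturality, CommRingCat.comp_apply]
    simp only [Scheme.Hom.comp_appTop, CommRingCat.comp_apply]
    rfl
  rw [Scheme.IdealSheafData.map, Scheme.Hom.ker, Scheme.IdealSheafData.le_ofIdeals_iff]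
  rintro U s ⟨n, hn⟩
  rw [RingHom.mem_ker, Scheme.Hom.comp_app]
  change ((torsIdeal q).subschemeι.app (f ⁻¹ᵁ U.1)).hom ((f.app U.1).hom s) = 0
  set s' := (f.app U).hom s with hs'
  have hn' : tFunOn q (f ⁻¹ᵁ U.1) ^ n * s' = 0 := by
    rw [hs', ← ht, ← map_pow, ← map_mul, hn, map_zero]
  set ι := (torsIdeal q).subschemeι with hι
  apply (torsIdeal q).subscheme.IsSheaf.section_ext
  intro x hx
  obtain ⟨_, ⟨W, hW, rfl⟩, hxW, hWU⟩ :=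
    Z.isBasis_affineOpens.exists_subset_of_mem_open (show ι x ∈ f ⁻¹ᵁ U.1 from hx) (f ⁻¹ᵁ U.1).2
  have hWU : W ≤ f ⁻¹ᵁ U.1 := hWU
  refine ⟨ι ⁻¹ᵁ W, fun y hy => hWU hy, hxW, ?_⟩
  have key : (ι.app W).hom ((Z.presheaf.map (homOfLE hWU).op).hom s') = 0 := by
    rw [← RingHom.mem_ker, hι, (torsIdeal q).ker_subschemeι_app ⟨W, hW⟩]
    refine ⟨n, ?_⟩
    rw [← tFunOn_map q hWU, ← map_pow, ← map_mul, hn', map_zero]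
  rw [map_zero]
  rw [← CommRingCat.comp_apply, ι.naturality, CommRingCat.comp_apply] at key
  exact key

/-- The morphism `Z⁺ ⟶ Y⁺` induced by a morphism `Z ⟶ Y` of `ℤ[t]`-schemes. -/
def plusMap {Z Y : Scheme.{0}} (q : Z ⟶ A1) (p : Y ⟶ A1) (f : Z ⟶ Y) (hf : f ≫ p = q) :
    plus q ⟶ plus p :=
  Scheme.IdealSheafData.subschemeMap (torsIdeal q) (torsIdeal p) f (torsIdeal_le_map q p f hf)

end Plus

/-! ### Blowing up -/

section BlowUp

variable {R : Type} [CommRing R] (I : Ideal R)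

/-- The degree `n` part `I ^ n · Xⁿ` of the Rees algebra `⨁ I ^ n`. -/
def reesPart (n : ℕ) : Submodule R (reesAlgebra I) where
  carrier := {f | ∀ i, i ≠ n → (f : R[X]).coeff i = 0}
  zero_mem' := by simp
  add_mem' := by
    intro f h hf hh i hi
    simp [hf i hi, hh i hi]
  smul_mem' := by
    intro c f hf i hi
    simp [hf i hi]

/-- The homogeneous component of degree `n` of an element of the Rees algebra. -/
def reesComponent (n : ℕ) (f : reesAlgebra I) : reesPart I n :=
  ⟨⟨monomial n ((f : R[X]).coeff n), reesAlgebra.monomial_mem.2 (f.2 n)⟩, by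
    intro i hi
    simp [coeff_monomial, hi.symm]⟩

instance reesPart_gradedMonoid : SetLike.GradedMonoid (reesPart I) where
  one_mem := by
    intro i hi
    simp [coeff_one, hi]
  mul_mem := by
    intro m n f h hf hh i hi
    simp only [MulMemClass.coe_mul, coeff_mul]
    apply Finset.sum_eq_zero
    rintro ⟨a, b⟩ hab
    have hab : a + b = i := Finset.HasAntidiagonal.mem_antidiagonal.1 hab
    by_cases ha : a = m
    · have hb : b ≠ n := by
        rintro rfl
        exact hi (by rw [← hab, ha])
      simp [hh b hb]
    · simp [hf a ha]

theorem coeff_coe_reesPart (x : DirectSum ℕ fun n => reesPart I n) (n : ℕ) :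
    ((DirectSum.coeAddMonoidHom (reesPart I) x : reesAlgebra I) : R[X]).coeff n
      = ((x n : reesAlgebra I) : R[X]).coeff n := by
  induction x using DirectSum.induction_on with
  | zero => simp
  | of i y =>
    rw [DirectSum.coeAddMonoidHom_of]
    by_cases h : i = n
    · subst h
      rw [DirectSum.of_eq_same]
    · rw [DirectSum.of_eq_of_ne _ _ _ (Ne.symm h), y.2 n (Ne.symm h)]
      simp
  | add y z hy hz => simp [hy, hz]

instance reesPart_gradedAlgebra : GradedAlgebra (reesPart I) where
  toGradedMonoid := reesPart_gradedMonoid I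
  decompose' f := DFinsupp.mk (f : R[X]).support fun n => reesComponent I n f
  left_inv f := by
    apply Subtype.ext
    ext n
    rw [coeff_coe_reesPart, DFinsupp.mk_apply]
    split_ifs with h
    · simp [reesComponent]
    · simpa using (notMem_support_iff.1 h).symm
  right_inv x := by
    ext n m
    rw [DFinsupp.mk_apply]
    by_cases hm : m = n
    · subst hm
      split_ifs with h
      · simp [reesComponent, coeff_coe_reesPart]
      · rw [notMem_support_iff, coeff_coe_reesPart] at h
        simpa using h.symm
    · rw [(x n).2 m hm]
      split_ifs with h
      · simp [reesComponent, coeff_monomial, Ne.symm hm]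
      · simp

/-- The blow-up of `Spec R` along the ideal `I`: the `Proj` of the Rees algebra `⨁ I ^ n`. -/
def blowUp : Scheme.{0} := Proj (reesPart I)

/-- The structure morphism of the blow-up. -/
def blowUpMap : blowUp I ⟶ Spec (.of R) :=
  Proj.toSpecZero (reesPart I) ≫ Spec.map (CommRingCat.ofHom (algebraMap R (reesPart I 0)))

end BlowUp

/-! ### The scheme `μ` of matrix tuples

Throughout, matrices of size `2g` are indexed by `Fin g ⊕ Fin g`; the first summand indexes the
basis of `Ω = 𝔸^g`, the second one the remaining basis vectors of `V = 𝔸^{2g}`. Such a matrix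
belongs to the Lie algebra `𝔓` of the parabolic `P` when its lower left block vanishes. A tuple
`(Π_0, …, Π_N)` consists of maps `Π_i : V_i ⟶ V_{i-1}`, with `i ∈ ℤ/(N+1)ℤ = Fin (N + 1)`. -/

section Mu

/-- The index set of the standard basis of `𝔸^{2g}`. -/
abbrev Idx (g : ℕ) : Type := Fin g ⊕ Fin g

/-- `Π_j Π_{j+1} ⋯ Π_{j+N}`, with indices modulo `N + 1`. -/
def cycProd {A : Type} [CommRing A] {g N : ℕ} (M : Fin (N + 1) → Matrix (Idx g) (Idx g) A)
    (j : Fin (N + 1)) : Matrix (Idx g) (Idx g) A :=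
  (List.ofFn fun k : Fin (N + 1) => M (j + k)).prod

/-- `Π_1 Π_2 ⋯ Π_N`, a map `V_N ⟶ V_0`. -/
def tailProd {A : Type} [CommRing A] {g N : ℕ} (M : Fin (N + 1) → Matrix (Idx g) (Idx g) A) :
    Matrix (Idx g) (Idx g) A :=
  (List.ofFn fun k : Fin N => M k.succ).prod

variable (g N : ℕ)

/-- Polynomials over `ℤ[t]` in the entries of `N + 1` matrices of size `2g`. -/
abbrev MuPoly : Type := MvPolynomial (Fin (N + 1) × Idx g × Idx g) ℤ[X]

/-- The generic matrices. -/
def genericMat (i : Fin (N + 1)) : Matrix (Idx g) (Idx g) (MuPoly g N) :=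
  Matrix.of fun p q => MvPolynomial.X (i, p, q)

/-- The equations of `μ`: the matrices `Π_i` belong to `𝔓`, and each of the `N + 1` cyclic
products `Π_j ⋯ Π_N Π_0 ⋯ Π_{j-1}` is equal to `t · Id`. -/
def muRel : Set (MuPoly g N) :=
  {f | ∃ (i : Fin (N + 1)) (a b : Fin g), f = genericMat g N i (.inr a) (.inl b)} ∪
  {f | ∃ (j : Fin (N + 1)) (p q : Idx g),
    f = (cycProd (genericMat g N) j - (MvPolynomial.C X : MuPoly g N) •
      (1 : Matrix (Idx g) (Idx g) (MuPoly g N))) p q}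

/-- The `ℤ[t]`-algebra of functions on the closed subscheme of `𝔓^{N+1} × 𝔸¹` that is defined
by the equations of `μ`. -/
def MuRing : Type := MuPoly g N ⧸ Ideal.span (muRel g N)

instance : CommRing (MuRing g N) :=
  inferInstanceAs (CommRing (MuPoly g N ⧸ Ideal.span (muRel g N)))

/-- The quotient map. -/
def toMuRing : MuPoly g N →+* MuRing g N := Ideal.Quotient.mk (Ideal.span (muRel g N))

instance : Algebra ℤ[X] (MuRing g N) := ((toMuRing g N).comp MvPolynomial.C).toAlgebra

/-- The universal tuple `(Π_0, …, Π_N)`. -/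
def univPi (i : Fin (N + 1)) : Matrix (Idx g) (Idx g) (MuRing g N) :=
  (genericMat g N i).map (toMuRing g N)

/-- The closed subscheme of `𝔓^{N+1} × 𝔸¹` defined by the equations of `μ`. -/
abbrev MuClosed : Scheme.{0} := Spec (.of (MuRing g N))

theorem isOpen_notMem {R : Type} [CommRing R] (r : R) :
    IsOpen {x : Spec (.of R) | r ∉ x.asIdeal} :=
  (PrimeSpectrum.basicOpen r).2

/-- The open subset where none of the `Π_i` is zero. -/
def muOpen : (MuClosed g N).Opens where
  carrier := {x | ∀ i, ∃ p q, univPi g N i p q ∉ x.asIdeal}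
  is_open' := by
    simp only [Set.ofPred_forall, Set.ofPred_exists]
    exact isOpen_iInter_of_finite fun i => isOpen_iUnion fun p => isOpen_iUnion fun q =>
      isOpen_notMem _

/-- The scheme `μ`, a closed subscheme of `(𝔓 - {0})^{N+1} × 𝔸¹`. -/
abbrev Mu : Scheme.{0} := (muOpen g N).toScheme

/-- The `(N+1)`-tuple `(d_i)`, `i ∈ ℤ/(N+1)ℤ`, that extends `(d_1, …, d_N)` by
`d_0 = d_{N+1} = g`. -/
def dExt {N : ℕ} (d : Fin N → ℕ) : Fin (N + 1) → ℕ := Fin.cons g d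

/-- The biggest open subset where, for all `i`, the minors of size `2g - d_i` of `Π_i` generate
the unit ideal. -/
def muDClosed {N : ℕ} (d : Fin N → ℕ) : (MuClosed g N).Opens where
  carrier := {x | ∀ i, ∃ r c : Fin (2 * g - dExt g d i) ↪ Idx g,
    ((univPi g N i).submatrix r c).det ∉ x.asIdeal}
  is_open' := by
    simp only [Set.ofPred_forall, Set.ofPred_exists]
    exact isOpen_iInter_of_finite fun i => isOpen_iUnion fun p => isOpen_iUnion fun q =>
      isOpen_notMem _

/-- The same open subset, as an open subset of `μ`. -/
def muD {N : ℕ} (d : Fin N → ℕ) : (Mu g N).Opens := (muOpen g N).ι ⁻¹ᵁ muDClosed g d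

/-- The structure morphism of `MuClosed` over the affine line. -/
def muClosedToA1 : MuClosed g N ⟶ A1 :=
  Spec.map (CommRingCat.ofHom (algebraMap ℤ[X] (MuRing g N)))

end Mu

/-! ### The blow-up of `μ` -/

section MuBl

variable (g N : ℕ)

/-- The ideal generated by the minors of size `k` of a square matrix. -/
def minorIdeal {A : Type} [CommRing A] {m : ℕ} (k : ℕ) (M : Matrix (Fin m) (Fin m) A) : Ideal A :=
  Ideal.span {f | ∃ r c : Fin k ↪ Fin m, f = (M.submatrix r c).det}

/-- The product of the ideals of minors of size `1, …, g - 1` of the upper left blocks of `Π_0`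
and of `Π_1 ⋯ Π_N`. -/
def muCenter : Ideal (MuRing g N) :=
  (∏ k ∈ Finset.Icc 1 (g - 1), minorIdeal k (univPi g N 0).toBlocks₁₁) *
    ∏ k ∈ Finset.Icc 1 (g - 1), minorIdeal k (tailProd (univPi g N)).toBlocks₁₁

/-- The blow-up of `μ` along all these ideals of minors, that is, along their product. It is the
restriction to `μ` of the blow-up of the affine scheme of which `μ` is an open subscheme. -/
abbrev MuBl : Scheme.{0} := (blowUpMap (muCenter g N) ⁻¹ᵁ muOpen g N).toScheme

/-- The blow-up morphism. -/
def muBlToMu : MuBl g N ⟶ Mu g N := blowUpMap (muCenter g N) ∣_ muOpen g N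

/-- The structure morphism of the blow-up over the affine line. -/
def muBlToA1 : MuBl g N ⟶ A1 := muBlToMu g N ≫ (muOpen g N).ι ≫ muClosedToA1 g N

end MuBl

/-! ### The scheme `Σ` of matrix tuples with symplectic pairings -/

section Sigma

variable (g N : ℕ)

/-- Polynomials over the coordinate ring of `MuClosed` in the entries of two matrices. -/
abbrev SigmaPoly : Type := MvPolynomial (Bool × Idx g × Idx g) (MuRing g N)

/-- The generic Gram matrix of a pairing on `V_0` (for `false`) and on `V_N` (for `true`). -/
def genericForm (e : Bool) : Matrix (Idx g) (Idx g) (SigmaPoly g N) :=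
  Matrix.of fun p q => MvPolynomial.X (e, p, q)

/-- The tuple `(Π_i)` over `SigmaPoly`. -/
def polyPi (i : Fin (N + 1)) : Matrix (Idx g) (Idx g) (SigmaPoly g N) :=
  (univPi g N i).map MvPolynomial.C

/-- The equations of `Σ` over `μ`: both pairings are alternating, `Ω_0` and `Ω_N` are totally
isotropic, and `(Π_0 x, y)_N = (x, Π_1 ⋯ Π_N y)_0` for `x ∈ V_0` and `y ∈ V_N`. -/
def sigmaRel : Set (SigmaPoly g N) :=
  {f | ∃ (e : Bool) (p q : Idx g), f = genericForm g N e p q + genericForm g N e q p} ∪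
  {f | ∃ (e : Bool) (p : Idx g), f = genericForm g N e p p} ∪
  {f | ∃ (e : Bool) (a b : Fin g), f = genericForm g N e (.inl a) (.inl b)} ∪
  {f | ∃ p q : Idx g, f = ((polyPi g N 0).transpose * genericForm g N true
    - genericForm g N false * tailProd (polyPi g N)) p q}

/-- The algebra defined by these equations. -/
def SigmaQuot : Type := SigmaPoly g N ⧸ Ideal.span (sigmaRel g N)

instance : CommRing (SigmaQuot g N) :=
  inferInstanceAs (CommRing (SigmaPoly g N ⧸ Ideal.span (sigmaRel g N)))

/-- The quotient map. -/
def toSigmaQuot : SigmaPoly g N →+* SigmaQuot g N := Ideal.Quotient.mk (Ideal.span (sigmaRel g N))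

instance : Algebra (MuRing g N) (SigmaQuot g N) :=
  ((toSigmaQuot g N).comp MvPolynomial.C).toAlgebra

/-- The product of the determinants of the two Gram matrices. -/
def sigmaDisc : SigmaQuot g N :=
  toSigmaQuot g N ((genericForm g N false).det * (genericForm g N true).det)

/-- The algebra classifying the equations of `Σ` together with the nondegeneracy of both
pairings. -/
abbrev SigmaRing : Type := Localization.Away (sigmaDisc g N)

/-- The morphism from the affine scheme of pairings to `MuClosed`. -/
def sigmaClosedToMu : Spec (.of (SigmaRing g N)) ⟶ MuClosed g N :=
  Spec.map (CommRingCat.ofHom (algebraMap (MuRing g N) (SigmaRing g N)))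

/-- The scheme `Σ`. -/
abbrev Sig : Scheme.{0} := (sigmaClosedToMu g N ⁻¹ᵁ muOpen g N).toScheme

/-- The morphism `Σ ⟶ μ` that forgets the pairings. -/
def sigToMu : Sig g N ⟶ Mu g N := sigmaClosedToMu g N ∣_ muOpen g N

/-- The fibre product of `Σ` and `μ_{(d_i)}` over `μ`. -/
abbrev SigD {N : ℕ} (d : Fin N → ℕ) : Scheme.{0} := pullback (sigToMu g N) (muD g d).ι

/-- The morphism from this fibre product to `μ`. -/
def sigDToMu {N : ℕ} (d : Fin N → ℕ) : SigD g d ⟶ Mu g N :=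
  pullback.fst (sigToMu g N) (muD g d).ι ≫ sigToMu g N

end Sigma

/-! ### The morphism of the theorem -/

section Main

variable (g : ℕ) {N : ℕ} (d : Fin N → ℕ)

/-- The second projection of the fibre product of `Σ_{(d_i)}` and the blow-up over `μ`. -/
def fibreToBl : pullback (sigDToMu g d) (muBlToMu g N) ⟶ MuBl g N :=
  pullback.snd (sigDToMu g d) (muBlToMu g N)

/-- The fibre product with `t`-torsion killed. -/
abbrev Source : Scheme.{0} := plus (fibreToBl g d ≫ muBlToA1 g N)

/-- The blow-up with `t`-torsion killed. -/
abbrev Target (g N : ℕ) : Scheme.{0} := plus (muBlToA1 g N)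

/-- The morphism induced by the second projection after killing the `t`-torsion. -/
def mainMap : Source g d ⟶ Target g N :=
  plusMap (fibreToBl g d ≫ muBlToA1 g N) (muBlToA1 g N) (fibreToBl g d) rfl

/-- The morphism from the target to `μ`. -/
def targetToMu (g N : ℕ) : Target g N ⟶ Mu g N := plusι (muBlToA1 g N) ≫ muBlToMu g N

/-- The pullback of functions along a morphism to the spectrum of `R`. -/
def pullFun {R : Type} [CommRing R] {Y : Scheme.{0}} (p : Y ⟶ Spec (.of R)) (U : Y.Opens) :
    R →+* Γ(Y, U) :=
  (Y.presheaf.map (homOfLE (le_top : U ≤ ⊤)).op).hom.comp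
    (p.appTop.hom.comp (Scheme.ΓSpecIso (.of R)).inv.hom)

/-- The tuple `(Π_0, …, Π_N)` over an open subset of the target. -/
def targetPi (g N : ℕ) (U : (Target g N).Opens) (i : Fin (N + 1)) :
    Matrix (Idx g) (Idx g) Γ(Target g N, U) :=
  (univPi g N i).map (pullFun (targetToMu g N ≫ (muOpen g N).ι) U)

/-- A tuple of invertible matrices belongs to `P^{N+1}`: all lower left blocks vanish. -/
def InParabolic {A : Type} [CommRing A] {g N : ℕ}
    (h : Fin (N + 1) → Matrix.GeneralLinearGroup (Idx g) A) : Prop :=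
  ∀ i, (h i : Matrix (Idx g) (Idx g) A).toBlocks₂₁ = 0

/-- The translate `(h_{i-1}⁻¹ Π_i h_i)_i` of a tuple by an element of `P^{N+1}`. -/
def translate {A : Type} [CommRing A] {g N : ℕ}
    (h : Fin (N + 1) → Matrix.GeneralLinearGroup (Idx g) A)
    (M : Fin (N + 1) → Matrix (Idx g) (Idx g) A) (i : Fin (N + 1)) : Matrix (Idx g) (Idx g) A :=
  ((h (i - 1))⁻¹ : Matrix.GeneralLinearGroup (Idx g) A).val * M i * (h i).val

/-- The upper right blocks of `Π_0` and of `Π_1 ⋯ Π_N` are both invertible. -/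
def InBigCell {A : Type} [CommRing A] {g N : ℕ} (M : Fin (N + 1) → Matrix (Idx g) (Idx g) A) :
    Prop :=
  IsUnit (M 0).toBlocks₁₂ ∧ IsUnit (tailProd M).toBlocks₁₂

end Main

end Genestier

/-!
At a point of the target lying over `μ_{(d_i)}`, let `O` be the local ring. Four facts hold there:
`t` is a nonzerodivisor of `O`, because the `t`-torsion has been killed
(`isTorsionFree_plus`); at the residue field, `Π_0` and `T = Π_1 ⋯ Π_N` have rank at least `g`,
the latter because coranks are subadditive (`card_le_rank_prod_add`) and `∑ d_i = g`; both products
of `Π_0` and `T` are `t`; and, thanks to the blow-up, each ideal of minors of the upper left block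
`A` of `Π_0` is generated by one of the minors (`exists_minor_dvd`).

The rank conditions allow one to make `B`, and then `B'`, invertible by unipotent changes of basis
(`exists_isUnit_add_mul_add_mul`, `isUnit_of_le_rank`). The minors of `A` divide powers of `t`, so
`A` is equivalent to a diagonal matrix `D` whose entries form a divisor chain
(`exists_mul_mul_eq_diagonal`). Changes of basis in the Levi subgroup then bring the pair to the
form `Π_0 = (D 1; 0 C)`, `T = (-C 1; 0 -D)` with `C` diagonal and `D C = -t`
(`nonempty_normalData`). Such a normal form consists of finitely many functions subject to
finitely many equations, so that it extends to an affine neighbourhood `U`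
(`exists_normalData`).

For a pair in normal form, write the Gram matrices of the pairings on `V_0` and `V_N` as
`(0 E; -Eᵀ F)` and `(0 E'; -E'ᵀ F')`. The adjointness condition amounts to
`E' = -Eᵀ - F D - C F'`, `D E' = -E D` and `Eᵀ C = -C E'ᵀ`. If `t` is a nonzerodivisor, the last two
say precisely, for `i < j` and `D_j = q_ij D_i`, that
`E_ji = q_ij E_ij - D_j F_ij - C_i F'_ij`. The entries of `E` on and above the diagonal and the
alternating matrices `F` and `F'` are therefore free coordinates (`stdForm_stdCoord`,
`isPairing_stdForm`); there are `g (3 g - 1) / 2` of them (`card_var`).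

This identifies points of the source and points of the open subscheme of `𝔸_U` on which the Gram
determinants are invertible, for schemes over `U` without `t`-torsion. Both the source over `U` and
`𝔸_U` are such schemes, so they represent the same functor on them (`exists_iso_basicOpen`).
Setting `E = 1` and `F = F' = 0` provides a section over `U`, whence surjectivity
(`surjective_of_pulledNormalData`). Since the whole source lies over such neighbourhoods, the
morphism is smooth (`smooth_mainMap`).
-/

namespace Genestier

/-! ### Ranks over a field -/

section Rank

variable {K : Type} [Field K]

theorem finrank_ker_comp_le {V₁ V₂ V₃ : Type} [AddCommGroup V₁] [Module K V₁]
    [AddCommGroup V₂] [Module K V₂] [AddCommGroup V₃] [Module K V₃] [FiniteDimensional K V₁]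
    [FiniteDimensional K V₂] (f : V₂ →ₗ[K] V₃) (h : V₁ →ₗ[K] V₂) :
    Module.finrank K (LinearMap.ker (f ∘ₗ h)) ≤
      Module.finrank K (LinearMap.ker f) + Module.finrank K (LinearMap.ker h) := by
  set S := LinearMap.ker (f ∘ₗ h)
  let φ : S →ₗ[K] LinearMap.ker f :=
    (h.domRestrict S).codRestrict _ fun x => LinearMap.mem_ker.1 x.2
  have h1 := LinearMap.finrank_range_add_finrank_ker φ
  have h2 : Module.finrank K (LinearMap.range φ) ≤ Module.finrank K (LinearMap.ker f) :=
    Submodule.finrank_le _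
  let ψ : LinearMap.ker φ →ₗ[K] LinearMap.ker h :=
    (S.subtype ∘ₗ (LinearMap.ker φ).subtype).codRestrict _ fun x => by
      have := congrArg Subtype.val (LinearMap.mem_ker.1 x.2)
      exact LinearMap.mem_ker.2 this
  have h3 : Module.finrank K (LinearMap.ker φ) ≤ Module.finrank K (LinearMap.ker h) :=
    LinearMap.finrank_le_finrank_of_injective (f := ψ) fun x y hxy => by
      have := congrArg Subtype.val hxy
      exact Subtype.ext (Subtype.ext (by simpa [ψ] using this))
  omega

theorem card_sub_rank_eq {n : Type} [Fintype n] [DecidableEq n] (M : Matrix n n K) :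
    M.rank + Module.finrank K (LinearMap.ker M.mulVecLin) = Fintype.card n := by
  rw [Matrix.rank, LinearMap.finrank_range_add_finrank_ker, Module.finrank_fintype_fun_eq_card]

/-- Sylvester's inequality for a product of several matrices: coranks are subadditive. -/
theorem card_le_rank_prod_add {n : Type} [Fintype n] [DecidableEq n] {N : ℕ}
    (M : Fin N → Matrix n n K) (d : Fin N → ℕ) (h : ∀ i, Fintype.card n ≤ (M i).rank + d i) :
    Fintype.card n ≤ (List.ofFn M).prod.rank + ∑ i, d i := by
  induction N with
  | zero => simp [Matrix.rank_one]
  | succ N ih =>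
    rw [List.ofFn_succ, List.prod_cons, Fin.sum_univ_succ]
    have h1 := ih (fun i => M i.succ) (fun i => d i.succ) fun i => h _
    have h2 := finrank_ker_comp_le (M 0).mulVecLin (List.ofFn fun i => M i.succ).prod.mulVecLin
    rw [← Matrix.mulVecLin_mul] at h2
    have h3 := card_sub_rank_eq (M 0)
    have h4 := card_sub_rank_eq (List.ofFn fun i => M i.succ).prod
    have h5 := card_sub_rank_eq (M 0 * (List.ofFn fun i => M i.succ).prod)
    have h6 := h 0
    omega

/-- A nonvanishing minor bounds the rank from below. -/
theorem le_rank_of_det_submatrix_ne_zero {n : Type} [Fintype n] [DecidableEq n] {k : ℕ}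
    (M : Matrix n n K) (r c : Fin k → n) (h : (M.submatrix r c).det ≠ 0) : k ≤ M.rank := by
  have h1 : (M.submatrix r c).rank = k := by
    rw [Matrix.rank_of_isUnit _ ((Matrix.isUnit_iff_isUnit_det _).2 h.isUnit), Fintype.card_fin]
  have h2 : M.submatrix r c = (1 : Matrix n n K).submatrix r id * M *
      (1 : Matrix n n K).submatrix id c := by
    ext i j
    simp [Matrix.mul_apply, Matrix.one_apply]
  rw [← h1, h2]
  exact (Matrix.rank_mul_le_left _ _).trans (Matrix.rank_mul_le_right _ _)

/-- Matrices over a field have generalized inverses. -/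
theorem exists_mul_mul_eq_self {n : Type} [Fintype n] [DecidableEq n] (M : Matrix n n K) :
    ∃ G, M * G * M = M := by
  obtain ⟨V, U, e, hV, hU, h⟩ := Matrix.exists_rank_normal_form M
  have h0 : V * M * U * (V * M * U) = V * M * U := by
    rw [h, Matrix.submatrix_mul_equiv, Matrix.fromBlocks_multiply]
    simp
  refine ⟨U * V, ?_⟩
  apply hV.mul_left_cancel
  apply hU.mul_right_cancel
  simpa only [mul_assoc] using h0

/-- If a block upper triangular matrix `(A B; 0 C)` has at least half the maximal rank, its upper
right block becomes invertible after a translation by unipotent block matrices. Indeed, a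
translate of `B` is any map that agrees with `B` as a map from `ker C` to the cokernel of `A`, and
the rank condition says that the kernel of this map is not bigger than the image of `A`. -/
theorem exists_isUnit_add_mul_add_mul {g : ℕ} (A B C : Matrix (Fin g) (Fin g) K)
    (h : g ≤ (Matrix.fromBlocks A B 0 C).rank) :
    ∃ x y : Matrix (Fin g) (Fin g) K, IsUnit (B + A * x + y * C) := by
  set M := Matrix.fromBlocks A B 0 C with hM
  set P : Submodule K (Fin g → K) :=
    LinearMap.ker C.mulVecLin ⊓ (LinearMap.range A.mulVecLin).comap B.mulVecLin with hP
  have hPA : Module.finrank K P ≤ Module.finrank K (LinearMap.range A.mulVecLin) := by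
    let f : LinearMap.ker M.mulVecLin →ₗ[K] (Fin g → K) :=
      LinearMap.funLeft K K Sum.inr ∘ₗ (LinearMap.ker M.mulVecLin).subtype
    have h1 := LinearMap.finrank_range_add_finrank_ker f
    have h2 := card_sub_rank_eq M
    rw [Fintype.card_sum, Fintype.card_fin] at h2
    have h3 := card_sub_rank_eq A
    rw [Fintype.card_fin, Matrix.rank] at h3
    have hmem : ∀ u v : Fin g → K, Sum.elim u v ∈ LinearMap.ker M.mulVecLin ↔
        A.mulVec u + B.mulVec v = 0 ∧ C.mulVec v = 0 := by
      intro u v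
      rw [LinearMap.mem_ker, Matrix.mulVecLin_apply, hM, Matrix.fromBlocks_mulVec]
      simp only [Sum.elim_comp_inl, Sum.elim_comp_inr, Matrix.zero_mulVec, zero_add]
      constructor
      · intro e
        exact ⟨funext fun i => congrFun e (.inl i), funext fun i => congrFun e (.inr i)⟩
      · rintro ⟨e1, e2⟩
        rw [e1, e2]
        ext (i | i) <;> rfl
    have h4 : P ≤ LinearMap.range f := by
      rintro v ⟨hv1, u, hu⟩
      refine ⟨⟨Sum.elim (-u) v, (hmem _ _).2 ⟨?_, hv1⟩⟩, rfl⟩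
      rw [Matrix.mulVec_neg]
      have hu : A.mulVec u = B.mulVec v := hu
      rw [hu, neg_add_cancel]
    have h5 := Submodule.finrank_mono h4
    let ψ : LinearMap.ker A.mulVecLin →ₗ[K] LinearMap.ker f :=
      { toFun := fun u => ⟨⟨Sum.elim u.1 0, (hmem _ _).2 ⟨by
            have : A.mulVec u.1 = 0 := u.2
            rw [this, Matrix.mulVec_zero, add_zero], Matrix.mulVec_zero _⟩⟩, rfl⟩
        map_add' := fun u v => by
          apply Subtype.ext; apply Subtype.ext; ext (i | i) <;> simp
        map_smul' := fun u v => by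
          apply Subtype.ext; apply Subtype.ext; ext (i | i) <;> simp }
    have h6 : Module.finrank K (LinearMap.ker A.mulVecLin) ≤ Module.finrank K (LinearMap.ker f) :=
      LinearMap.finrank_le_finrank_of_injective (f := ψ) fun u v huv => by
        have := congrArg (fun w => w.1.1 ∘ Sum.inl) huv
        exact Subtype.ext (by simpa [ψ] using this)
    omega
  -- `γ₀` agrees with `B` on the complement of `P` that is the kernel of `π`, and maps `P` into the
  -- image of `A` by an injective map, so that it is injective on `ker C`.
  obtain ⟨j, hj⟩ := finrank_le_iff_exists_linearMap.1 hPA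
  obtain ⟨π, hπ⟩ := LinearMap.exists_leftInverse_of_injective P.subtype P.ker_subtype
  have hπ' : ∀ v (hv : v ∈ P), π v = ⟨v, hv⟩ := fun v hv => LinearMap.congr_fun hπ ⟨v, hv⟩
  let γ₀ : (Fin g → K) →ₗ[K] (Fin g → K) :=
    B.mulVecLin ∘ₗ (LinearMap.id - P.subtype ∘ₗ π) +
      (LinearMap.range A.mulVecLin).subtype ∘ₗ j ∘ₗ π
  have hγ₀ : ∀ v, γ₀ v = B.mulVec (v - (π v : Fin g → K)) + (j (π v) : Fin g → K) :=
    fun v => rfl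
  let γ := γ₀.domRestrict (LinearMap.ker C.mulVecLin)
  have hγ : Function.Injective γ := by
    rw [← LinearMap.ker_eq_bot, LinearMap.ker_eq_bot']
    rintro ⟨v, hv⟩ h0
    have h0 : γ₀ v = 0 := h0
    rw [hγ₀] at h0
    have hmem : v - (π v : Fin g → K) ∈ P := by
      refine Submodule.mem_inf.2 ⟨Submodule.sub_mem _ hv (Submodule.mem_inf.1 (π v).2).1, ?_⟩
      change B.mulVec (v - (π v : Fin g → K)) ∈ LinearMap.range A.mulVecLin
      rw [eq_neg_of_add_eq_zero_left h0]
      exact neg_mem (j (π v)).2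
    have e1 : v - (π v : Fin g → K) = 0 := by
      have := hπ' _ hmem
      rw [map_sub, hπ' _ (π v).2, sub_self] at this
      exact (congrArg Subtype.val this).symm
    rw [e1, Matrix.mulVec_zero, zero_add] at h0
    have e2 : π v = 0 := hj (by rw [map_zero]; exact Subtype.ext h0)
    rw [e2] at e1
    exact Subtype.ext (by simpa using e1)
  obtain ⟨β, hβ⟩ := Submodule.exists_linearEquiv_restrict_eq (LinearEquiv.ofInjective γ hγ)
  set b := LinearMap.toMatrix' β.toLinearMap with hb
  have hbu : IsUnit b := by
    refine IsUnit.of_mul_eq_one (LinearMap.toMatrix' β.symm.toLinearMap) ?_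
    rw [hb, ← LinearMap.toMatrix'_comp]
    simp
  have hbv : ∀ v, b.mulVec v = β v := fun v => by
    rw [hb, ← Matrix.toLin'_apply, Matrix.toLin'_toMatrix']; rfl
  -- The automorphism `b` extends the restriction of `γ₀` to `ker C`. On `ker C`, the difference
  -- `b - B` has values in the image of `A`, so that it is of the form `A x + y C`.
  obtain ⟨A', hA'⟩ := exists_mul_mul_eq_self A
  obtain ⟨C', hC'⟩ := exists_mul_mul_eq_self C
  have key : A * A' * ((b - B) * (1 - C' * C)) = (b - B) * (1 - C' * C) := by
    apply Matrix.toLin'.injective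
    ext1 v
    ext1
    simp only [LinearMap.coe_comp, Function.comp_apply, Matrix.toLin'_apply]
    set w : Fin g → K := (1 - C' * C).mulVec (LinearMap.single K (fun _ => K) v 1) with hw
    have hwC : w ∈ LinearMap.ker C.mulVecLin := by
      rw [LinearMap.mem_ker, Matrix.mulVecLin_apply, hw, Matrix.mulVec_mulVec, mul_sub, mul_one,
        ← mul_assoc, hC', sub_self, Matrix.zero_mulVec]
    have hr : (b - B).mulVec w ∈ LinearMap.range A.mulVecLin := by
      rw [Matrix.sub_mulVec, hbv, ← hβ ⟨w, hwC⟩]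
      change γ₀ w - _ ∈ LinearMap.range A.mulVecLin
      rw [hγ₀, Matrix.mulVec_sub]
      have e : B.mulVec w - B.mulVec (π w : Fin g → K) + (j (π w) : Fin g → K) - B.mulVec w
        = (j (π w) : Fin g → K) - B.mulVec (π w : Fin g → K) := by abel
      rw [e]
      exact sub_mem (j (π w)).2 (π w).2.2
    obtain ⟨u, hu⟩ := hr
    rw [← Matrix.mulVec_mulVec, ← Matrix.mulVec_mulVec (N := 1 - C' * C), ← hw, ← hu,
      Matrix.mulVecLin_apply, Matrix.mulVec_mulVec, hA']
  refine ⟨A' * ((b - B) * (1 - C' * C)), (b - B) * C', ?_⟩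
  have e : B + A * (A' * ((b - B) * (1 - C' * C))) + (b - B) * C' * C = b := by
    rw [← mul_assoc A, key]
    noncomm_ring
  rw [e]
  exact hbu

end Rank

/-! ### Ideals of minors -/

section Minors

variable {R : Type} [CommRing R]

/-- The determinant of a product is expanded along the rows of the left factor only. -/
theorem det_mul_eq_sum_prod_mul_det {m k : ℕ} (Y : Matrix (Fin k) (Fin m) R)
    (Z : Matrix (Fin m) (Fin k) R) :
    (Y * Z).det = ∑ f : Fin k → Fin m, (∏ i, Y i (f i)) * (Z.submatrix f id).det := by
  have h : (Y * Z).det = Matrix.detRowAlternating.toMultilinearMap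
      fun i => ∑ l, Y i l • (Z l : Fin k → R) := by
    change Matrix.det _ = Matrix.det _
    congr 1
    ext i j
    simp [Matrix.mul_apply]
  rw [h, MultilinearMap.map_sum]
  refine Finset.sum_congr rfl fun f _ => ?_
  rw [MultilinearMap.map_smul_univ]
  rfl

theorem det_submatrix_mem_minorIdeal {m k : ℕ} (M : Matrix (Fin m) (Fin m) R)
    (r c : Fin k ↪ Fin m) : (M.submatrix r c).det ∈ minorIdeal k M :=
  Ideal.subset_span ⟨r, c, rfl⟩

/-- Minors of a product are linear combinations of the minors of the right factor, by the
multilinearity of the determinant. -/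
theorem minorIdeal_mul_le_right {m : ℕ} (k : ℕ) (A B : Matrix (Fin m) (Fin m) R) :
    minorIdeal k (A * B) ≤ minorIdeal k B := by
  rw [minorIdeal, Ideal.span_le]
  rintro _ ⟨r, c, rfl⟩
  have h : (A * B).submatrix r c = A.submatrix r id * B.submatrix id c :=
    (Matrix.submatrix_mul_equiv A B r (Equiv.refl _) c).symm
  rw [h, det_mul_eq_sum_prod_mul_det]
  refine Ideal.sum_mem _ fun f _ => Ideal.mul_mem_left _ _ ?_
  by_cases hf : Function.Injective f
  · exact det_submatrix_mem_minorIdeal B ⟨f, hf⟩ c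
  · simp only [Function.Injective, not_forall] at hf
    obtain ⟨i, j, hij, hne⟩ := hf
    rw [Matrix.det_zero_of_row_eq hne (by ext l; simp [hij])]
    exact zero_mem _

theorem minorIdeal_transpose_le {m : ℕ} (k : ℕ) (A : Matrix (Fin m) (Fin m) R) :
    minorIdeal k A.transpose ≤ minorIdeal k A := by
  rw [minorIdeal, Ideal.span_le]
  rintro _ ⟨r, c, rfl⟩
  rw [← Matrix.det_transpose]
  exact det_submatrix_mem_minorIdeal A c r

theorem minorIdeal_mul_le_left {m : ℕ} (k : ℕ) (A B : Matrix (Fin m) (Fin m) R) :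
    minorIdeal k (A * B) ≤ minorIdeal k A := by
  have h := minorIdeal_transpose_le k (A * B).transpose
  rw [Matrix.transpose_transpose, Matrix.transpose_mul] at h
  exact h.trans ((minorIdeal_mul_le_right k _ _).trans (minorIdeal_transpose_le k A))

theorem minorIdeal_mul_mul_of_isUnit {m : ℕ} (k : ℕ) (A : Matrix (Fin m) (Fin m) R)
    {P Q : Matrix (Fin m) (Fin m) R} (hP : IsUnit P) (hQ : IsUnit Q) :
    minorIdeal k (P * A * Q) = minorIdeal k A := by
  apply le_antisymm
  · exact (minorIdeal_mul_le_left k _ _).trans (minorIdeal_mul_le_right k _ _)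
  · obtain ⟨P, rfl⟩ := hP
    obtain ⟨Q, rfl⟩ := hQ
    have e : A = (↑P⁻¹ : Matrix (Fin m) (Fin m) R) * (P.val * A * Q.val) *
        (↑Q⁻¹ : Matrix (Fin m) (Fin m) R) := by
      simp only [mul_assoc, Units.mul_inv, mul_one, Units.inv_mul_cancel_left]
    conv_lhs => rw [e]
    exact (minorIdeal_mul_le_left k _ _).trans (minorIdeal_mul_le_right k _ _)

theorem pow_mem_minorIdeal_smul_one {m k : ℕ} (hk : k ≤ m) (t : R) :
    t ^ k ∈ minorIdeal k (t • (1 : Matrix (Fin m) (Fin m) R)) := by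
  have h := det_submatrix_mem_minorIdeal (t • (1 : Matrix (Fin m) (Fin m) R))
    (Fin.castLEEmb hk) (Fin.castLEEmb hk)
  rw [Matrix.submatrix_smul, Pi.smul_apply, Pi.smul_apply,
    Matrix.submatrix_one _ (Fin.castLEEmb hk).injective, Matrix.det_smul, Matrix.det_one, mul_one,
    Fintype.card_fin] at h
  exact h

theorem minorIdeal_smul {m : ℕ} (k : ℕ) (a : R) (M : Matrix (Fin m) (Fin m) R) :
    minorIdeal k (a • M) = Ideal.span {a ^ k} * minorIdeal k M := by
  have h : ∀ r c : Fin k ↪ Fin m,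
      ((a • M).submatrix r c).det = a ^ k * (M.submatrix r c).det := fun r c => by
    rw [Matrix.submatrix_smul, Pi.smul_apply, Pi.smul_apply, Matrix.det_smul, Fintype.card_fin]
  apply le_antisymm
  · rw [minorIdeal, Ideal.span_le]
    rintro _ ⟨r, c, rfl⟩
    rw [h]
    exact Ideal.mul_mem_mul (Ideal.mem_span_singleton_self _) (det_submatrix_mem_minorIdeal M r c)
  · rw [Ideal.span_singleton_mul_le_iff]
    change minorIdeal k M ≤ Submodule.comap (LinearMap.lsmul R R (a ^ k)) (minorIdeal k (a • M))
    rw [minorIdeal, Ideal.span, Submodule.span_le]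
    rintro _ ⟨r, c, rfl⟩
    change a ^ k * _ ∈ minorIdeal k (a • M)
    rw [← h]
    exact det_submatrix_mem_minorIdeal _ r c

theorem minorIdeal_card {m : ℕ} (M : Matrix (Fin m) (Fin m) R) :
    minorIdeal m M = Ideal.span {M.det} := by
  apply le_antisymm
  · rw [minorIdeal, Ideal.span_le]
    rintro _ ⟨r, c, rfl⟩
    let r' := Equiv.ofBijective r (Finite.injective_iff_bijective.1 r.injective)
    let c' := Equiv.ofBijective c (Finite.injective_iff_bijective.1 c.injective)
    have h : M.submatrix r c = (M.submatrix id (r'.symm.trans c')).submatrix r' r' := by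
      ext i j
      simp only [Matrix.submatrix_apply, id, Equiv.trans_apply, Equiv.symm_apply_apply]
      rfl
    rw [h, Matrix.det_submatrix_equiv_self, Matrix.det_permute']
    exact Ideal.mul_mem_left _ _ (Ideal.mem_span_singleton_self _)
  · rw [Ideal.span_singleton_le_iff_mem]
    exact det_submatrix_mem_minorIdeal M (Function.Embedding.refl _) (Function.Embedding.refl _)

end Minors

/-! ### Elementary divisors over a local ring -/

section Smith

variable {R : Type} [CommRing R]

/-- The bijection `1 + n = n + 1` that puts the single element first. -/
def oneSumEquiv (n : ℕ) : Fin 1 ⊕ Fin n ≃ Fin (n + 1) :=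
  finSumFinEquiv.trans (finCongr (add_comm 1 n))

theorem oneSumEquiv_symm_zero (n : ℕ) : (oneSumEquiv n).symm 0 = .inl 0 := by
  rw [Equiv.symm_apply_eq]; rfl

theorem oneSumEquiv_symm_succ {n : ℕ} (i : Fin n) : (oneSumEquiv n).symm i.succ = .inr i := by
  rw [Equiv.symm_apply_eq]
  apply Fin.ext
  simp [oneSumEquiv]

/-- The block diagonal matrix with blocks `1`, of size one, and `M`. -/
def consOne {n : ℕ} (M : Matrix (Fin n) (Fin n) R) : Matrix (Fin (n + 1)) (Fin (n + 1)) R :=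
  (Matrix.fromBlocks (1 : Matrix (Fin 1) (Fin 1) R) 0 0 M).submatrix (oneSumEquiv n).symm
    (oneSumEquiv n).symm

theorem consOne_zero_zero {n : ℕ} (M : Matrix (Fin n) (Fin n) R) : consOne M 0 0 = 1 := by
  simp [consOne, oneSumEquiv_symm_zero]

theorem consOne_zero_succ {n : ℕ} (M : Matrix (Fin n) (Fin n) R) (j : Fin n) :
    consOne M 0 j.succ = 0 := by
  simp [consOne, oneSumEquiv_symm_zero, oneSumEquiv_symm_succ]

theorem consOne_succ_zero {n : ℕ} (M : Matrix (Fin n) (Fin n) R) (i : Fin n) :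
    consOne M i.succ 0 = 0 := by
  simp [consOne, oneSumEquiv_symm_zero, oneSumEquiv_symm_succ]

theorem consOne_succ_succ {n : ℕ} (M : Matrix (Fin n) (Fin n) R) (i j : Fin n) :
    consOne M i.succ j.succ = M i j := by
  simp [consOne, oneSumEquiv_symm_succ]

theorem consOne_mul {n : ℕ} (M M' : Matrix (Fin n) (Fin n) R) :
    consOne (M * M') = consOne M * consOne M' := by
  rw [consOne, consOne, consOne, Matrix.submatrix_mul_equiv, Matrix.fromBlocks_multiply]
  simp

theorem consOne_one {n : ℕ} : consOne (1 : Matrix (Fin n) (Fin n) R) = 1 := by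
  rw [consOne, Matrix.fromBlocks_one, Matrix.submatrix_one_equiv]

theorem isUnit_consOne {n : ℕ} {M : Matrix (Fin n) (Fin n) R} (h : IsUnit M) :
    IsUnit (consOne M) := by
  obtain ⟨u, rfl⟩ := h
  refine IsUnit.of_mul_eq_one (consOne (↑u⁻¹ : Matrix (Fin n) (Fin n) R)) ?_
  rw [← consOne_mul, Units.mul_inv, consOne_one]

/-- A matrix with an invertible entry is equivalent to a block diagonal one with a block `1`. -/
theorem exists_mul_mul_eq_consOne {n : ℕ} (M : Matrix (Fin (n + 1)) (Fin (n + 1)) R)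
    (i j : Fin (n + 1)) (h : IsUnit (M i j)) :
    ∃ P Q, IsUnit P ∧ IsUnit Q ∧ ∃ M' : Matrix (Fin n) (Fin n) R, P * M * Q = consOne M' := by
  -- After permutations, the unit is in the corner; the complementary block is a Schur complement.
  set e := oneSumEquiv n
  set σ : Fin 1 ⊕ Fin n ≃ Fin (n + 1) := e.trans (Equiv.swap 0 i) with hσ
  set τ : Fin 1 ⊕ Fin n ≃ Fin (n + 1) := e.trans (Equiv.swap 0 j) with hτ
  have e0 : ∀ x : Fin 1, e (.inl x) = 0 := fun x => by
    rw [Subsingleton.elim x 0]; rfl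
  set Z := M.submatrix σ τ with hZ
  obtain ⟨u, hu⟩ := h
  have h11 : Z.toBlocks₁₁ = (u : R) • 1 := by
    ext x y
    rw [hu, Subsingleton.elim y x]
    simp [hZ, hσ, hτ, Matrix.toBlocks₁₁, e0]
  let iA : Invertible Z.toBlocks₁₁ :=
    ⟨(↑u⁻¹ : R) • 1, by rw [h11]; simp [smul_smul], by rw [h11]; simp [smul_smul]⟩
  have hZ2 := Matrix.fromBlocks_eq_of_invertible₁₁ Z.toBlocks₁₁ Z.toBlocks₁₂ Z.toBlocks₂₁
    Z.toBlocks₂₂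
  rw [Matrix.fromBlocks_toBlocks] at hZ2
  obtain ⟨V, hV⟩ : ∃ V, V = ⅟Z.toBlocks₁₁ := ⟨_, rfl⟩
  have hVZ : V * Z.toBlocks₁₁ = 1 := by rw [hV, invOf_mul_self]
  have hZV : Z.toBlocks₁₁ * V = 1 := by rw [hV, mul_invOf_self]
  rw [← hV] at hZ2
  set S := Z.toBlocks₂₂ - Z.toBlocks₂₁ * V * Z.toBlocks₁₂
  set c := Z.toBlocks₂₁ * V
  set r := V * Z.toBlocks₁₂
  set L : Matrix (Fin 1 ⊕ Fin n) (Fin 1 ⊕ Fin n) R := Matrix.fromBlocks (V) 0 0 1 *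
    Matrix.fromBlocks 1 0 (-c) 1 with hL
  set L' : Matrix (Fin 1 ⊕ Fin n) (Fin 1 ⊕ Fin n) R := Matrix.fromBlocks 1 0 c 1 *
    Matrix.fromBlocks (Z.toBlocks₁₁) 0 0 1 with hL'
  set U : Matrix (Fin 1 ⊕ Fin n) (Fin 1 ⊕ Fin n) R := Matrix.fromBlocks 1 (-r) 0 1 with hU
  have hLL : L * L' = 1 := by
    rw [hL, hL', mul_assoc, ← mul_assoc (Matrix.fromBlocks 1 0 (-c) 1)]
    simp [Matrix.fromBlocks_multiply, Matrix.fromBlocks_one, hVZ]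
  have hUU : U * Matrix.fromBlocks 1 r 0 1 = 1 := by
    simp [hU, Matrix.fromBlocks_multiply, Matrix.fromBlocks_one]
  have hLZU : L * Z * U = Matrix.fromBlocks 1 0 0 S := by
    rw [hZ2, hL, hU]
    simp [Matrix.fromBlocks_multiply, hVZ, ← Matrix.mul_assoc]
  refine ⟨L.submatrix e.symm σ.symm, U.submatrix τ.symm e.symm, ?_, ?_, S, ?_⟩
  · refine IsUnit.of_mul_eq_one (L'.submatrix σ.symm e.symm) ?_
    rw [Matrix.submatrix_mul_equiv, hLL, Matrix.submatrix_one_equiv]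
  · refine IsUnit.of_mul_eq_one ((Matrix.fromBlocks 1 r 0 1).submatrix e.symm τ.symm) ?_
    have := mul_eq_one_comm.1 hUU
    apply mul_eq_one_comm.1
    rw [Matrix.submatrix_mul_equiv, this, Matrix.submatrix_one_equiv]
  · have hM : M = Z.submatrix σ.symm τ.symm := by
      ext a b
      simp [hZ]
    rw [hM, Matrix.submatrix_mul_equiv, Matrix.submatrix_mul_equiv, hLZU]
    rfl

theorem det_submatrix_consOne_mem {n k : ℕ} (M : Matrix (Fin n) (Fin n) R)
    (r c : Fin k ↪ Fin (n + 1)) (hr : ∀ i, r i ≠ 0) :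
    ((consOne M).submatrix r c).det ∈ minorIdeal k M := by
  choose r' hr' using fun i => Fin.exists_succ_eq.2 (hr i)
  by_cases hc : ∃ j, c j = 0
  · obtain ⟨j, hj⟩ := hc
    rw [Matrix.det_eq_zero_of_column_eq_zero j]
    · exact zero_mem _
    · intro i
      rw [Matrix.submatrix_apply, hj, ← hr', consOne_succ_zero]
  · push Not at hc
    choose c' hc' using fun i => Fin.exists_succ_eq.2 (hc i)
    have e : (consOne M).submatrix r c = M.submatrix r' c' := by
      ext i j
      rw [Matrix.submatrix_apply, ← hr', ← hc', consOne_succ_succ, Matrix.submatrix_apply]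
    rw [e]
    refine det_submatrix_mem_minorIdeal M ⟨r', fun i j h => ?_⟩ ⟨c', fun i j h => ?_⟩
    · exact r.injective (by rw [← hr', ← hr', h])
    · exact c.injective (by rw [← hc', ← hc', h])

/-- The embedding obtained from `r` by adding `0` as a new first value. -/
def consZeroEmb {n k : ℕ} (r : Fin k ↪ Fin n) : Fin (k + 1) ↪ Fin (n + 1) where
  toFun := Fin.cons 0 fun i => (r i).succ
  inj' := Fin.cons_injective_iff.2 ⟨by rintro ⟨i, hi⟩; exact Fin.succ_ne_zero _ hi,
    fun i j h => r.injective (Fin.succ_injective _ h)⟩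

/-- Splitting off a block `1` shifts the sizes of the minors by one. -/
theorem minorIdeal_consOne {n : ℕ} (k : ℕ) (M : Matrix (Fin n) (Fin n) R) :
    minorIdeal (k + 1) (consOne M) = minorIdeal k M := by
  apply le_antisymm
  · rw [minorIdeal, Ideal.span_le]
    rintro _ ⟨r, c, rfl⟩
    -- Expanding along the row of the block `1`, if it is involved, leaves minors of `M`.
    obtain ⟨p, hp⟩ : ∃ p : Fin (k + 1), ∀ i, r (p.succAbove i) ≠ 0 := by
      by_cases h : ∃ p, r p = 0
      · obtain ⟨p, hp⟩ := h
        exact ⟨p, fun i hi => Fin.succAbove_ne p i (r.injective (hi.trans hp.symm))⟩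
      · push Not at h
        exact ⟨0, fun i => h _⟩
    rw [Matrix.det_succ_row _ p]
    refine Ideal.sum_mem _ fun j _ => Ideal.mul_mem_left _ _ ?_
    exact det_submatrix_consOne_mem M (p.succAboveEmb.trans r) (j.succAboveEmb.trans c) hp
  · rw [minorIdeal, Ideal.span_le]
    rintro _ ⟨r, c, rfl⟩
    have h := det_submatrix_mem_minorIdeal (consOne M) (consZeroEmb r) (consZeroEmb c)
    rw [Matrix.det_succ_row_zero, Fin.sum_univ_succ] at h
    have e0 : ∀ x : Fin k, (consOne M).submatrix (consZeroEmb r) (consZeroEmb c) 0 x.succ = 0 :=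
      fun x => consOne_zero_succ M _
    have e1 : (consOne M).submatrix (consZeroEmb r) (consZeroEmb c) 0 0 = 1 := consOne_zero_zero M
    have e2 : ((consOne M).submatrix (consZeroEmb r) (consZeroEmb c)).submatrix Fin.succ
        (Fin.succAbove 0) = M.submatrix r c := by
      ext i j
      simp only [Fin.succAbove_zero]
      exact consOne_succ_succ M _ _
    simp only [e0, e1, mul_zero, zero_mul, Finset.sum_const_zero, add_zero, Fin.val_zero, pow_zero,
      one_mul] at h
    rw [e2] at h
    exact h

/-- If the ideal of entries is generated by a nonzerodivisor, over a local ring, then it is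
generated by an entry. -/
theorem exists_smul_eq_of_minorIdeal_one [IsLocalRing R] {n : ℕ}
    (A : Matrix (Fin n) (Fin n) R) {a : R} (ha : a ∈ nonZeroDivisors R)
    (h : minorIdeal 1 A = Ideal.span {a}) :
    ∃ A₀ : Matrix (Fin n) (Fin n) R, A = a • A₀ ∧ ∃ i j, IsUnit (A₀ i j) := by
  have hdvd : ∀ i j, a ∣ A i j := fun i j => by
    rw [← Ideal.mem_span_singleton, ← h]
    have := det_submatrix_mem_minorIdeal A
      ⟨fun _ : Fin 1 => i, fun _ _ _ => Subsingleton.elim _ _⟩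
      ⟨fun _ : Fin 1 => j, fun _ _ _ => Subsingleton.elim _ _⟩
    rwa [Matrix.det_fin_one] at this
  choose A₀ hA₀ using hdvd
  refine ⟨Matrix.of A₀, by ext i j; exact hA₀ i j, ?_⟩
  by_contra! hu
  have hle : minorIdeal 1 A ≤ Ideal.span {a} * IsLocalRing.maximalIdeal R := by
    rw [minorIdeal, Ideal.span_le]
    rintro _ ⟨r, c, rfl⟩
    rw [Matrix.det_fin_one, Matrix.submatrix_apply, hA₀]
    exact Ideal.mul_mem_mul (Ideal.mem_span_singleton_self _)
      ((IsLocalRing.mem_maximalIdeal _).2 (hu _ _))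
  rw [h] at hle
  obtain ⟨z, hz, haz⟩ := Ideal.mem_span_singleton_mul.1 (hle (Ideal.mem_span_singleton_self a))
  have h1 : z = 1 := by
    rw [← mul_cancel_left_mem_nonZeroDivisors ha, haz, mul_one]
  exact (IsLocalRing.mem_maximalIdeal _).1 hz (h1 ▸ isUnit_one)

/-- Over a local ring, a square matrix all of whose ideals of minors are generated by
nonzerodivisors is equivalent to a diagonal matrix whose entries form a divisor chain. -/
theorem exists_mul_mul_eq_diagonal [IsLocalRing R] {n : ℕ} (A : Matrix (Fin n) (Fin n) R)
    (h : ∀ k, 1 ≤ k → k ≤ n → ∃ a ∈ nonZeroDivisors R, minorIdeal k A = Ideal.span {a}) :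
    ∃ P Q, IsUnit P ∧ IsUnit Q ∧ ∃ D : Fin n → R, P * A * Q = Matrix.diagonal D ∧
      ∀ i j, i ≤ j → D i ∣ D j := by
  induction n with
  | zero => exact ⟨1, 1, isUnit_one, isUnit_one, 0, Subsingleton.elim _ _, fun i => i.elim0⟩
  | succ n ih =>
    obtain ⟨a, ha, h1⟩ := h 1 le_rfl (Nat.succ_le_succ (Nat.zero_le n))
    obtain ⟨A₀, rfl, i, j, hij⟩ := exists_smul_eq_of_minorIdeal_one A ha h1
    obtain ⟨P, Q, hP, hQ, A₁, hA₁⟩ := exists_mul_mul_eq_consOne A₀ i j hij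
    -- Hence the ideals of minors of the complementary block `A₁` are again principal.
    have key : ∀ k, minorIdeal (k + 1) (a • A₀) = Ideal.span {a ^ (k + 1)} * minorIdeal k A₁ :=
      fun k => by
        rw [minorIdeal_smul, ← minorIdeal_mul_mul_of_isUnit _ A₀ hP hQ, hA₁, minorIdeal_consOne]
    obtain ⟨P', Q', hP', hQ', D, hD, hdvd⟩ := ih A₁ fun k hk hkn => by
      obtain ⟨m, hm, hmk⟩ := h (k + 1) (by omega) (by omega)
      rw [key] at hmk
      obtain ⟨b, hb, hab⟩ := Ideal.mem_span_singleton_mul.1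
        (hmk.symm ▸ Ideal.mem_span_singleton_self m)
      refine ⟨b, ?_, le_antisymm (fun x hx => ?_) ?_⟩
      · rw [← hab] at hm
        exact (mul_mem_nonZeroDivisors.1 hm).2
      · have hx' : a ^ (k + 1) * x ∈ Ideal.span {m} := by
          rw [← hmk]
          exact Ideal.mul_mem_mul (Ideal.mem_span_singleton_self _) hx
        obtain ⟨y, hy⟩ := Ideal.mem_span_singleton.1 hx'
        rw [Ideal.mem_span_singleton]
        refine ⟨y, ?_⟩
        rw [← hab, mul_assoc] at hy
        exact (mul_cancel_left_mem_nonZeroDivisors (pow_mem ha _)).1 hy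
      · rwa [Ideal.span_singleton_le_iff_mem]
    refine ⟨consOne P' * P, Q * consOne Q', (isUnit_consOne hP').mul hP,
      hQ.mul (isUnit_consOne hQ'), Fin.cons a fun i => a * D i, ?_, ?_⟩
    · have e : consOne P' * P * (a • A₀) * (Q * consOne Q') = a • consOne (Matrix.diagonal D) := by
        rw [← hD, consOne_mul, consOne_mul, ← hA₁]
        simp only [Matrix.mul_smul, Matrix.smul_mul, mul_assoc]
      rw [e]
      ext i j
      refine Fin.cases ?_ (fun i => ?_) i <;> refine Fin.cases ?_ (fun j => ?_) j
      · simp [consOne_zero_zero]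
      · simp [consOne_zero_succ, (Fin.succ_ne_zero j).symm]
      · simp [consOne_succ_zero]
      · simp [consOne_succ_succ, Matrix.diagonal_apply]
    · intro i j
      refine Fin.cases (fun _ => ?_) (fun i => ?_) i <;> refine Fin.cases ?_ (fun j => ?_) j
      · exact dvd_rfl
      · exact ⟨D j, by simp⟩
      · intro hle
        exact absurd hle (by simp)
      · intro hle
        simpa using mul_dvd_mul_left a (hdvd i j (Fin.succ_le_succ_iff.1 hle))

end Smith

/-! ### Normal forms of pairs of block matrices -/

section Normal

variable {A : Type} [CommRing A] {g : ℕ}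

/-- A normalization of a pair of maps `M : V_0 ⟶ V_N` and `T : V_N ⟶ V_0` of the Lie algebra `𝔓`:
elements `h false` and `h true` of `P`, with inverses `h'`, that change the bases of `V_0` and of
`V_N` in such a way that `M` becomes `(D 1; 0 C)` and `T` becomes `(-C 1; 0 -D)`, where `D` and `C`
are diagonal and the entries of `D` form a divisor chain. The relations between the diagonal entries
that hold when `M T = T M = t` is a nonzerodivisor are recorded as well. -/
structure NormalData (t : A) (M T : Matrix (Idx g) (Idx g) A) where
  h : Bool → Matrix (Idx g) (Idx g) A
  h' : Bool → Matrix (Idx g) (Idx g) A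
  D : Fin g → A
  C : Fin g → A
  q : Fin g → Fin g → A
  h_mul : ∀ e, h e * h' e = 1
  h_low : ∀ e, (h e).toBlocks₂₁ = 0
  h'_low : ∀ e, (h' e).toBlocks₂₁ = 0
  left_eq : h' true * M * h false =
    Matrix.fromBlocks (Matrix.diagonal D) 1 0 (Matrix.diagonal C)
  right_eq : h' false * T * h true =
    Matrix.fromBlocks (-Matrix.diagonal C) 1 0 (-Matrix.diagonal D)
  D_mul_C : ∀ i, D i * C i = -t
  D_eq : ∀ i j, i ≤ j → D j = q i j * D i
  C_eq : ∀ i j, i ≤ j → C i = q i j * C j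

theorem fromBlocks_of_lower_eq_zero {M : Matrix (Idx g) (Idx g) A} (h : M.toBlocks₂₁ = 0) :
    M = Matrix.fromBlocks M.toBlocks₁₁ M.toBlocks₁₂ 0 M.toBlocks₂₂ := by
  conv_lhs => rw [← Matrix.fromBlocks_toBlocks M, h]

theorem isUnit_of_card_le_rank {K : Type} [Field K] {n : Type} [Fintype n] [DecidableEq n]
    {M : Matrix n n K} (h : Fintype.card n ≤ M.rank) : IsUnit M := by
  rw [← Matrix.mulVec_injective_iff_isUnit]
  have h1 := card_sub_rank_eq M
  have h2 : Module.finrank K (LinearMap.ker M.mulVecLin) = 0 := by omega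
  exact LinearMap.ker_eq_bot.1 (Submodule.finrank_eq_zero.1 h2)

/-- If `M T = T M` is scalar and the block `B` of `M` is invertible, then the block `B'` of `T` is
invertible as soon as `T` has at least half the maximal rank: either the scalar is nonzero, or `T`
factors through `B'`. -/
theorem isUnit_of_le_rank {K : Type} [Field K] {A B C A' B' C' : Matrix (Fin g) (Fin g) K} {t : K}
    (hB : IsUnit B) (h1 : A * A' = t • 1) (h2 : A * B' + B * C' = 0) (h3 : A' * B + B' * C = 0)
    (hr : g ≤ (Matrix.fromBlocks A' B' 0 C').rank) : IsUnit B' := by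
  obtain ⟨b, rfl⟩ := hB
  by_cases ht : t = 0
  · subst ht
    rw [zero_smul] at h1
    have hA' : A' = B' * (-(C * (b⁻¹).val)) := by
      have : A' * b.val = -(B' * C) := eq_neg_of_add_eq_zero_left h3
      rw [mul_neg, ← mul_assoc, ← neg_mul, ← this, Units.mul_inv_cancel_right]
    have hC' : C' = -((b⁻¹).val * A) * B' := by
      have : b.val * C' = -(A * B') := eq_neg_of_add_eq_zero_right h2
      rw [neg_mul, mul_assoc, ← mul_neg, ← this, Units.inv_mul_cancel_left]
    have e : Matrix.fromBlocks A' B' 0 C' = Matrix.fromRows 1 (-((b⁻¹).val * A)) * B' *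
        Matrix.fromCols (-(C * (b⁻¹).val)) 1 := by
      rw [Matrix.fromRows_mul, Matrix.fromRows_mul_fromCols, one_mul, ← hC', mul_one, mul_one,
        ← hA']
      congr 1
      rw [hC', mul_assoc, ← hA', neg_mul, mul_assoc, h1, mul_zero, neg_zero]
    apply isUnit_of_card_le_rank
    rw [Fintype.card_fin]
    rw [e] at hr
    exact hr.trans ((Matrix.rank_mul_le_left _ _).trans (Matrix.rank_mul_le_right _ _))
  · have hA' : IsUnit A' := by
      rw [Matrix.isUnit_iff_isUnit_det]
      have := congrArg Matrix.det h1
      rw [Matrix.det_mul, Matrix.det_smul, Matrix.det_one, mul_one] at this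
      exact isUnit_of_mul_isUnit_right (this ▸ (IsUnit.mk0 _ (pow_ne_zero _ ht)))
    have h4 : IsUnit (B' * C) := by
      rw [eq_neg_of_add_eq_zero_right h3]
      exact (hA'.mul b.isUnit).neg
    rw [Matrix.isUnit_iff_isUnit_det] at h4 ⊢
    rw [Matrix.det_mul] at h4
    exact isUnit_of_mul_isUnit_left h4

theorem isUnit_of_isUnit_map {R S : Type} [CommRing R] [CommRing S] (f : R →+* S) [IsLocalHom f]
    {n : Type} [Fintype n] [DecidableEq n] {M : Matrix n n R} (h : IsUnit (M.map f)) :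
    IsUnit M := by
  rw [Matrix.isUnit_iff_isUnit_det] at h ⊢
  rw [← RingHom.mapMatrix_apply, ← RingHom.map_det] at h
  exact (isUnit_map_iff f _).1 h

/-- The normal form of a pair whose upper right blocks are invertible and whose block `A` is
equivalent to a diagonal matrix. -/
theorem nonempty_normalData_of_isUnit {a B C A' B' C' : Matrix (Fin g) (Fin g) A} {t : A}
    (ht : t ∈ nonZeroDivisors A)
    (hMT : Matrix.fromBlocks a B 0 C * Matrix.fromBlocks A' B' 0 C' = t • 1)
    (hTM : Matrix.fromBlocks A' B' 0 C' * Matrix.fromBlocks a B 0 C = t • 1)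
    (hB : IsUnit B) (hB' : IsUnit B') {P Q : Matrix (Fin g) (Fin g) A} (hP : IsUnit P)
    (hQ : IsUnit Q) {D : Fin g → A} (hD : P * a * Q = Matrix.diagonal D)
    (hdvd : ∀ i j, i ≤ j → D i ∣ D j) :
    Nonempty (NormalData t (Matrix.fromBlocks a B 0 C) (Matrix.fromBlocks A' B' 0 C')) := by
  obtain ⟨P, rfl⟩ := hP
  obtain ⟨Q, rfl⟩ := hQ
  obtain ⟨B, rfl⟩ := hB
  obtain ⟨B', rfl⟩ := hB'
  have q : ∀ i j, ∃ c, i ≤ j → D j = c * D i := fun i j => by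
    by_cases hij : i ≤ j
    · obtain ⟨c, hc⟩ := hdvd i j hij
      exact ⟨c, fun _ => by rw [hc, mul_comm]⟩
    · exact ⟨0, fun h => absurd h hij⟩
  choose q hq using q
  -- The Levi parts of the changes of basis of `V_0` and `V_N`; the lower blocks are forced by the
  -- normalization of the upper right blocks.
  set h := Matrix.fromBlocks Q.val 0 0 (B⁻¹ * P⁻¹).val with hh
  set h' := Matrix.fromBlocks (Q⁻¹).val 0 0 (P * B).val with hh'
  set k := Matrix.fromBlocks (P⁻¹).val 0 0 (B'⁻¹ * Q).val with hk
  set k' := Matrix.fromBlocks P.val 0 0 (Q⁻¹ * B').val with hk'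
  have hhh : h * h' = 1 := by
    simp [hh, hh', Matrix.fromBlocks_multiply, Matrix.mul_assoc, Matrix.fromBlocks_one]
  have hkk : k * k' = 1 := by
    simp [hk, hk', Matrix.fromBlocks_multiply, Matrix.mul_assoc, Matrix.fromBlocks_one]
  set C₁ := (Q⁻¹ * B').val * C * (B⁻¹ * P⁻¹).val with hC₁
  set X := (Q⁻¹).val * A' * (P⁻¹).val with hX
  set Y := (P * B).val * C' * (B'⁻¹ * Q).val with hY
  have eM : k' * Matrix.fromBlocks a B.val 0 C * h =
      Matrix.fromBlocks (Matrix.diagonal D) 1 0 C₁ := by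
    rw [hk', hh, Matrix.fromBlocks_multiply, Matrix.fromBlocks_multiply, hC₁, ← hD]
    simp [Matrix.mul_assoc]
  have eT : h' * Matrix.fromBlocks A' B'.val 0 C' * k = Matrix.fromBlocks X 1 0 Y := by
    rw [hk, hh', Matrix.fromBlocks_multiply, Matrix.fromBlocks_multiply, hX, hY]
    simp [Matrix.mul_assoc]
  have hhh' : h' * h = 1 := mul_eq_one_comm.1 hhh
  have hkk' : k' * k = 1 := mul_eq_one_comm.1 hkk
  have r1 : Matrix.fromBlocks (Matrix.diagonal D) 1 0 C₁ * Matrix.fromBlocks X 1 0 Y = t • 1 := by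
    rw [← eM, ← eT]
    calc _ = k' * Matrix.fromBlocks a B.val 0 C * (h * h') *
          Matrix.fromBlocks A' B'.val 0 C' * k := by simp only [Matrix.mul_assoc]
      _ = _ := by
        rw [hhh, mul_one, mul_assoc k', hMT, Matrix.mul_smul, mul_one, Matrix.smul_mul, hkk']
  have r2 : Matrix.fromBlocks X 1 0 Y * Matrix.fromBlocks (Matrix.diagonal D) 1 0 C₁ = t • 1 := by
    rw [← eM, ← eT]
    calc _ = h' * Matrix.fromBlocks A' B'.val 0 C' * (k * k') *
          Matrix.fromBlocks a B.val 0 C * h := by simp only [Matrix.mul_assoc]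
      _ = _ := by
        rw [hkk, mul_one, mul_assoc h', hTM, Matrix.mul_smul, mul_one, Matrix.smul_mul, hhh']
  rw [Matrix.fromBlocks_multiply, ← Matrix.fromBlocks_one, Matrix.fromBlocks_smul,
    Matrix.fromBlocks_inj] at r1 r2
  simp only [mul_one, one_mul, mul_zero, zero_mul, add_zero, smul_zero] at r1 r2
  -- The upper right blocks of both products determine the diagonal blocks of the second matrix.
  have hY' : Y = -Matrix.diagonal D := eq_neg_of_add_eq_zero_right r1.2.1
  have hX' : X = -C₁ := eq_neg_of_add_eq_zero_left r2.2.1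
  have hDC : ∀ i j, D i * C₁ i j = if i = j then -t else 0 := fun i j => by
    have := congrFun (congrFun r1.1 i) j
    rw [hX', mul_neg, Matrix.neg_apply, Matrix.diagonal_mul, Matrix.smul_apply,
      Matrix.one_apply] at this
    rw [neg_eq_iff_eq_neg.1 this]
    split_ifs <;> simp
  have hDn : ∀ i, D i ∈ nonZeroDivisors A := fun i => by
    have := hDC i i
    rw [if_pos rfl] at this
    have h2 : D i * C₁ i i ∈ nonZeroDivisors A := by
      rw [this, ← neg_one_mul]
      exact mul_mem isUnit_one.neg.mem_nonZeroDivisors ht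
    exact (mul_mem_nonZeroDivisors.1 h2).1
  have hC : C₁ = Matrix.diagonal fun i => C₁ i i := by
    ext i j
    by_cases hij : i = j
    · subst hij; simp
    · rw [Matrix.diagonal_apply_ne _ hij]
      have := hDC i j
      rw [if_neg hij] at this
      exact (mul_right_mem_nonZeroDivisors_eq_zero_iff (hDn i)).1 ((mul_comm _ _).trans this)
  refine ⟨{ h := fun e => bif e then k else h, h' := fun e => bif e then k' else h', D := D,
            C := fun i => C₁ i i, q := q, h_mul := ?_, h_low := ?_, h'_low := ?_, left_eq := ?_,
            right_eq := ?_, D_mul_C := ?_, D_eq := hq, C_eq := ?_ }⟩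
  · rintro (_ | _)
    exacts [hhh, hkk]
  · rintro (_ | _) <;> exact Matrix.toBlocks_fromBlocks₂₁ _ _ _ _
  · rintro (_ | _) <;> exact Matrix.toBlocks_fromBlocks₂₁ _ _ _ _
  · rw [← hC]
    exact eM
  · rw [← hC, ← hX', ← hY']
    exact eT
  · intro i
    rw [hDC, if_pos rfl]
  · intro i j hij
    rw [← mul_cancel_left_mem_nonZeroDivisors (hDn i), hDC, if_pos rfl, ← mul_assoc,
      mul_comm (D i), ← hq i j hij, hDC, if_pos rfl]

/-- Normal data for a translate of a pair by elements of `P`. -/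
def NormalData.ofTranslate {t : A} {M T : Matrix (Idx g) (Idx g) A}
    (u u' : Bool → Matrix (Idx g) (Idx g) A) (hu : ∀ e, u e * u' e = 1)
    (hl : ∀ e, (u e).toBlocks₂₁ = 0) (hl' : ∀ e, (u' e).toBlocks₂₁ = 0)
    (d : NormalData t (u' true * M * u false) (u' false * T * u true)) : NormalData t M T where
  h e := u e * d.h e
  h' e := d.h' e * u' e
  D := d.D
  C := d.C
  q := d.q
  h_mul e := by
    rw [← mul_assoc, mul_assoc (u e), d.h_mul, mul_one, hu]
  h_low e := by
    rw [fromBlocks_of_lower_eq_zero (hl e), fromBlocks_of_lower_eq_zero (d.h_low e),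
      Matrix.fromBlocks_multiply, Matrix.toBlocks_fromBlocks₂₁]
    simp
  h'_low e := by
    rw [fromBlocks_of_lower_eq_zero (hl' e), fromBlocks_of_lower_eq_zero (d.h'_low e),
      Matrix.fromBlocks_multiply, Matrix.toBlocks_fromBlocks₂₁]
    simp
  left_eq := by rw [← d.left_eq]; simp only [mul_assoc]
  right_eq := by rw [← d.right_eq]; simp only [mul_assoc]
  D_mul_C := d.D_mul_C
  D_eq := d.D_eq
  C_eq := d.C_eq

/-- Over a local ring, a pair of maps `M` and `T` of `𝔓` with `M T = T M = t` can be normalized if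
both have at least half the maximal rank at the closed point and, in each size, one of the minors of
the upper left block of `M` divides all the others. -/
theorem nonempty_normalData [IsLocalRing A] {t : A} (ht : t ∈ nonZeroDivisors A)
    {M T : Matrix (Idx g) (Idx g) A} (hM : M.toBlocks₂₁ = 0) (hT : T.toBlocks₂₁ = 0)
    (hMT : M * T = t • 1) (hTM : T * M = t • 1)
    (hMr : g ≤ (M.map (IsLocalRing.residue A)).rank)
    (hTr : g ≤ (T.map (IsLocalRing.residue A)).rank)
    (hm : ∀ k, 1 ≤ k → k ≤ g - 1 → ∃ r c : Fin k ↪ Fin g, ∀ r' c' : Fin k ↪ Fin g,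
      (M.toBlocks₁₁.submatrix r c).det ∣ (M.toBlocks₁₁.submatrix r' c').det) :
    Nonempty (NormalData t M T) := by
  set res := IsLocalRing.residue A
  obtain ⟨a, B, C, rfl⟩ : ∃ a B C, M = Matrix.fromBlocks a B 0 C :=
    ⟨_, _, _, fromBlocks_of_lower_eq_zero hM⟩
  obtain ⟨a', B', C', rfl⟩ : ∃ a B C, T = Matrix.fromBlocks a B 0 C :=
    ⟨_, _, _, fromBlocks_of_lower_eq_zero hT⟩
  rw [Matrix.toBlocks_fromBlocks₁₁] at hm
  rw [Matrix.fromBlocks_map, Matrix.map_zero _ (map_zero res)] at hMr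
  obtain ⟨x₀, y₀, hxy⟩ := exists_isUnit_add_mul_add_mul _ _ _ hMr
  have hlift : ∀ z : Matrix (Fin g) (Fin g) (IsLocalRing.ResidueField A),
      ∃ x : Matrix (Fin g) (Fin g) A, x.map res = z := fun z => by
    choose x hx using fun i j => IsLocalRing.residue_surjective (z i j)
    exact ⟨Matrix.of x, by ext i j; exact hx i j⟩
  -- Unipotent changes of basis make `B` invertible, without changing `A` and `C`.
  obtain ⟨x, rfl⟩ := hlift x₀
  obtain ⟨y, rfl⟩ := hlift y₀
  rw [← Matrix.map_mul, ← Matrix.map_mul, ← Matrix.map_add _ (map_add res),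
    ← Matrix.map_add _ (map_add res)] at hxy
  have hB := isUnit_of_isUnit_map res hxy
  let u : Bool → Matrix (Idx g) (Idx g) A := fun e =>
    bif e then Matrix.fromBlocks 1 (-y) 0 1 else Matrix.fromBlocks 1 x 0 1
  let u' : Bool → Matrix (Idx g) (Idx g) A := fun e =>
    bif e then Matrix.fromBlocks 1 y 0 1 else Matrix.fromBlocks 1 (-x) 0 1
  have hu : ∀ e, u e * u' e = 1 := by
    rintro (_ | _) <;> simp [u, u', Matrix.fromBlocks_multiply, Matrix.fromBlocks_one]
  have hu' : ∀ e, u' e * u e = 1 := fun e => mul_eq_one_comm.1 (hu e)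
  have hul : ∀ e, (u e).toBlocks₂₁ = 0 := by
    rintro (_ | _) <;> exact Matrix.toBlocks_fromBlocks₂₁ _ _ _ _
  have hul' : ∀ e, (u' e).toBlocks₂₁ = 0 := by
    rintro (_ | _) <;> exact Matrix.toBlocks_fromBlocks₂₁ _ _ _ _
  have e1 : u' true * Matrix.fromBlocks a B 0 C * u false =
      Matrix.fromBlocks a (B + a * x + y * C) 0 C := by
    simp only [u, u', cond_true, cond_false, Matrix.fromBlocks_multiply]
    simp only [one_mul, mul_zero, add_zero, zero_mul, mul_one, zero_add]
    congr 1
    abel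
  have e2 : u' false * Matrix.fromBlocks a' B' 0 C' * u true =
      Matrix.fromBlocks a' (B' - a' * y - x * C') 0 C' := by
    simp only [u, u', cond_true, cond_false, Matrix.fromBlocks_multiply]
    simp only [one_mul, mul_zero, add_zero, zero_mul, mul_one, zero_add, mul_neg, neg_mul,
      neg_zero]
    congr 1
    abel
  have r1 : (u' true * Matrix.fromBlocks a B 0 C * u false) *
      (u' false * Matrix.fromBlocks a' B' 0 C' * u true) = t • 1 := by
    calc _ = u' true * Matrix.fromBlocks a B 0 C * (u false * u' false) *
          Matrix.fromBlocks a' B' 0 C' * u true := by simp only [Matrix.mul_assoc]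
      _ = _ := by
        rw [hu, mul_one, mul_assoc (u' true), hMT, Matrix.mul_smul, mul_one, Matrix.smul_mul, hu']
  have r2 : (u' false * Matrix.fromBlocks a' B' 0 C' * u true) *
      (u' true * Matrix.fromBlocks a B 0 C * u false) = t • 1 := by
    calc _ = u' false * Matrix.fromBlocks a' B' 0 C' * (u true * u' true) *
          Matrix.fromBlocks a B 0 C * u false := by simp only [Matrix.mul_assoc]
      _ = _ := by
        rw [hu, mul_one, mul_assoc (u' false), hTM, Matrix.mul_smul, mul_one, Matrix.smul_mul, hu']
  have hTr' : g ≤ ((u' false * Matrix.fromBlocks a' B' 0 C' * u true).map res).rank := by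
    have hun : ∀ v v' : Matrix (Idx g) (Idx g) A, v * v' = 1 → IsUnit ((v.map res).det) :=
      fun v v' h => by
        rw [← RingHom.mapMatrix_apply, ← RingHom.map_det]
        exact ((Matrix.isUnit_iff_isUnit_det _).1 (IsUnit.of_mul_eq_one _ h)).map res
    rw [Matrix.map_mul, Matrix.map_mul, Matrix.rank_mul_eq_left_of_isUnit_det _ _ (hun _ _ (hu _)),
      Matrix.rank_mul_eq_right_of_isUnit_det _ _ (hun _ _ (hu' _))]
    exact hTr
  rw [e1, e2] at r1 r2
  rw [e2, Matrix.fromBlocks_map, Matrix.map_zero _ (map_zero res)] at hTr'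
  have hmaps : ∀ v w v' w' : Matrix (Fin g) (Fin g) A, v * w + v' * w' = 0 →
      v.map res * w.map res + v'.map res * w'.map res = 0 := fun v w v' w' h => by
    rw [← Matrix.map_mul, ← Matrix.map_mul, ← Matrix.map_add _ (map_add res), h,
      Matrix.map_zero _ (map_zero res)]
  have s1 := r1
  have s2 := r2
  rw [Matrix.fromBlocks_multiply, ← Matrix.fromBlocks_one, Matrix.fromBlocks_smul,
    Matrix.fromBlocks_inj] at s1 s2
  have haa : a * a' = t • 1 := by simpa using s1.1
  have hB' : IsUnit (B' - a' * y - x * C') := by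
    apply isUnit_of_isUnit_map res
    refine isUnit_of_le_rank (t := res t) hxy ?_ (hmaps a _ _ C' ?_) (hmaps _ _ _ C ?_) hTr'
    · rw [← Matrix.map_mul, haa]
      ext i j
      simp [Matrix.one_apply, apply_ite res]
    · simpa using s1.2.1
    · simpa using s2.2.1
  obtain ⟨P, Q, hP, hQ, D, hD, hdvd⟩ := exists_mul_mul_eq_diagonal a fun k hk hkg => by
    have hpow : t ^ k ∈ minorIdeal k a := by
      apply minorIdeal_mul_le_left k a a'
      rw [haa]
      exact pow_mem_minorIdeal_smul_one hkg t
    -- A generator of the ideal of minors divides a power of `t`.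
    have hnz : ∀ m, minorIdeal k a = Ideal.span {m} → m ∈ nonZeroDivisors A := fun m h => by
      rw [h] at hpow
      obtain ⟨c, hc⟩ := Ideal.mem_span_singleton.1 hpow
      exact (mul_mem_nonZeroDivisors.1 (hc ▸ pow_mem ht k)).1
    rcases Nat.lt_or_ge k g with hlt | hge
    · obtain ⟨r, c, hrc⟩ := hm k hk (by omega)
      have h : minorIdeal k a = Ideal.span {(a.submatrix r c).det} := by
        apply le_antisymm
        · rw [minorIdeal, Ideal.span_le]
          rintro _ ⟨r', c', rfl⟩
          exact Ideal.mem_span_singleton.2 (hrc r' c')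
        · rw [Ideal.span_singleton_le_iff_mem]
          exact det_submatrix_mem_minorIdeal a r c
      exact ⟨_, hnz _ h, h⟩
    · obtain rfl : k = g := le_antisymm hkg hge
      exact ⟨_, hnz _ (minorIdeal_card a), minorIdeal_card a⟩
  obtain ⟨d⟩ := nonempty_normalData_of_isUnit ht r1 r2 hB hB' hP hQ hD hdvd
  rw [← e1, ← e2] at d
  exact ⟨d.ofTranslate u u' hu hul hul'⟩

end Normal

/-! ### Pairings -/

section Pairing

variable {A : Type} [CommRing A] {g : ℕ}

/-- The Gram matrices `J false` and `J true` of two alternating pairings on `V_0` and on `V_N`, for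
which `Ω_0` and `Ω_N` are totally isotropic and `M : V_0 ⟶ V_N` is adjoint to `T : V_N ⟶ V_0`. -/
structure IsPairing (M T : Matrix (Idx g) (Idx g) A) (J : Bool → Matrix (Idx g) (Idx g) A) :
    Prop where
  skew : ∀ e p q, J e p q + J e q p = 0
  diag : ∀ e p, J e p p = 0
  isotropic : ∀ e (a b : Fin g), J e (.inl a) (.inl b) = 0
  adjoint : M.transpose * J true = J false * T

theorem transpose_mul_mul_diag_eq_zero {n : Type} [Fintype n] {J : Matrix n n A}
    (hs : ∀ p q, J p q + J q p = 0) (hd : ∀ p, J p p = 0) (u : Matrix n n A) (p : n) :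
    (u.transpose * J * u) p p = 0 := by
  have h : (u.transpose * J * u) p p = ∑ x : n × n, u x.2 p * J x.2 x.1 * u x.1 p := by
    rw [Fintype.sum_prod_type]
    simp [Matrix.mul_apply, Finset.sum_mul]
  rw [h]
  refine Finset.sum_involution (fun x _ => x.swap) (fun x _ => ?_) (fun x _ hx hs => hx ?_)
    (fun _ _ => Finset.mem_univ _) fun x _ => x.swap_swap
  · have := hs x.2 x.1
    simp only [Prod.fst_swap, Prod.snd_swap]
    linear_combination u x.2 p * u x.1 p * this
  · have h12 : x.2 = x.1 := congrArg Prod.fst hs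
    rw [h12, hd]
    ring

theorem IsPairing.transpose_eq {M T : Matrix (Idx g) (Idx g) A}
    {J : Bool → Matrix (Idx g) (Idx g) A} (hJ : IsPairing M T J) (e : Bool) :
    (J e).transpose = -J e := by
  ext p q
  exact eq_neg_of_add_eq_zero_left (hJ.skew e q p)

/-- Pairings after a change of bases of `V_0` and `V_N` by elements of `P`. -/
theorem IsPairing.congr {M T : Matrix (Idx g) (Idx g) A} {J : Bool → Matrix (Idx g) (Idx g) A}
    (hJ : IsPairing M T J) {u u' : Bool → Matrix (Idx g) (Idx g) A} (hu : ∀ e, u e * u' e = 1)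
    (hl : ∀ e, (u e).toBlocks₂₁ = 0) :
    IsPairing (u' true * M * u false) (u' false * T * u true)
      fun e => (u e).transpose * J e * u e where
  skew e p q := by
    have h : ((u e).transpose * J e * u e).transpose = -((u e).transpose * J e * u e) := by
      rw [Matrix.transpose_mul, Matrix.transpose_mul, Matrix.transpose_transpose, hJ.transpose_eq,
        Matrix.neg_mul, Matrix.mul_neg, mul_assoc]
    have := congrFun (congrFun h q) p
    rw [Matrix.transpose_apply, Matrix.neg_apply] at this
    rw [this, neg_add_cancel]
  diag e p := transpose_mul_mul_diag_eq_zero (hJ.skew e) (hJ.diag e) _ p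
  isotropic e a b := by
    have h1 : (J e).toBlocks₁₁ = 0 := by ext a b; exact hJ.isotropic e a b
    have h2 : ((u e).transpose * J e * u e).toBlocks₁₁ = 0 := by
      rw [fromBlocks_of_lower_eq_zero (hl e), ← Matrix.fromBlocks_toBlocks (J e), h1,
        Matrix.fromBlocks_transpose, Matrix.fromBlocks_multiply, Matrix.fromBlocks_multiply,
        Matrix.toBlocks_fromBlocks₁₁]
      simp
    exact congrFun (congrFun h2 a) b
  adjoint := by
    have h1 : (u' true).transpose * (u true).transpose = 1 := by
      rw [← Matrix.transpose_mul, hu, Matrix.transpose_one]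
    calc _ = (u false).transpose * M.transpose * ((u' true).transpose * (u true).transpose) *
          J true * u true := by simp only [Matrix.transpose_mul, mul_assoc]
      _ = (u false).transpose * J false * T * u true := by
        rw [h1, mul_one, mul_assoc (_ : Matrix (Idx g) (Idx g) A) M.transpose, hJ.adjoint,
          ← mul_assoc]
      _ = (u false).transpose * J false * (u false * u' false) * T * u true := by
        rw [hu, mul_one]
      _ = _ := by simp only [mul_assoc]

/-- The index set of the coordinates on the space of pairings. If the Gram matrices are
`(0 E; -Eᵀ F)` and `(0 E'; -E'ᵀ F')`, the coordinates are the entries of `E` on and above the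
diagonal and of `F` below it, both put into one square matrix, and the entries of `F'` above the
diagonal. -/
abbrev Var (g : ℕ) : Type := (Fin g × Fin g) ⊕ {p : Fin g × Fin g // p.1 < p.2}

theorem card_var (g : ℕ) : Fintype.card (Var g) = g * (3 * g - 1) / 2 := by
  have h : Fintype.card {p : Fin g × Fin g // p.1 < p.2} = ∑ i ∈ Finset.range g, i := by
    rw [Fintype.card_subtype, Finset.card_filter, Fintype.sum_prod_type, ← Finset.sum_range_reflect,
      Finset.sum_range]
    refine Finset.sum_congr rfl fun i _ => ?_
    rw [← Finset.card_filter, Finset.filter_lt_eq_Ioi, Fin.card_Ioi]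
  have h2 := Finset.sum_range_id_mul_two g
  rw [Fintype.card_sum, Fintype.card_prod, Fintype.card_fin, h]
  refine (Nat.div_eq_of_eq_mul_left two_pos ?_).symm
  rw [add_mul, h2]
  rcases g with _ | g
  · rfl
  · have e : 3 * (g + 1) - 1 = 3 * g + 2 := by omega
    rw [e, Nat.add_sub_cancel]
    ring

section Coordinates

variable (D C : Fin g → A) (q : Fin g → Fin g → A) (v : Var g → A)

/-- The lower right block `F` of the first Gram matrix. -/
def formF (i j : Fin g) : A :=
  if j < i then v (.inl (i, j)) else if i < j then -v (.inl (j, i)) else 0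

/-- The lower right block `F'` of the second Gram matrix. -/
def formF' (i j : Fin g) : A :=
  if h : i < j then v (.inr ⟨(i, j), h⟩) else if h : j < i then -v (.inr ⟨(j, i), h⟩) else 0

/-- The upper right block `E` of the first Gram matrix. Its entries below the diagonal are those
forced by the adjointness condition, after division by entries of `D`. -/
def formE (i j : Fin g) : A :=
  if i ≤ j then v (.inl (i, j))
  else q j i * v (.inl (j, i)) - D i * formF v j i - C j * formF' v j i

/-- The upper right block `E'` of the second Gram matrix. -/
def formE' (i j : Fin g) : A :=
  -formE D C q v j i - formF v i j * D j - C i * formF' v i j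

/-- The Gram matrices with given coordinates, for maps in normal form. -/
def stdForm (e : Bool) : Matrix (Idx g) (Idx g) A :=
  bif e then Matrix.fromBlocks 0 (Matrix.of (formE' D C q v))
    (-(Matrix.of (formE' D C q v)).transpose) (Matrix.of (formF' v))
  else Matrix.fromBlocks 0 (Matrix.of (formE D C q v)) (-(Matrix.of (formE D C q v)).transpose)
    (Matrix.of (formF v))

/-- The coordinates of a pair of Gram matrices. -/
def stdCoord (J : Bool → Matrix (Idx g) (Idx g) A) : Var g → A
  | .inl (i, j) => if i ≤ j then J false (.inl i) (.inr j) else J false (.inr i) (.inr j)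
  | .inr p => J true (.inr p.1.1) (.inr p.1.2)

theorem stdCoord_stdForm : stdCoord (stdForm D C q v) = v := by
  ext (⟨i, j⟩ | ⟨⟨i, j⟩, h⟩)
  · by_cases hij : i ≤ j
    · simp [stdCoord, stdForm, formE, hij]
    · simp [stdCoord, stdForm, formF, hij, not_le.1 hij]
  · have h : i < j := h
    simp [stdCoord, stdForm, formF', h]

theorem formF_add_swap (i j : Fin g) : formF v i j + formF v j i = 0 := by
  rcases lt_trichotomy i j with h | rfl | h
  · simp [formF, h, h.not_gt]
  · simp [formF]
  · simp [formF, h, h.not_gt]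

theorem formF_self (i : Fin g) : formF v i i = 0 := by simp [formF]

theorem formF'_add_swap (i j : Fin g) : formF' v i j + formF' v j i = 0 := by
  rcases lt_trichotomy i j with h | rfl | h
  · simp [formF', h, h.not_gt]
  · simp [formF']
  · simp [formF', h, h.not_gt]

theorem formF'_self (i : Fin g) : formF' v i i = 0 := by simp [formF']

theorem formE_swap {i j : Fin g} (h : i < j) :
    formE D C q v j i = q i j * formE D C q v i j - D j * formF v i j - C i * formF' v i j := by
  simp [formE, h.le, h.not_ge]

variable {D C q} {t : A}

/-- The block equation `D E' = -E D` of the adjointness condition. -/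
theorem D_mul_formE' (v : Var g → A) (hDC : ∀ i, D i * C i = -t)
    (hD : ∀ i j, i ≤ j → D j = q i j * D i) (i j : Fin g) :
    D i * formE' D C q v i j = -(formE D C q v i j * D j) := by
  rcases lt_trichotomy i j with h | rfl | h
  · rw [formE', formE_swap _ _ _ _ h]
    linear_combination formE D C q v i j * hD i j h.le
  · rw [formE', formF_self, formF'_self]
    ring
  · rw [formE', formE_swap _ _ _ _ h, eq_neg_of_add_eq_zero_left (formF_add_swap v i j),
      eq_neg_of_add_eq_zero_left (formF'_add_swap v i j)]
    linear_combination -formE D C q v j i * hD j i h.le + formF' v j i * (hDC i - hDC j)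

/-- The block equation `C E'ᵀ = -Eᵀ C` of the adjointness condition. -/
theorem C_mul_formE' (v : Var g → A) (hDC : ∀ i, D i * C i = -t)
    (hC : ∀ i j, i ≤ j → C i = q i j * C j) (i j : Fin g) :
    C i * formE' D C q v j i = -(formE D C q v j i * C j) := by
  rcases lt_trichotomy i j with h | rfl | h
  · rw [formE', formE_swap _ _ _ _ h, eq_neg_of_add_eq_zero_left (formF_add_swap v j i),
      eq_neg_of_add_eq_zero_left (formF'_add_swap v j i)]
    linear_combination -formE D C q v i j * hC i j h.le + formF v i j * (hDC i - hDC j)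
  · rw [formE', formF_self, formF'_self]
    ring
  · rw [formE', formE_swap _ _ _ _ h]
    linear_combination formE D C q v j i * hC j i h.le

theorem isPairing_stdForm (v : Var g → A) (hDC : ∀ i, D i * C i = -t)
    (hD : ∀ i j, i ≤ j → D j = q i j * D i)
    (hC : ∀ i j, i ≤ j → C i = q i j * C j) :
    IsPairing (Matrix.fromBlocks (Matrix.diagonal D) 1 0 (Matrix.diagonal C))
      (Matrix.fromBlocks (-Matrix.diagonal C) 1 0 (-Matrix.diagonal D)) (stdForm D C q v) where
  skew := by
    rintro (_ | _) (p | p) (r | r) <;>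
      simp [stdForm, formF_add_swap, formF'_add_swap]
  diag := by
    rintro (_ | _) (p | p) <;> simp [stdForm, formF_self, formF'_self]
  isotropic := by
    rintro (_ | _) a b <;> simp [stdForm]
  adjoint := by
    simp only [stdForm, cond_true, cond_false, Matrix.fromBlocks_transpose,
      Matrix.fromBlocks_multiply, Matrix.diagonal_transpose, Matrix.transpose_one,
      Matrix.transpose_zero]
    rw [Matrix.fromBlocks_inj]
    refine ⟨by simp, ?_, ?_, ?_⟩ <;> ext i j
    · simp [D_mul_formE' v hDC hD]
    · simp [C_mul_formE' v hDC hC]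
    · simp [formE']
      ring

/-- If `t` is a nonzerodivisor, pairings for maps in normal form are determined by their
coordinates. -/
theorem stdForm_stdCoord (hDC : ∀ i, D i * C i = -t)
    (hD : ∀ i j, i ≤ j → D j = q i j * D i)
    (ht : t ∈ nonZeroDivisors A) {J : Bool → Matrix (Idx g) (Idx g) A}
    (hJ : IsPairing (Matrix.fromBlocks (Matrix.diagonal D) 1 0 (Matrix.diagonal C))
      (Matrix.fromBlocks (-Matrix.diagonal C) 1 0 (-Matrix.diagonal D)) J) :
    stdForm D C q (stdCoord J) = J := by
  have hDn : ∀ i, D i ∈ nonZeroDivisors A := fun i => by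
    have h2 : D i * C i ∈ nonZeroDivisors A := by
      rw [hDC, ← neg_one_mul]
      exact mul_mem isUnit_one.neg.mem_nonZeroDivisors ht
    exact (mul_mem_nonZeroDivisors.1 h2).1
  have hblk : ∀ e, J e = Matrix.fromBlocks 0 (J e).toBlocks₁₂ (-(J e).toBlocks₁₂.transpose)
      (J e).toBlocks₂₂ := fun e => by
    ext (a | a) (b | b)
    · exact hJ.isotropic e a b
    · rfl
    · exact eq_neg_of_add_eq_zero_left (hJ.skew e _ _)
    · rfl
  have hadj := hJ.adjoint
  rw [hblk true, hblk false, Matrix.fromBlocks_transpose, Matrix.fromBlocks_multiply,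
    Matrix.fromBlocks_multiply, Matrix.fromBlocks_inj] at hadj
  have hE'E : ∀ i j, D i * J true (.inl i) (.inr j) = -(J false (.inl i) (.inr j) * D j) := by
    intro i j
    have := congrFun (congrFun hadj.2.1 i) j
    simpa [Matrix.toBlocks₁₂] using this
  have hE' : ∀ i j, J true (.inl i) (.inr j) = -J false (.inl j) (.inr i) -
      J false (.inr i) (.inr j) * D j - C i * J true (.inr i) (.inr j) := by
    intro i j
    have := congrFun (congrFun hadj.2.2.2 i) j
    simp [Matrix.toBlocks₁₂, Matrix.toBlocks₂₂] at this
    linear_combination this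
  have hF : ∀ i j, formF (stdCoord J) i j = J false (.inr i) (.inr j) := by
    intro i j
    rcases lt_trichotomy i j with h | rfl | h
    · simp only [formF, h.not_gt, h, if_true, if_false, stdCoord, h.not_ge]
      exact (eq_neg_of_add_eq_zero_left (hJ.skew false _ _)).symm
    · rw [formF_self, hJ.diag]
    · simp only [formF, h, if_true, stdCoord, h.not_ge, if_false]
  have hF' : ∀ i j, formF' (stdCoord J) i j = J true (.inr i) (.inr j) := by
    intro i j
    rcases lt_trichotomy i j with h | rfl | h
    · simp only [formF', h, dif_pos, stdCoord]
    · rw [formF'_self, hJ.diag]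
    · simp only [formF', h.not_gt, h, dif_pos, dif_neg, not_false_eq_true, stdCoord]
      exact (eq_neg_of_add_eq_zero_left (hJ.skew true _ _)).symm
  have hE : ∀ i j, formE D C q (stdCoord J) i j = J false (.inl i) (.inr j) := by
    intro i j
    rcases le_or_gt i j with h | h
    · simp [formE, h, stdCoord]
    · rw [formE, if_neg h.not_ge, hF, hF', stdCoord, if_pos h.le,
        ← mul_cancel_left_mem_nonZeroDivisors (hDn j)]
      have h1 := hE'E j i
      rw [hE'] at h1
      linear_combination h1 - J false (.inl j) (.inr i) * hD j i h.le
  have hE'' : ∀ i j, formE' D C q (stdCoord J) i j = J true (.inl i) (.inr j) := by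
    intro i j
    rw [formE', hE, hF, hF', hE']
  ext (_ | _) a b
  · rw [hblk false]
    rcases a with a | a <;> rcases b with b | b <;>
      simp [stdForm, hE, hF, Matrix.toBlocks₁₂, Matrix.toBlocks₂₂]
  · rw [hblk true]
    rcases a with a | a <;> rcases b with b | b <;>
      simp [stdForm, hE'', hF', Matrix.toBlocks₁₂, Matrix.toBlocks₂₂]

end Coordinates

end Pairing

/-! ### Pairings for maps with a normal form -/

section NormalForms

variable {A B : Type} [CommRing A] [CommRing B] {g : ℕ}

theorem diagonal_map' (φ : A →+* B) (D : Fin g → A) :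
    (Matrix.diagonal D).map φ = Matrix.diagonal fun i => φ (D i) := by
  rw [Matrix.diagonal_map (map_zero φ)]

theorem toBlocks₂₁_map {M : Matrix (Idx g) (Idx g) A} (φ : A →+* B) (h : M.toBlocks₂₁ = 0) :
    (M.map φ).toBlocks₂₁ = 0 := by
  ext a b
  exact (congrArg φ (congrFun (congrFun h a) b)).trans (map_zero φ)

/-- The image of normal data under a ring homomorphism. -/
def NormalData.map {t : A} {M T : Matrix (Idx g) (Idx g) A} (d : NormalData t M T) (φ : A →+* B) :
    NormalData (φ t) (M.map φ) (T.map φ) where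
  h e := (d.h e).map φ
  h' e := (d.h' e).map φ
  D i := φ (d.D i)
  C i := φ (d.C i)
  q i j := φ (d.q i j)
  h_mul e := by
    rw [← Matrix.map_mul, d.h_mul, Matrix.map_one _ (map_zero φ) (map_one φ)]
  h_low e := toBlocks₂₁_map φ (d.h_low e)
  h'_low e := toBlocks₂₁_map φ (d.h'_low e)
  left_eq := by
    rw [← Matrix.map_mul, ← Matrix.map_mul, d.left_eq, Matrix.fromBlocks_map, diagonal_map',
      diagonal_map', Matrix.map_zero _ (map_zero φ), Matrix.map_one _ (map_zero φ) (map_one φ)]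
  right_eq := by
    rw [← Matrix.map_mul, ← Matrix.map_mul, d.right_eq, Matrix.fromBlocks_map,
      Matrix.map_neg _ (map_neg φ), Matrix.map_neg _ (map_neg φ), diagonal_map', diagonal_map',
      Matrix.map_zero _ (map_zero φ), Matrix.map_one _ (map_zero φ) (map_one φ)]
  D_mul_C i := by rw [← map_mul, d.D_mul_C, map_neg]
  D_eq i j h := by rw [← map_mul, ← d.D_eq i j h]
  C_eq i j h := by rw [← map_mul, ← d.C_eq i j h]

variable {t : A} {M T : Matrix (Idx g) (Idx g) A}

theorem NormalData.h'_mul (d : NormalData t M T) (e : Bool) : d.h' e * d.h e = 1 :=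
  mul_eq_one_comm.1 (d.h_mul e)

/-- The pair of Gram matrices with given coordinates with respect to the normal form. -/
def NormalData.form (d : NormalData t M T) (v : Var g → A) (e : Bool) :
    Matrix (Idx g) (Idx g) A :=
  (d.h' e).transpose * stdForm d.D d.C d.q v e * d.h' e

/-- The coordinates of a pair of Gram matrices with respect to the normal form. -/
def NormalData.coord (d : NormalData t M T) (J : Bool → Matrix (Idx g) (Idx g) A) : Var g → A :=
  stdCoord fun e => (d.h e).transpose * J e * d.h e

theorem transpose_mul_mul_cancel {n : Type} [Fintype n] [DecidableEq n] {u u' : Matrix n n A}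
    (h : u * u' = 1) (J : Matrix n n A) :
    u'.transpose * (u.transpose * J * u) * u' = J := by
  have h1 : u'.transpose * u.transpose = 1 := by
    rw [← Matrix.transpose_mul, h, Matrix.transpose_one]
  calc _ = (u'.transpose * u.transpose) * J * (u * u') := by simp only [mul_assoc]
    _ = J := by rw [h1, h, one_mul, mul_one]

theorem NormalData.isPairing_form (d : NormalData t M T) (v : Var g → A) :
    IsPairing M T (d.form v) := by
  have h := (isPairing_stdForm v d.D_mul_C d.D_eq d.C_eq).congr d.h'_mul d.h'_low
  rw [← d.left_eq, ← d.right_eq] at h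
  have e1 : d.h true * (d.h' true * M * d.h false) * d.h' false = M := by
    calc _ = (d.h true * d.h' true) * M * (d.h false * d.h' false) := by simp only [mul_assoc]
      _ = M := by rw [d.h_mul, d.h_mul, one_mul, mul_one]
  have e2 : d.h false * (d.h' false * T * d.h true) * d.h' true = T := by
    calc _ = (d.h false * d.h' false) * T * (d.h true * d.h' true) := by simp only [mul_assoc]
      _ = T := by rw [d.h_mul, d.h_mul, one_mul, mul_one]
  rwa [e1, e2] at h

theorem NormalData.coord_form (d : NormalData t M T) (v : Var g → A) : d.coord (d.form v) = v := by
  have h : (fun e => (d.h e).transpose * d.form v e * d.h e) = stdForm d.D d.C d.q v :=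
    funext fun e => transpose_mul_mul_cancel (d.h'_mul e) _
  rw [NormalData.coord, h, stdCoord_stdForm]

theorem NormalData.form_coord (d : NormalData t M T) (ht : t ∈ nonZeroDivisors A)
    {J : Bool → Matrix (Idx g) (Idx g) A} (hJ : IsPairing M T J) : d.form (d.coord J) = J := by
  have h := hJ.congr d.h_mul d.h_low
  rw [d.left_eq, d.right_eq] at h
  funext e
  rw [NormalData.form, NormalData.coord, stdForm_stdCoord d.D_mul_C d.D_eq ht h]
  exact transpose_mul_mul_cancel (d.h_mul e) _

theorem NormalData.form_map (d : NormalData t M T) (φ : A →+* B) (v : Var g → A) (e : Bool) :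
    (d.map φ).form (fun i => φ (v i)) e = (d.form v e).map φ := by
  have hF : ∀ i j, formF (fun i => φ (v i)) i j = φ (formF v i j) := fun i j => by
    simp only [formF]; split_ifs <;> simp
  have hF' : ∀ i j, formF' (fun i => φ (v i)) i j = φ (formF' v i j) := fun i j => by
    simp only [formF']; split_ifs <;> simp
  have hE : ∀ i j, formE (d.map φ).D (d.map φ).C (d.map φ).q (fun i => φ (v i)) i j =
      φ (formE d.D d.C d.q v i j) := fun i j => by
    simp only [formE, hF, hF', NormalData.map]; split_ifs <;> simp
  have hE' : ∀ i j, formE' (d.map φ).D (d.map φ).C (d.map φ).q (fun i => φ (v i)) i j =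
      φ (formE' d.D d.C d.q v i j) := fun i j => by
    simp only [formE', hE, hF, hF']
    simp [NormalData.map]
  have hs : stdForm (d.map φ).D (d.map φ).C (d.map φ).q (fun i => φ (v i)) e =
      (stdForm d.D d.C d.q v e).map φ := by
    cases e <;> ext (i | i) (j | j) <;> simp [stdForm, hF, hF', hE, hE']
  rw [NormalData.form, hs, NormalData.form, Matrix.map_mul, Matrix.map_mul]
  rfl

theorem NormalData.coord_map (d : NormalData t M T) (φ : A →+* B)
    (J : Bool → Matrix (Idx g) (Idx g) A) (i : Var g) :
    (d.map φ).coord (fun e => (J e).map φ) i = φ (d.coord J i) := by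
  have h : ∀ e, ((d.map φ).h e).transpose * (J e).map φ * (d.map φ).h e =
      ((d.h e).transpose * J e * d.h e).map φ := fun e => by
    rw [Matrix.map_mul, Matrix.map_mul]
    rfl
  rcases i with ⟨i, j⟩ | p
  · simp only [NormalData.coord, stdCoord, h, Matrix.map_apply]
    split_ifs <;> rfl
  · simp only [NormalData.coord, stdCoord, h, Matrix.map_apply]

/-- The coordinates of a particular nondegenerate pair: `E` is the identity, `F` and `F'` vanish. -/
def idVar (A : Type) [CommRing A] (g : ℕ) : Var g → A
  | .inl (i, j) => if i = j then 1 else 0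
  | .inr _ => 0

theorem NormalData.isUnit_det_form_idVar (d : NormalData t M T) (e : Bool) :
    IsUnit (d.form (idVar A g) e).det := by
  have hF : ∀ i j, formF (idVar A g) i j = 0 := fun i j => by
    simp only [formF, idVar]
    split_ifs with h1 h2 h3 <;> simp_all
  have hF' : ∀ i j, formF' (idVar A g) i j = 0 := fun i j => by
    simp only [formF', idVar]; split_ifs <;> simp
  have hE : ∀ i j, formE d.D d.C d.q (idVar A g) i j = (1 : Matrix (Fin g) (Fin g) A) i j :=
    fun i j => by
      rcases lt_trichotomy i j with h | rfl | h
      · simp [formE, idVar, h.le, h.ne]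
      · simp [formE, idVar]
      · simp [formE, hF, hF', idVar, h.not_ge, h.ne, h.ne']
  have hE' : ∀ i j, formE' d.D d.C d.q (idVar A g) i j = -(1 : Matrix (Fin g) (Fin g) A) i j :=
    fun i j => by
      rw [formE', hE, hF, hF', ← Matrix.transpose_apply 1, Matrix.transpose_one]
      simp
  have hu : IsUnit (d.h' e).det :=
    (Matrix.isUnit_iff_isUnit_det _).1 (IsUnit.of_mul_eq_one _ (d.h'_mul e))
  have hs : IsUnit (stdForm d.D d.C d.q (idVar A g) e).det := by
    rw [← Matrix.isUnit_iff_isUnit_det]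
    refine IsUnit.of_mul_eq_one (-stdForm d.D d.C d.q (idVar A g) e) ?_
    have e1 : stdForm d.D d.C d.q (idVar A g) false = Matrix.fromBlocks 0 1 (-1) 0 := by
      ext (i | i) (j | j) <;> simp [stdForm, hE, hF, Matrix.one_apply, eq_comm]
    have e2 : stdForm d.D d.C d.q (idVar A g) true = Matrix.fromBlocks 0 (-1) 1 0 := by
      ext (i | i) (j | j) <;> simp [stdForm, hE', hF', Matrix.one_apply, eq_comm]
    cases e
    · rw [e1, mul_neg, Matrix.fromBlocks_multiply, ← Matrix.fromBlocks_one, Matrix.fromBlocks_neg]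
      simp
    · rw [e2, mul_neg, Matrix.fromBlocks_multiply, ← Matrix.fromBlocks_one, Matrix.fromBlocks_neg]
      simp
  rw [NormalData.form, Matrix.det_mul, Matrix.det_mul, Matrix.det_transpose]
  exact (hu.mul hs).mul hu

end NormalForms

/-! ### Products of tuples -/

section Tuples

variable {A B : Type} [CommRing A] [CommRing B] {g N : ℕ}

theorem tailProd_map (φ : A →+* B) (M : Fin (N + 1) → Matrix (Idx g) (Idx g) A) :
    (tailProd M).map φ = tailProd fun i => (M i).map φ := by
  rw [tailProd, tailProd, ← RingHom.mapMatrix_apply, map_list_prod, List.map_ofFn]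
  rfl

theorem cycProd_map (φ : A →+* B) (M : Fin (N + 1) → Matrix (Idx g) (Idx g) A)
    (j : Fin (N + 1)) : (cycProd M j).map φ = cycProd (fun i => (M i).map φ) j := by
  rw [cycProd, cycProd, ← RingHom.mapMatrix_apply, map_list_prod, List.map_ofFn]
  rfl

theorem cycProd_zero (M : Fin (N + 1) → Matrix (Idx g) (Idx g) A) :
    cycProd M 0 = M 0 * tailProd M := by
  simp only [cycProd, tailProd, zero_add]
  rw [List.ofFn_succ, List.prod_cons]

theorem cycProd_one (M : Fin (N + 1) → Matrix (Idx g) (Idx g) A) :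
    cycProd M 1 = tailProd M * M 0 := by
  simp only [cycProd, tailProd]
  rw [List.ofFn_succ', List.concat_eq_append, List.prod_append, List.prod_singleton]
  congr 3
  · funext k
    rw [add_comm, Fin.coeSucc_eq_succ]
  · exact (add_comm _ _).trans (Fin.last_add_one N)

theorem toBlocks₂₁_list_prod (l : List (Matrix (Idx g) (Idx g) A))
    (h : ∀ M ∈ l, M.toBlocks₂₁ = 0) : l.prod.toBlocks₂₁ = 0 := by
  induction l with
  | nil =>
    rw [List.prod_nil, ← Matrix.fromBlocks_one, Matrix.toBlocks_fromBlocks₂₁]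
  | cons M l ih =>
    rw [List.prod_cons, fromBlocks_of_lower_eq_zero (h M (by simp)),
      fromBlocks_of_lower_eq_zero (ih fun M' hM' => h M' (by simp [hM'])),
      Matrix.fromBlocks_multiply, Matrix.toBlocks_fromBlocks₂₁]
    simp

/-- The product of a translated tuple telescopes. -/
theorem prod_ofFn_conj {G : Type} [Monoid G] {N : ℕ} (u : Fin (N + 1) → Gˣ) (M : Fin N → G) :
    (List.ofFn fun k => (↑(u k.castSucc)⁻¹ : G) * M k * u k.succ).prod =
      (↑(u 0)⁻¹ : G) * (List.ofFn M).prod * u (Fin.last N) := by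
  induction N with
  | zero => simp
  | succ N ih =>
    rw [List.ofFn_succ, List.prod_cons, List.ofFn_succ, List.prod_cons]
    have := ih (fun k => u k.succ) fun k => M k.succ
    simp only [← Fin.succ_castSucc] at this ⊢
    rw [this]
    simp only [mul_assoc, Fin.castSucc_zero, Fin.succ_zero_eq_one, Fin.succ_last,
      Units.mul_inv_cancel_left]

theorem tailProd_translate (h : Fin (N + 1) → Matrix.GeneralLinearGroup (Idx g) A)
    (M : Fin (N + 1) → Matrix (Idx g) (Idx g) A) :
    tailProd (translate h M) = ((h 0)⁻¹).val * tailProd M * (h (Fin.last N)).val := by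
  have e : ∀ k : Fin N, k.succ - 1 = k.castSucc := fun k => by
    rw [← Fin.coeSucc_eq_succ, add_sub_cancel_right]
  simp only [tailProd, translate, e]
  exact prod_ofFn_conj h fun k => M k.succ

/-- The changes of basis of a normal form, that of `V_N` being used at all indices other than `0`,
translate the tuple into one with invertible upper right blocks. -/
theorem NormalData.exists_inBigCell (hN : 0 < N) {t : A}
    {M : Fin (N + 1) → Matrix (Idx g) (Idx g) A} (d : NormalData t (M 0) (tailProd M)) :
    ∃ h : Fin (N + 1) → Matrix.GeneralLinearGroup (Idx g) A,
      InParabolic h ∧ InBigCell (translate h M) := by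
  let u : Bool → Matrix.GeneralLinearGroup (Idx g) A := fun e =>
    ⟨d.h e, d.h' e, d.h_mul e, d.h'_mul e⟩
  have hne : Fin.last N ≠ 0 := by
    rw [Ne, Fin.ext_iff]
    simpa using hN.ne'
  let h : Fin (N + 1) → Matrix.GeneralLinearGroup (Idx g) A := fun i =>
    if i = 0 then u false else u true
  have h0 : h 0 = u false := if_pos rfl
  have hl : h (Fin.last N) = u true := if_neg hne
  refine ⟨h, fun i => ?_, ?_, ?_⟩
  · by_cases hi : i = 0
    · rw [hi, h0]
      exact d.h_low false
    · have : h i = u true := if_neg hi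
      rw [this]
      exact d.h_low true
  · have e : (0 : Fin (N + 1)) - 1 = Fin.last N := by
      rw [sub_eq_iff_eq_add, Fin.last_add_one]
    rw [translate, e, h0, hl]
    have : ((u true)⁻¹).val * M 0 * (u false).val = _ := d.left_eq
    rw [this, Matrix.toBlocks_fromBlocks₁₂]
    exact isUnit_one
  · rw [tailProd_translate, h0, hl]
    have : ((u false)⁻¹).val * tailProd M * (u true).val = _ := d.right_eq
    rw [this, Matrix.toBlocks_fromBlocks₁₂]
    exact isUnit_one

end Tuples

/-! ### The universal tuple and the universal pairing -/

section Universal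

variable (g N : ℕ)

/-- The function `t` on `MuClosed`. -/
def muT : MuRing g N := algebraMap ℤ[X] (MuRing g N) X

theorem toMuRing_eq_zero {f : MuPoly g N} (h : f ∈ muRel g N) : toMuRing g N f = 0 :=
  Ideal.Quotient.eq_zero_iff_mem.2 (Ideal.subset_span h)

theorem univPi_toBlocks₂₁ (i : Fin (N + 1)) : (univPi g N i).toBlocks₂₁ = 0 := by
  ext a b
  exact toMuRing_eq_zero g N (.inl ⟨i, a, b, rfl⟩)

theorem tailProd_univPi_toBlocks₂₁ : (tailProd (univPi g N)).toBlocks₂₁ = 0 := by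
  refine toBlocks₂₁_list_prod _ fun M hM => ?_
  obtain ⟨k, rfl⟩ := List.mem_ofFn.1 hM
  exact univPi_toBlocks₂₁ g N _

theorem cycProd_univPi (j : Fin (N + 1)) : cycProd (univPi g N) j = muT g N • 1 := by
  have h : ∀ p q, toMuRing g N ((cycProd (genericMat g N) j - (MvPolynomial.C X : MuPoly g N) •
      (1 : Matrix (Idx g) (Idx g) (MuPoly g N))) p q) = 0 := fun p q =>
    toMuRing_eq_zero g N (.inr ⟨j, p, q, rfl⟩)
  ext p q
  have h1 := h p q
  rw [Matrix.sub_apply, map_sub, sub_eq_zero] at h1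
  have h2 := congrFun (congrFun (cycProd_map (toMuRing g N) (genericMat g N) j) p) q
  rw [Matrix.map_apply] at h2
  refine h2.symm.trans (h1.trans ?_)
  simp only [Matrix.smul_apply, Matrix.one_apply, smul_eq_mul, map_mul]
  congr 1
  split_ifs <;> simp

theorem univPi_mul_tailProd : univPi g N 0 * tailProd (univPi g N) = muT g N • 1 := by
  rw [← cycProd_zero, cycProd_univPi]

theorem tailProd_mul_univPi : tailProd (univPi g N) * univPi g N 0 = muT g N • 1 := by
  rw [← cycProd_one, cycProd_univPi]

/-- The Gram matrices of the universal pairings over `SigmaQuot`. -/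
def quotForm (e : Bool) : Matrix (Idx g) (Idx g) (SigmaQuot g N) :=
  (genericForm g N e).map (toSigmaQuot g N)

/-- The Gram matrices of the universal nondegenerate pairings. -/
def univForm (e : Bool) : Matrix (Idx g) (Idx g) (SigmaRing g N) :=
  (quotForm g N e).map (algebraMap (SigmaQuot g N) (SigmaRing g N))

theorem toSigmaQuot_eq_zero {f : SigmaPoly g N} (h : f ∈ sigmaRel g N) :
    toSigmaQuot g N f = 0 :=
  Ideal.Quotient.eq_zero_iff_mem.2 (Ideal.subset_span h)

theorem IsPairing.map {A B : Type} [CommRing A] [CommRing B] {M T : Matrix (Idx g) (Idx g) A}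
    {J : Bool → Matrix (Idx g) (Idx g) A} (hJ : IsPairing M T J) (φ : A →+* B) :
    IsPairing (M.map φ) (T.map φ) fun e => (J e).map φ where
  skew e p q := by rw [Matrix.map_apply, Matrix.map_apply, ← map_add, hJ.skew, map_zero]
  diag e p := by rw [Matrix.map_apply, hJ.diag, map_zero]
  isotropic e a b := by rw [Matrix.map_apply, hJ.isotropic, map_zero]
  adjoint := by
    rw [← Matrix.map_mul, ← hJ.adjoint, Matrix.map_mul]
    rfl

theorem isPairing_quotForm :
    IsPairing ((univPi g N 0).map (algebraMap (MuRing g N) (SigmaQuot g N)))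
      ((tailProd (univPi g N)).map (algebraMap (MuRing g N) (SigmaQuot g N))) (quotForm g N) where
  skew e p q := by
    have := toSigmaQuot_eq_zero g N (.inl (.inl (.inl ⟨e, p, q, rfl⟩)))
    rwa [map_add] at this
  diag e p := toSigmaQuot_eq_zero g N (.inl (.inl (.inr ⟨e, p, rfl⟩)))
  isotropic e a b := toSigmaQuot_eq_zero g N (.inl (.inr ⟨e, a, b, rfl⟩))
  adjoint := by
    have h1 : (((polyPi g N 0).transpose * genericForm g N true).map (toSigmaQuot g N)) =
        (genericForm g N false * tailProd (polyPi g N)).map (toSigmaQuot g N) := by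
      ext p q
      have := toSigmaQuot_eq_zero g N (.inr ⟨p, q, rfl⟩)
      rw [Matrix.sub_apply, map_sub, sub_eq_zero] at this
      exact this
    rw [Matrix.map_mul, Matrix.map_mul] at h1
    have h2 : (tailProd (polyPi g N)).map (toSigmaQuot g N) =
        (tailProd (univPi g N)).map (algebraMap (MuRing g N) (SigmaQuot g N)) := by
      have : tailProd (polyPi g N) = (tailProd (univPi g N)).map MvPolynomial.C :=
        (tailProd_map MvPolynomial.C _).symm
      rw [this, Matrix.map_map]
      rfl
    rw [h2] at h1
    exact h1

theorem algebraMap_sigmaRing :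
    algebraMap (MuRing g N) (SigmaRing g N) = (algebraMap (SigmaQuot g N) (SigmaRing g N)).comp
      (algebraMap (MuRing g N) (SigmaQuot g N)) :=
  IsScalarTower.algebraMap_eq _ _ _

theorem isPairing_univForm :
    IsPairing ((univPi g N 0).map (algebraMap (MuRing g N) (SigmaRing g N)))
      ((tailProd (univPi g N)).map (algebraMap (MuRing g N) (SigmaRing g N))) (univForm g N) := by
  have h := (isPairing_quotForm g N).map g (algebraMap (SigmaQuot g N) (SigmaRing g N))
  rw [Matrix.map_map, Matrix.map_map] at h
  rw [algebraMap_sigmaRing]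
  exact h

theorem isUnit_det_univForm (e : Bool) : IsUnit (univForm g N e).det := by
  have h : IsUnit (algebraMap (SigmaQuot g N) (SigmaRing g N) (sigmaDisc g N)) :=
    IsLocalization.Away.algebraMap_isUnit _
  have hd : ∀ e, (univForm g N e).det =
      algebraMap (SigmaQuot g N) (SigmaRing g N) (toSigmaQuot g N (genericForm g N e).det) :=
    fun e => by
      rw [univForm, quotForm, RingHom.map_det, RingHom.map_det]
      rfl
  have hm : algebraMap (SigmaQuot g N) (SigmaRing g N) (sigmaDisc g N) =
      (univForm g N false).det * (univForm g N true).det := by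
    rw [hd, hd, ← map_mul, ← map_mul]
    rfl
  rw [hm] at h
  cases e
  · exact isUnit_of_mul_isUnit_left h
  · exact isUnit_of_mul_isUnit_right h

variable {g N} {K : Type} [CommRing K]

/-- `SigmaRing` classifies nondegenerate pairings. -/
theorem exists_sigmaRing_lift (φ : MuRing g N →+* K) {J : Bool → Matrix (Idx g) (Idx g) K}
    (hJ : IsPairing ((univPi g N 0).map φ) ((tailProd (univPi g N)).map φ) J)
    (hd : ∀ e, IsUnit (J e).det) :
    ∃ σ : SigmaRing g N →+* K, σ.comp (algebraMap (MuRing g N) (SigmaRing g N)) = φ ∧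
      ∀ e, (univForm g N e).map σ = J e := by
  let ψ : SigmaPoly g N →+* K := MvPolynomial.eval₂Hom φ fun i => J i.1 i.2.1 i.2.2
  have hψJ : ∀ e, (genericForm g N e).map ψ = J e := fun e => by
    ext p q
    simp [ψ, genericForm]
  have hψC : ψ.comp MvPolynomial.C = φ := MvPolynomial.eval₂Hom_comp_C _ _
  have hψM : ∀ M : Matrix (Idx g) (Idx g) (MuRing g N), (M.map MvPolynomial.C).map ψ = M.map φ :=
    fun M => by
      rw [Matrix.map_map, ← hψC]
      rfl
  have hker : ∀ f ∈ Ideal.span (sigmaRel g N), ψ f = 0 := by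
    intro f hf
    rw [← RingHom.mem_ker]
    revert f
    change Ideal.span (sigmaRel g N) ≤ RingHom.ker ψ
    rw [Ideal.span_le]
    rintro f (((⟨e, p, q, rfl⟩ | ⟨e, p, rfl⟩) | ⟨e, a, b, rfl⟩) | ⟨p, q, rfl⟩)
    · change ψ _ = 0
      rw [map_add, ← Matrix.map_apply (f := ψ), ← Matrix.map_apply (f := ψ), hψJ]
      exact hJ.skew e p q
    · change ψ _ = 0
      rw [← Matrix.map_apply (f := ψ), hψJ]
      exact hJ.diag e p
    · change ψ _ = 0
      rw [← Matrix.map_apply (f := ψ), hψJ]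
      exact hJ.isotropic e a b
    · change ψ _ = 0
      rw [Matrix.sub_apply, map_sub, ← Matrix.map_apply (f := ψ), ← Matrix.map_apply (f := ψ),
        Matrix.map_mul, Matrix.map_mul, hψJ, hψJ]
      have h1 : (polyPi g N 0).transpose.map ψ = ((univPi g N 0).map φ).transpose := by
        rw [← hψM]; rfl
      have h2 : (tailProd (polyPi g N)).map ψ = (tailProd (univPi g N)).map φ := by
        rw [← hψM, tailProd_map MvPolynomial.C]
        rfl
      rw [h1, h2, hJ.adjoint, sub_self]
  let χ : SigmaQuot g N →+* K := Ideal.Quotient.lift _ ψ hker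
  have hχ : ∀ f, χ (toSigmaQuot g N f) = ψ f := fun f => Ideal.Quotient.lift_mk _ _ _
  have hunit : IsUnit (χ (sigmaDisc g N)) := by
    change IsUnit (χ (toSigmaQuot g N (_ * _)))
    rw [hχ, map_mul, RingHom.map_det, RingHom.map_det, RingHom.mapMatrix_apply,
      RingHom.mapMatrix_apply, hψJ, hψJ]
    exact (hd _).mul (hd _)
  refine ⟨IsLocalization.Away.lift (sigmaDisc g N) hunit, ?_, fun e => ?_⟩
  · rw [algebraMap_sigmaRing, ← RingHom.comp_assoc, IsLocalization.Away.lift_comp]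
    rw [← hψC]
    ext r
    exact hχ _
  · ext p q
    rw [← hψJ, univForm, quotForm, Matrix.map_apply, Matrix.map_apply, Matrix.map_apply,
      IsLocalization.Away.lift_eq, hχ, Matrix.map_apply]

theorem sigmaRing_hom_ext {σ₁ σ₂ : SigmaRing g N →+* K}
    (h : σ₁.comp (algebraMap (MuRing g N) (SigmaRing g N)) =
      σ₂.comp (algebraMap (MuRing g N) (SigmaRing g N)))
    (hJ : ∀ e, (univForm g N e).map σ₁ = (univForm g N e).map σ₂) : σ₁ = σ₂ := by
  refine IsLocalization.ringHom_ext (Submonoid.powers (sigmaDisc g N)) ?_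
  refine Ideal.Quotient.ringHom_ext (MvPolynomial.ringHom_ext (fun r => ?_) fun i => ?_)
  · have := RingHom.congr_fun h r
    rw [algebraMap_sigmaRing] at this
    exact this
  · exact congrFun (congrFun (hJ i.1) i.2.1) i.2.2

end Universal

/-! ### Functions and morphisms to affine schemes -/

section PullFun

variable {R S : Type} [CommRing R] [CommRing S] {X Y : Scheme.{0}}

theorem pullFun_app (f : X ⟶ Y) (p : Y ⟶ Spec (.of R)) (U : Y.Opens) (r : R) :
    (f.app U).hom (pullFun p U r) = pullFun (f ≫ p) (f ⁻¹ᵁ U) r := by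
  simp only [pullFun, RingHom.comp_apply]
  rw [← CommRingCat.comp_apply, f.naturality, CommRingCat.comp_apply, Scheme.Hom.comp_appTop,
    CommRingCat.comp_apply]
  rfl

theorem pullFun_appTop (f : X ⟶ Y) (p : Y ⟶ Spec (.of R)) (r : R) :
    f.appTop.hom (pullFun p ⊤ r) = pullFun (f ≫ p) ⊤ r :=
  pullFun_app f p ⊤ r

theorem pullFun_res (p : Y ⟶ Spec (.of R)) {U V : Y.Opens} (h : V ≤ U) (r : R) :
    (Y.presheaf.map (homOfLE h).op).hom (pullFun p U r) = pullFun p V r := by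
  simp only [pullFun, RingHom.comp_apply]
  rw [← CommRingCat.comp_apply, ← Functor.map_comp]
  rfl

theorem pullFun_top (p : Y ⟶ Spec (.of R)) (r : R) :
    pullFun p ⊤ r = p.appTop.hom ((Scheme.ΓSpecIso (.of R)).inv.hom r) := by
  have : (homOfLE (le_top : (⊤ : Y.Opens) ≤ ⊤)).op = 𝟙 _ := rfl
  simp only [pullFun, RingHom.comp_apply, this]
  simp

theorem pullFun_comp_SpecMap (p : Y ⟶ Spec (.of S)) (φ : R →+* S) (U : Y.Opens) (r : R) :
    pullFun (p ≫ Spec.map (CommRingCat.ofHom φ)) U r = pullFun p U (φ r) := by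
  rw [← pullFun_res _ le_top, ← pullFun_res p le_top, pullFun_top, pullFun_top,
    Scheme.Hom.comp_appTop, CommRingCat.comp_apply]
  congr 2
  have := congrArg (fun f => f.hom r) (Scheme.ΓSpecIso_inv_naturality (CommRingCat.ofHom φ))
  exact this.symm

theorem hom_ext_of_pullFun {p q : X ⟶ Spec (.of R)} (h : pullFun p ⊤ = pullFun q ⊤) : p = q := by
  apply ext_to_Spec
  ext r
  have := RingHom.congr_fun h r
  rw [pullFun_top, pullFun_top] at this
  exact this

theorem exists_pullFun_eq (φ : R →+* Γ(X, ⊤)) : ∃ p : X ⟶ Spec (.of R), pullFun p ⊤ = φ := by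
  refine ⟨X.toSpecΓ ≫ Spec.map (CommRingCat.ofHom φ), ?_⟩
  ext r
  rw [pullFun_comp_SpecMap, pullFun_top, Scheme.toSpecΓ_appTop]
  have := congrArg (fun f => f.hom (φ r)) (Scheme.ΓSpecIso (.of Γ(X, ⊤))).inv_hom_id
  exact this

end PullFun

/-! ### Schemes without `t`-torsion -/

section TorsionFree

variable {X Y : Scheme.{0}}

/-- A `ℤ[t]`-scheme on which `t` is a nonzerodivisor. -/
def IsTorsionFree (p : Y ⟶ A1) : Prop :=
  ∀ (U : Y.Opens) (s : Γ(Y, U)), tFunOn p U * s = 0 → s = 0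

theorem tFunOn_eq_pullFun (p : Y ⟶ A1) (U : Y.Opens) : tFunOn p U = pullFun p U (Polynomial.X) :=
  rfl

theorem IsTorsionFree.mem_nonZeroDivisors {p : Y ⟶ A1} (h : IsTorsionFree p) (U : Y.Opens) :
    tFunOn p U ∈ nonZeroDivisors Γ(Y, U) :=
  mem_nonZeroDivisors_iff_right.2 fun s hs => h U s ((mul_comm _ _).trans hs)

/-- It suffices to check the vanishing of sections locally. -/
theorem section_eq_zero {U : Y.Opens} (s : Γ(Y, U))
    (h : ∀ x ∈ U, ∃ (V : Y.Opens) (hV : V ≤ U), x ∈ V ∧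
      (Y.presheaf.map (homOfLE hV).op).hom s = 0) : s = 0 := by
  apply Y.IsSheaf.section_ext
  intro x hx
  obtain ⟨V, hV, hxV, h0⟩ := h x hx
  exact ⟨V, hV, hxV, by rw [map_zero]; exact h0⟩

theorem tFunOn_res_mul {p : Y ⟶ A1} {U V : Y.Opens} (hV : V ≤ U) {s : Γ(Y, U)}
    (h : tFunOn p U * s = 0) : tFunOn p V * (Y.presheaf.map (homOfLE hV).op).hom s = 0 := by
  rw [← tFunOn_map p hV, ← map_mul, h, map_zero]

/-- Killing the sections annihilated by a power of `t` leaves no `t`-torsion. -/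
theorem isTorsionFree_plus (p : Y ⟶ A1) : IsTorsionFree (plusι p ≫ p) := by
  intro U s hs
  set ι := plusι p with hι
  have : IsClosedImmersion ι := inferInstanceAs (IsClosedImmersion (torsIdeal p).subschemeι)
  obtain ⟨U', hU'⟩ := ι.isClosedEmbedding.isInducing.isOpen_iff.1 U.2
  obtain ⟨U', rfl⟩ : ∃ W : Y.Opens, W.1 = U' := ⟨⟨U', hU'.1⟩, rfl⟩
  refine section_eq_zero s fun x hx => ?_
  have hx' : ι x ∈ U' := by
    have : x ∈ ι ⁻¹' U'.1 := by rw [hU'.2]; exact hx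
    exact this
  obtain ⟨_, ⟨W, hW, rfl⟩, hxW, hWU⟩ :=
    Y.isBasis_affineOpens.exists_subset_of_mem_open hx' U'.2
  have hle : ι ⁻¹ᵁ W ≤ U := fun y hy => by
    have : y ∈ ι ⁻¹' U'.1 := hWU hy
    rwa [hU'.2] at this
  refine ⟨ι ⁻¹ᵁ W, hle, hxW, ?_⟩
  obtain ⟨s', hs'⟩ := (torsIdeal p).subschemeι_app_surjective ⟨W, hW⟩
    ((plus p).presheaf.map (homOfLE hle).op s)
  have hs' : (ι.app W).hom s' = ((plus p).presheaf.map (homOfLE hle).op).hom s := hs'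
  have hker := (torsIdeal p).ker_subschemeι_app ⟨W, hW⟩
  have hker : RingHom.ker (ι.app W).hom = powerTorsion (tFunOn p W) := hker
  have h1 : tFunOn p W * s' ∈ RingHom.ker (ι.app W).hom := by
    rw [RingHom.mem_ker, map_mul, hs', tFunOn_eq_pullFun, pullFun_app]
    exact tFunOn_res_mul hle hs
  rw [hker] at h1
  obtain ⟨n, hn⟩ := h1
  rw [← hs', ← RingHom.mem_ker, hker]
  exact ⟨n + 1, by rw [pow_succ, mul_assoc]; exact hn⟩

theorem IsTorsionFree.comp_openImmersion {p : Y ⟶ A1} (h : IsTorsionFree p) (j : X ⟶ Y)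
    [IsOpenImmersion j] : IsTorsionFree (j ≫ p) := by
  intro U s hs
  have hinj : Function.Injective (j.appIso U).inv.hom :=
    (j.appIso U).symm.commRingCatIsoToRingEquiv.injective
  apply hinj
  rw [map_zero]
  refine h _ _ ?_
  have ht : tFunOn p (j ''ᵁ U) = (j.appIso U).inv.hom (tFunOn (j ≫ p) U) := by
    have h1 : (j.appIso U).hom.hom (tFunOn p (j ''ᵁ U)) = tFunOn (j ≫ p) U := by
      rw [Scheme.Hom.appIso_hom, CommRingCat.comp_apply, tFunOn_eq_pullFun, pullFun_app]
      exact pullFun_res (j ≫ p) _ _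
    rw [← h1, ← CommRingCat.comp_apply, Iso.hom_inv_id]
    rfl
  rw [ht, ← map_mul, hs, map_zero]

/-- On an affine scheme, it suffices to consider global functions. -/
theorem isTorsionFree_of_isAffine [IsAffine Y] (p : Y ⟶ A1)
    (h : ∀ s : Γ(Y, ⊤), tFun p * s = 0 → s = 0) : IsTorsionFree p := by
  intro U s hs
  refine section_eq_zero s fun x hx => ?_
  obtain ⟨f, hfU, hxf⟩ := (isAffineOpen_top Y).exists_basicOpen_le ⟨x, hx⟩ (Set.mem_univ x)
  refine ⟨Y.basicOpen f, hfU, hxf, ?_⟩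
  let _ : Algebra Γ(Y, ⊤) Γ(Y, Y.basicOpen f) :=
    (Y.presheaf.map (homOfLE (Y.basicOpen_le f)).op).hom.toAlgebra
  have _ : IsLocalization.Away f Γ(Y, Y.basicOpen f) :=
    (isAffineOpen_top Y).isLocalization_of_eq_basicOpen _ _ rfl
  have ht : algebraMap Γ(Y, ⊤) Γ(Y, Y.basicOpen f) (tFun p) = tFunOn p (Y.basicOpen f) := rfl
  have h0 := tFunOn_res_mul hfU hs
  set z := (Y.presheaf.map (homOfLE hfU).op).hom s
  obtain ⟨⟨a, y⟩, hay⟩ := IsLocalization.surj (Submonoid.powers f) z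
  have h1 : algebraMap Γ(Y, ⊤) Γ(Y, Y.basicOpen f) (tFun p * a) =
      algebraMap Γ(Y, ⊤) Γ(Y, Y.basicOpen f) 0 := by
    rw [map_mul, ← hay, ht, ← mul_assoc, h0, zero_mul, map_zero]
  obtain ⟨c, hc⟩ := (IsLocalization.eq_iff_exists (Submonoid.powers f) _).1 h1
  have h2 : (c : Γ(Y, ⊤)) * a = 0 := h _ (by
    rw [mul_zero] at hc
    rw [← hc]
    ring)
  have hu := (IsLocalization.map_units Γ(Y, Y.basicOpen f) c).mul
    (IsLocalization.map_units Γ(Y, Y.basicOpen f) y)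
  rw [← hu.mul_right_eq_zero, mul_assoc, mul_comm (algebraMap _ _ _) z, hay, ← map_mul, h2,
    map_zero]

instance (p : Y ⟶ A1) : IsClosedImmersion (plusι p) :=
  inferInstanceAs (IsClosedImmersion (torsIdeal p).subschemeι)

/-- Morphisms from schemes without `t`-torsion factor through the closed subscheme that kills the
`t`-torsion. -/
theorem exists_lift_plus (p : Y ⟶ A1) (u : X ⟶ Y) (h : IsTorsionFree (u ≫ p)) :
    ∃ l : X ⟶ plus p, l ≫ plusι p = u := by
  have hker : (plusι p).ker ≤ u.ker := by
    have : (plusι p).ker = torsIdeal p := (torsIdeal p).ker_subschemeι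
    rw [this, Scheme.Hom.ker, Scheme.IdealSheafData.le_ofIdeals_iff]
    rintro U s ⟨n, hn⟩
    rw [RingHom.mem_ker]
    have h1 : tFunOn (u ≫ p) (u ⁻¹ᵁ U.1) ^ n * (u.app U.1).hom s = 0 := by
      have := congrArg (u.app U.1).hom hn
      rw [map_mul, map_pow, map_zero, tFunOn_eq_pullFun, pullFun_app] at this
      exact this
    clear hn
    induction n with
    | zero => simpa using h1
    | succ n ih =>
      rw [pow_succ', mul_assoc] at h1
      exact ih (h _ _ h1)
  exact ⟨IsClosedImmersion.lift _ _ hker, IsClosedImmersion.lift_fac _ _ _⟩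

theorem plusMap_plusι {Z Y : Scheme.{0}} (q : Z ⟶ A1) (p : Y ⟶ A1) (f : Z ⟶ Y) (hf : f ≫ p = q) :
    plusMap q p f hf ≫ plusι p = plusι q ≫ f :=
  Scheme.IdealSheafData.subschemeMap_subschemeι _ _ _ _

end TorsionFree

/-! ### Morphisms to the source -/

section Source

variable (g : ℕ) {N : ℕ} (d : Fin N → ℕ)

/-- The morphism from the source to the scheme of pairings. -/
def sourceToSig : Source g d ⟶ Spec (.of (SigmaRing g N)) :=
  plusι _ ≫ pullback.fst (sigDToMu g d) (muBlToMu g N) ≫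
    pullback.fst (sigToMu g N) (muD g d).ι ≫ (sigmaClosedToMu g N ⁻¹ᵁ muOpen g N).ι

/-- The morphism from the target to the closed subscheme of tuples. -/
def targetToClosed (g N : ℕ) : Target g N ⟶ MuClosed g N := targetToMu g N ≫ (muOpen g N).ι

/-- The structure morphism of the target over the affine line. -/
def targetToA1 (g N : ℕ) : Target g N ⟶ A1 := plusι (muBlToA1 g N) ≫ muBlToA1 g N

theorem isTorsionFree_target (N : ℕ) : IsTorsionFree (targetToA1 g N) := isTorsionFree_plus _

theorem targetToClosed_comp (N : ℕ) : targetToClosed g N ≫ muClosedToA1 g N = targetToA1 g N :=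
  (Category.assoc (plusι _ ≫ muBlToMu g N) _ _).trans (Category.assoc (plusι _) (muBlToMu g N) _)

theorem mainMap_plusι : mainMap g d ≫ plusι (muBlToA1 g N) = plusι _ ≫ fibreToBl g d :=
  plusMap_plusι _ _ _ _

theorem sourceToSig_comp :
    sourceToSig g d ≫ sigmaClosedToMu g N = mainMap g d ≫ targetToClosed g N := by
  have h := morphismRestrict_ι (sigmaClosedToMu g N) (muOpen g N)
  have h' : fibreToBl g d ≫ muBlToMu g N =
      pullback.fst (sigDToMu g d) _ ≫ pullback.fst (sigToMu g N) (muD g d).ι ≫ sigToMu g N :=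
    pullback.condition.symm
  simp only [sourceToSig, targetToClosed, targetToMu, Category.assoc]
  rw [reassoc_of% (mainMap_plusι g d), ← h, reassoc_of% h']
  rfl

theorem isTorsionFree_source : IsTorsionFree (mainMap g d ≫ targetToA1 g N) := by
  have h := isTorsionFree_plus (fibreToBl g d ≫ muBlToA1 g N)
  rw [targetToA1, ← Category.assoc, mainMap_plusι, Category.assoc]
  exact h

/-- The source lies over `μ_{(d_i)}`. -/
theorem mainMap_mem_muD (z : Source g d) :
    targetToMu g N (mainMap g d z) ∈ muD g d := by
  have h : mainMap g d ≫ targetToMu g N = plusι _ ≫ pullback.fst (sigDToMu g d) (muBlToMu g N) ≫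
      pullback.snd (sigToMu g N) (muD g d).ι ≫ (muD g d).ι := by
    have h' : fibreToBl g d ≫ muBlToMu g N =
        pullback.fst (sigDToMu g d) _ ≫ pullback.fst (sigToMu g N) (muD g d).ι ≫ sigToMu g N :=
      pullback.condition.symm
    rw [targetToMu, reassoc_of% (mainMap_plusι g d), h', pullback.condition]
  have h2 : targetToMu g N (mainMap g d z) = (mainMap g d ≫ targetToMu g N) z := rfl
  rw [h2, h]
  exact ((plusι _ ≫ pullback.fst (sigDToMu g d) (muBlToMu g N) ≫
      pullback.snd (sigToMu g N) (muD g d).ι) z).2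

variable {g d} {X : Scheme.{0}}

/-- A morphism to the source is determined by the induced morphisms to the target and to the scheme
of pairings. -/
theorem source_hom_ext {m₁ m₂ : X ⟶ Source g d} (h : m₁ ≫ mainMap g d = m₂ ≫ mainMap g d)
    (h' : m₁ ≫ sourceToSig g d = m₂ ≫ sourceToSig g d) : m₁ = m₂ := by
  rw [← cancel_mono (plusι _)]
  apply pullback.hom_ext
  · rw [← cancel_mono (pullback.fst (sigToMu g N) (muD g d).ι),
      ← cancel_mono (sigmaClosedToMu g N ⁻¹ᵁ muOpen g N).ι]
    simpa only [Category.assoc, sourceToSig] using h'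
  · have := h =≫ plusι _
    rw [Category.assoc, Category.assoc, mainMap_plusι, ← Category.assoc, ← Category.assoc] at this
    exact this

/-- The universal property of the source among schemes without `t`-torsion. -/
theorem exists_source_lift (a : X ⟶ Target g N) (ha : IsTorsionFree (a ≫ targetToA1 g N))
    (hD : ∀ x, targetToMu g N (a x) ∈ muD g d) (σ : X ⟶ Spec (.of (SigmaRing g N)))
    (hσ : σ ≫ sigmaClosedToMu g N = a ≫ targetToClosed g N) :
    ∃ m : X ⟶ Source g d, m ≫ mainMap g d = a ∧ m ≫ sourceToSig g d = σ := by
  have hpb := isPullback_morphismRestrict (sigmaClosedToMu g N) (muOpen g N)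
  let s : X ⟶ Sig g N := hpb.lift (a ≫ targetToMu g N) σ (by
    rw [hσ, targetToClosed, Category.assoc])
  have hs1 : s ≫ sigToMu g N = a ≫ targetToMu g N := hpb.lift_fst _ _ _
  have hs2 : s ≫ (sigmaClosedToMu g N ⁻¹ᵁ muOpen g N).ι = σ := hpb.lift_snd _ _ _
  let e : X ⟶ (muD g d).toScheme := IsOpenImmersion.lift (muD g d).ι (a ≫ targetToMu g N) (by
    rw [Scheme.Opens.range_ι]
    rintro _ ⟨x, rfl⟩
    exact hD x)
  have he : e ≫ (muD g d).ι = a ≫ targetToMu g N := IsOpenImmersion.lift_fac _ _ _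
  let w : X ⟶ SigD g d := pullback.lift s e (hs1.trans he.symm)
  let z : X ⟶ pullback (sigDToMu g d) (muBlToMu g N) := pullback.lift w (a ≫ plusι _) (by
    rw [sigDToMu, pullback.lift_fst_assoc, hs1, targetToMu, Category.assoc])
  have hz : z ≫ fibreToBl g d = a ≫ plusι _ := pullback.lift_snd _ _ _
  obtain ⟨m, hm⟩ := exists_lift_plus (fibreToBl g d ≫ muBlToA1 g N) z (by
    rw [← Category.assoc, hz, Category.assoc]
    exact ha)
  refine ⟨m, ?_, ?_⟩
  · rw [← cancel_mono (plusι _), Category.assoc, mainMap_plusι, reassoc_of% hm, hz]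
  · rw [sourceToSig, reassoc_of% hm, pullback.lift_fst_assoc, pullback.lift_fst_assoc, hs2]

end Source

/-! ### Divisibility of minors on the blow-up -/

section Rees

variable {R : Type} [CommRing R] (I : Ideal R)

/-- The element `f · X` of degree one of the Rees algebra. -/
def reesOne (f : I) : reesAlgebra I :=
  ⟨monomial 1 (f : R), reesAlgebra.monomial_mem.2 (by rw [pow_one]; exact f.2)⟩

theorem reesOne_mem (f : I) : reesOne I f ∈ reesPart I 1 := by
  intro i hi
  exact coeff_monomial_of_ne _ hi

variable {I}

theorem eq_monomial_of_mem_reesPart {n : ℕ} {z : reesAlgebra I} (hz : z ∈ reesPart I n) :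
    (z : R[X]) = monomial n ((z : R[X]).coeff n) := by
  ext i
  rw [coeff_monomial]
  split_ifs with h
  · rw [h]
  · exact hz i (Ne.symm h)

/-- Generators of `I`, placed in degree one, generate the irrelevant ideal of the Rees algebra. -/
theorem irrelevant_le_span {S : Set R} (hS : Ideal.span S = I) :
    (HomogeneousIdeal.irrelevant (reesPart I)).toIdeal ≤
      Ideal.span (Set.range fun f : {f : I // (f : R) ∈ S} => reesOne I f) := by
  rw [HomogeneousIdeal.toIdeal_irrelevant_le]
  intro n hn z hz
  obtain ⟨n, rfl⟩ : ∃ k, n = k + 1 := ⟨n - 1, by omega⟩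
  set J := Ideal.span (Set.range fun f : {f : I // (f : R) ∈ S} => reesOne I f)
  have key : ∀ a ∈ I * I ^ n, ∃ y ∈ J, (y : R[X]) = monomial (n + 1) a := by
    intro a ha
    induction ha using Submodule.mul_induction_on' with
    | mem_mul_mem s hs b hb =>
      have hb' : monomial n b ∈ reesAlgebra I := reesAlgebra.monomial_mem.2 hb
      rw [← hS] at hs
      induction hs using Submodule.span_induction with
      | mem s hs =>
        have hsI : s ∈ I := hS ▸ Ideal.subset_span hs
        refine ⟨⟨_, hb'⟩ * reesOne I ⟨s, hsI⟩,
          J.mul_mem_left _ (Ideal.subset_span ⟨⟨⟨s, hsI⟩, hs⟩, rfl⟩), ?_⟩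
        simp [reesOne, monomial_mul_monomial, mul_comm]
      | zero => exact ⟨0, J.zero_mem, by simp⟩
      | add x y _ _ hx hy =>
        obtain ⟨p, hp, hp'⟩ := hx
        obtain ⟨q, hq, hq'⟩ := hy
        exact ⟨p + q, J.add_mem hp hq, by rw [AddMemClass.coe_add, hp', hq', add_mul, map_add]⟩
      | smul r x _ hx =>
        obtain ⟨p, hp, hp'⟩ := hx
        refine ⟨algebraMap R _ r * p, J.mul_mem_left _ hp, ?_⟩
        rw [← Algebra.smul_def, smul_mul_assoc, ← smul_monomial, ← hp']
        rfl
    | add x _ y _ hx hy =>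
      obtain ⟨p, hp, hp'⟩ := hx
      obtain ⟨q, hq, hq'⟩ := hy
      exact ⟨p + q, J.add_mem hp hq, by rw [AddMemClass.coe_add, hp', hq', map_add]⟩
  have hc : (z : R[X]).coeff (n + 1) ∈ I * I ^ n := by
    rw [← pow_succ']
    exact z.2 _
  obtain ⟨y, hy, hyz⟩ := key _ hc
  have : z = y := Subtype.ext ((eq_monomial_of_mem_reesPart hz).trans hyz.symm)
  rw [this]
  exact hy

/-- The algebra of functions on the chart of the blow-up where `f` generates the inverse image of
`I`. -/
abbrev ReesAway (f : I) : Type := HomogeneousLocalization.Away (reesPart I) (reesOne I f)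

/-- The pullback of functions to this chart. -/
def reesAwayMap (f : I) : R →+* ReesAway f :=
  (HomogeneousLocalization.fromZeroRingHom (reesPart I) _).comp (algebraMap R (reesPart I 0))

theorem val_reesAwayMap (f : I) (r : R) :
    (reesAwayMap f r).val = algebraMap _ _ (algebraMap R (reesAlgebra I) r) := by
  exact Localization.mk_one_eq_algebraMap _

/-- On the chart, the inverse image of `I` is generated by that of `f`. -/
theorem reesAwayMap_dvd (f h : I) : reesAwayMap f f ∣ reesAwayMap f h := by
  refine ⟨HomogeneousLocalization.Away.mk (reesPart I) (reesOne_mem I f) 1 (reesOne I h)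
    (reesOne_mem I h), HomogeneousLocalization.val_injective _ ?_⟩
  rw [HomogeneousLocalization.val_mul, val_reesAwayMap, val_reesAwayMap,
    HomogeneousLocalization.Away.val_mk, Localization.mk_eq_mk',
    IsLocalization.mul_mk'_eq_mk'_of_mul, IsLocalization.eq_mk'_iff_mul_eq, ← map_mul]
  congr 1
  apply Subtype.ext
  have e (r : R) : ((algebraMap R (reesAlgebra I) r : reesAlgebra I) : R[X]) = C r := rfl
  simp [reesOne, e, C_mul_monomial, mul_comm]

/-- The inverse image of `f` on its chart is a nonzerodivisor. -/
theorem reesAwayMap_mul_eq_zero (f : I) (y : ReesAway f) (h : reesAwayMap f f * y = 0) :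
    y = 0 := by
  obtain ⟨n, z, hz, rfl⟩ := HomogeneousLocalization.Away.mk_surjective (reesPart I)
    (reesOne_mem I f) y
  have h' := congrArg HomogeneousLocalization.val h
  apply HomogeneousLocalization.val_injective
  rw [HomogeneousLocalization.val_zero] at h' ⊢
  rw [HomogeneousLocalization.val_mul, val_reesAwayMap,
    HomogeneousLocalization.Away.val_mk, Localization.mk_eq_mk', ← IsLocalization.mk'_one
      (M := Submonoid.powers (reesOne I f)), ← IsLocalization.mk'_mul,
      IsLocalization.mk'_eq_zero_iff] at h'
  rw [HomogeneousLocalization.Away.val_mk, Localization.mk_eq_mk', IsLocalization.mk'_eq_zero_iff]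
  obtain ⟨⟨_, k, rfl⟩, hk⟩ := h'
  refine ⟨⟨_, k + 1, rfl⟩, ?_⟩
  apply Subtype.ext
  have hk' := congrArg (fun w : reesAlgebra I => (Polynomial.X : R[X]) * (w : R[X])) hk
  simp only [MulMemClass.coe_mul, SubmonoidClass.coe_pow, ZeroMemClass.coe_zero, mul_zero] at hk' ⊢
  rw [← hk']
  have e : (reesOne I f : R[X]) = X * C (f : R) := by
    rw [X_mul_C, C_mul_X_eq_monomial]
    rfl
  have e2 : ((algebraMap R (reesAlgebra I) f : reesAlgebra I) : R[X]) = C (f : R) := rfl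
  rw [e2, pow_succ]
  nth_rewrite 2 [e]
  ring

/-- If the inverse image of a product of ideals is generated by a nonzerodivisor that is a product
of elements of these ideals, then each of these elements generates the inverse image of its
ideal. -/
theorem dvd_of_dvd_prod {B : Type} [CommRing B] (φ : R →+* B) {s : Finset ℕ} {K : ℕ → Ideal R}
    {L : Ideal R} {m : ℕ → R} {l : R} (hm : ∀ k ∈ s, m k ∈ K k) (hl : l ∈ L)
    (hd : ∀ h ∈ (∏ k ∈ s, K k) * L, φ ((∏ k ∈ s, m k) * l) ∣ φ h)
    (h0 : ∀ y, φ ((∏ k ∈ s, m k) * l) * y = 0 → y = 0) {k : ℕ} (hk : k ∈ s) {n : R}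
    (hn : n ∈ K k) : φ (m k) ∣ φ n := by
  classical
  set c := (∏ k ∈ s.erase k, m k) * l with hc
  have hfc : (∏ k ∈ s, m k) * l = m k * c := by
    rw [hc, ← Finset.mul_prod_erase s m hk, mul_assoc]
  have hnc : n * c ∈ (∏ k ∈ s, K k) * L := by
    rw [hc, ← Finset.mul_prod_erase s K hk, ← mul_assoc]
    exact Ideal.mul_mem_mul (Ideal.mul_mem_mul hn
      (Ideal.prod_mem_prod fun i hi => hm i (Finset.mem_of_mem_erase hi))) hl
  obtain ⟨y, hy⟩ := hd _ hnc
  refine ⟨y, ?_⟩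
  rw [← sub_eq_zero]
  apply h0
  simp only [hfc, map_mul] at hy ⊢
  linear_combination φ (m k) * hy

theorem blowUpMap_eq (f : I) :
    Proj.awayι (reesPart I) (reesOne I f) (reesOne_mem I f) one_pos ≫ blowUpMap I =
      Spec.map (CommRingCat.ofHom (reesAwayMap f)) := by
  refine (Proj.awayι_toSpecZero_assoc (reesPart I) (reesOne I f) (reesOne_mem I f) one_pos
    (Spec.map (CommRingCat.ofHom (algebraMap R (reesPart I 0))))).trans ?_
  rw [← Spec.map_comp]
  rfl

end Rees

section Target

variable {R : Type} [CommRing R] {I : Ideal R}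

open scoped Pointwise in
/-- A morphism to the blow-up along a product of ideals: locally, the inverse image of each
of these ideals is generated by one of its given generators. -/
theorem exists_dvd_of_hom_blowUp {s : Finset ℕ} {G : ℕ → Set R} {L : Ideal R}
    (hI : I = (∏ k ∈ s, Ideal.span (G k)) * L) {Y : Scheme.{0}} (u : Y ⟶ blowUp I) (x : Y) :
    ∃ W : Y.Opens, x ∈ W ∧ ∀ k ∈ s, ∃ m ∈ G k, ∀ n ∈ G k,
      pullFun (W.ι ≫ u ≫ blowUpMap I) ⊤ m ∣ pullFun (W.ι ≫ u ≫ blowUpMap I) ⊤ n := by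
  -- The charts given by products of generators cover the blow-up.
  have hS : Ideal.span ((∏ k ∈ s, G k) * (L : Set R)) = I := by
    rw [hI, ← Ideal.span_mul_span', Ideal.span_eq]
    congr 1
    exact (Submodule.prod_span (R := R) s G).symm
  have htop := Proj.iSup_basicOpen_eq_top _ _ (irrelevant_le_span hS)
  let u' : Y ⟶ Proj (reesPart I) := u
  have hx : u' x ∈ (⊤ : (Proj (reesPart I)).Opens) := trivial
  rw [← htop, TopologicalSpace.Opens.mem_iSup] at hx
  obtain ⟨⟨f, hf⟩, hx⟩ := hx
  obtain ⟨_, hp, l, hl, hfl⟩ := hf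
  obtain ⟨m, hm, rfl⟩ := Set.mem_finsetProd _ _ _ |>.1 hp
  have hr := Proj.opensRange_awayι (reesPart I) (reesOne I f) (reesOne_mem I f) one_pos
  let W : Y.Opens := u' ⁻¹ᵁ (Proj.basicOpen (reesPart I) (reesOne I f))
  let j := Proj.awayι (reesPart I) (reesOne I f) (reesOne_mem I f) one_pos
  let v : W.toScheme ⟶ Spec (.of (ReesAway f)) := IsOpenImmersion.lift j (W.ι ≫ u) (by
    rintro _ ⟨y, rfl⟩
    have h1 : u (W.ι y) ∈ Proj.basicOpen (reesPart I) (reesOne I f) := y.2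
    rw [← hr] at h1
    exact h1)
  have hv : v ≫ j = W.ι ≫ u := IsOpenImmersion.lift_fac _ _ _
  have hW : W.ι ≫ u ≫ blowUpMap I = v ≫ Spec.map (CommRingCat.ofHom (reesAwayMap f)) := by
    rw [← blowUpMap_eq, ← Category.assoc, ← hv]
    exact Category.assoc v j (blowUpMap I)
  refine ⟨W, hx, fun k hk => ⟨m k, hm hk, fun n hn => ?_⟩⟩
  rw [hW, pullFun_comp_SpecMap, pullFun_comp_SpecMap]
  have hfl : (∏ k ∈ s, m k) * l = f := hfl
  refine map_dvd _ (dvd_of_dvd_prod (reesAwayMap f) (fun k hk => Ideal.subset_span (hm hk)) hl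
    ?_ ?_ hk (Ideal.subset_span hn))
  · intro h hh
    rw [hfl]
    exact reesAwayMap_dvd f ⟨h, hI ▸ hh⟩
  · rw [hfl]
    exact reesAwayMap_mul_eq_zero f

/-- The ring homomorphism to the stalk that is induced by a morphism to `Spec R`. -/
def pullStalk {Y : Scheme.{0}} (p : Y ⟶ Spec (.of R)) (x : Y) : R →+* Y.presheaf.stalk x :=
  (Y.presheaf.germ ⊤ x trivial).hom.comp (pullFun p ⊤)

theorem germ_pullFun {Y : Scheme.{0}} (p : Y ⟶ Spec (.of R)) (U : Y.Opens) (x : Y) (hx : x ∈ U)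
    (r : R) : (Y.presheaf.germ U x hx).hom (pullFun p U r) = pullStalk p x r := by
  rw [← pullFun_res p (le_top : U ≤ ⊤), ← CommRingCat.comp_apply, Y.presheaf.germ_res]
  rfl

/-- Functions on an open subscheme have germs on the ambient scheme. -/
theorem exists_ringHom_stalk {Y : Scheme.{0}} (p : Y ⟶ Spec (.of R)) (W : Y.Opens) (x : Y)
    (hx : x ∈ W) : ∃ θ : Γ(W.toScheme, ⊤) →+* Y.presheaf.stalk x, ∀ r,
      θ (pullFun (W.ι ≫ p) ⊤ r) = pullStalk p x r := by
  have hx' : x ∈ W.ι ''ᵁ ⊤ := ⟨⟨x, hx⟩, trivial, rfl⟩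
  refine ⟨(Y.presheaf.germ (W.ι ''ᵁ ⊤) x hx').hom, fun r => ?_⟩
  rw [← pullFun_appTop, ← germ_pullFun p (W.ι ''ᵁ ⊤) x hx', ← pullFun_res p
    (le_top : W.ι ''ᵁ ⊤ ≤ ⊤)]
  rfl

/-- At a point of the target, the minors of size `k` of the upper left block of `Π_0` generate a
principal ideal that is generated by one of them. -/
theorem exists_minor_dvd (g N : ℕ) (x : Target g N) (k : ℕ) (h1 : 1 ≤ k) (hk : k ≤ g - 1) :
    ∃ r c : Fin k ↪ Fin g, ∀ r' c' : Fin k ↪ Fin g,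
      ((((univPi g N 0).map (pullStalk (targetToClosed g N) x)).toBlocks₁₁).submatrix r c).det ∣
      ((((univPi g N 0).map (pullStalk (targetToClosed g N) x)).toBlocks₁₁).submatrix r' c').det
      := by
  let u : Target g N ⟶ blowUp (muCenter g N) :=
    plusι (muBlToA1 g N) ≫ (blowUpMap (muCenter g N) ⁻¹ᵁ muOpen g N).ι
  have hu : u ≫ blowUpMap (muCenter g N) = targetToClosed g N := by
    have := morphismRestrict_ι (blowUpMap (muCenter g N)) (muOpen g N)
    simp only [u, targetToClosed, targetToMu, Category.assoc, muBlToMu]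
    rw [this]
  obtain ⟨W, hxW, hW⟩ := exists_dvd_of_hom_blowUp (I := muCenter g N) (s := Finset.Icc 1 (g - 1))
    (G := fun k => {f | ∃ r c : Fin k ↪ Fin g,
      f = ((univPi g N 0).toBlocks₁₁.submatrix r c).det}) rfl u x
  obtain ⟨_, ⟨r, c, rfl⟩, h⟩ := hW k (Finset.mem_Icc.2 ⟨h1, hk⟩)
  obtain ⟨θ, hθ⟩ := exists_ringHom_stalk (targetToClosed g N) W x hxW
  refine ⟨r, c, fun r' c' => ?_⟩
  have h2 := map_dvd θ (h _ ⟨r', c', rfl⟩)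
  rw [hu, hθ, hθ, RingHom.map_det, RingHom.map_det] at h2
  exact h2

end Target

/-! ### Normal forms near a point -/

section Spreading

variable {Y : Scheme.{0}} {x : Y}

/-- The restriction of functions. -/
abbrev resHom {U V : Y.Opens} (h : V ≤ U) : Γ(Y, U) →+* Γ(Y, V) :=
  (Y.presheaf.map (homOfLE h).op).hom

/-- The passage from functions to germs. -/
abbrev germHom (U : Y.Opens) (hx : x ∈ U) : Γ(Y, U) →+* Y.presheaf.stalk x :=
  (Y.presheaf.germ U x hx).hom

theorem germHom_resHom {U V : Y.Opens} (h : V ≤ U) (hx : x ∈ V) (s : Γ(Y, U)) :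
    germHom V hx (resHom h s) = germHom U (h hx) s := by
  rw [germHom, resHom, ← CommRingCat.comp_apply, Y.presheaf.germ_res]

theorem resHom_resHom {U V W : Y.Opens} (h : V ≤ U) (h' : W ≤ V) (s : Γ(Y, U)) :
    resHom h' (resHom h s) = resHom (h'.trans h) s := by
  rw [resHom, resHom, ← CommRingCat.comp_apply, ← Functor.map_comp]
  rfl

/-- A finite intersection of open neighbourhoods. -/
theorem exists_le_of_finite {κ : Type} [Finite κ] (W : κ → Y.Opens) (h : ∀ k, x ∈ W k) :
    ∃ V : Y.Opens, x ∈ V ∧ ∀ k, V ≤ W k :=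
  ⟨⟨⋂ k, (W k : Set Y), isOpen_iInter_of_finite fun k => (W k).2⟩, Set.mem_iInter.2 h,
    fun k => Set.iInter_subset (fun k => (W k : Set Y)) k⟩

/-- Finitely many germs extend to a common neighbourhood. -/
theorem exists_germHom_eq {κ : Type} [Finite κ] (a : κ → Y.presheaf.stalk x) :
    ∃ (V : Y.Opens) (hx : x ∈ V) (s : κ → Γ(Y, V)), ∀ k, germHom V hx (s k) = a k := by
  choose W hW s hs using fun k => Y.presheaf.exists_germ_eq (a k)
  obtain ⟨V, hV, hVW⟩ := exists_le_of_finite W hW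
  exact ⟨V, hV, fun k => resHom (hVW k) (s k), fun k => by
    rw [germHom_resHom]
    exact hs k⟩

/-- Equalities between finitely many germs hold on all sufficiently small open subsets. -/
theorem exists_resHom_eq {κ : Type} [Finite κ] {V : Y.Opens} (hx : x ∈ V) (s s' : κ → Γ(Y, V))
    (h : ∀ k, germHom V hx (s k) = germHom V hx (s' k)) :
    ∃ W : Y.Opens, x ∈ W ∧ ∀ (W' : Y.Opens) (hV : W' ≤ V), W' ≤ W →
      ∀ k, resHom hV (s k) = resHom hV (s' k) := by
  choose W hW i i' hi using fun k => Y.presheaf.germ_eq x hx hx (s k) (s' k) (h k)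
  obtain ⟨V', hV', hVW⟩ := exists_le_of_finite W hW
  refine ⟨V', hV', fun W' hV hW' k => ?_⟩
  have h1 := congrArg (resHom (hW'.trans (hVW k))) (hi k)
  have h2 := resHom_resHom (leOfHom (i k)) (hW'.trans (hVW k)) (s k)
  have h3 := resHom_resHom (leOfHom (i k)) (hW'.trans (hVW k)) (s' k)
  exact h2.symm.trans (h1.trans h3)

/-- A normal form over the stalk at a point extends to a neighbourhood. -/
theorem NormalData.exists_of_germ {g : ℕ} {U : Y.Opens} (hx : x ∈ U) {t : Γ(Y, U)}
    {M T : Matrix (Idx g) (Idx g) Γ(Y, U)}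
    (d : NormalData (germHom U hx t) (M.map (germHom U hx)) (T.map (germHom U hx))) :
    ∃ (V : Y.Opens) (hV : V ≤ U), x ∈ V ∧
      Nonempty (NormalData (resHom hV t) (M.map (resHom hV)) (T.map (resHom hV))) := by
  obtain ⟨V₀, hx₀, s, hs⟩ := exists_germHom_eq (x := x) fun k :
    (Bool × Bool × Idx g × Idx g) ⊕ (Bool × Fin g) ⊕ (Fin g × Fin g) => match k with
      | .inl (false, e, p, q) => d.h e p q
      | .inl (true, e, p, q) => d.h' e p q
      | .inr (.inl (false, i)) => d.D i
      | .inr (.inl (true, i)) => d.C i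
      | .inr (.inr (i, j)) => d.q i j
  let V := V₀ ⊓ U
  have hxV : x ∈ V := ⟨hx₀, hx⟩
  have hVU : V ≤ U := inf_le_right
  let γ := germHom V hxV
  let r := resHom (inf_le_left : V ≤ V₀)
  have hr : ∀ k, γ (r (s k)) = germHom V₀ hx₀ (s k) := fun k =>
    germHom_resHom (inf_le_left : V ≤ V₀) hxV (s k)
  let h : Bool → Matrix (Idx g) (Idx g) Γ(Y, V) := fun e => .of fun p q =>
    r (s (.inl (false, e, p, q)))
  let h' : Bool → Matrix (Idx g) (Idx g) Γ(Y, V) := fun e => .of fun p q =>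
    r (s (.inl (true, e, p, q)))
  let D : Fin g → Γ(Y, V) := fun i => r (s (.inr (.inl (false, i))))
  let C : Fin g → Γ(Y, V) := fun i => r (s (.inr (.inl (true, i))))
  let q : Fin g → Fin g → Γ(Y, V) := fun i j => r (s (.inr (.inr (i, j))))
  let M' := M.map (resHom hVU)
  let T' := T.map (resHom hVU)
  have eh : ∀ e, (h e).map γ = d.h e := fun e => by
    ext a b
    exact (hr _).trans (hs _)
  have eh' : ∀ e, (h' e).map γ = d.h' e := fun e => by
    ext a b
    exact (hr _).trans (hs _)
  have eD : ∀ i, γ (D i) = d.D i := fun i => (hr _).trans (hs _)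
  have eC : ∀ i, γ (C i) = d.C i := fun i => (hr _).trans (hs _)
  have eq : ∀ i j, γ (q i j) = d.q i j := fun i j => (hr _).trans (hs _)
  have eM : M'.map γ = M.map (germHom U hx) := by
    ext a b
    exact germHom_resHom hVU hxV _
  have eT : T'.map γ = T.map (germHom U hx) := by
    ext a b
    exact germHom_resHom hVU hxV _
  have et : γ (resHom hVU t) = germHom U hx t := germHom_resHom hVU hxV _
  have eD' : (Matrix.diagonal D).map γ = Matrix.diagonal d.D := by
    rw [diagonal_map']
    exact congrArg _ (funext eD)
  have eC' : (Matrix.diagonal C).map γ = Matrix.diagonal d.C := by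
    rw [diagonal_map']
    exact congrArg _ (funext eC)
  have e1 : (1 : Matrix (Idx g) (Idx g) Γ(Y, V)).map γ = 1 :=
    Matrix.map_one _ (map_zero γ) (map_one γ)
  have e1' : (1 : Matrix (Fin g) (Fin g) Γ(Y, V)).map γ = 1 :=
    Matrix.map_one _ (map_zero γ) (map_one γ)
  have e0' : (0 : Matrix (Fin g) (Fin g) Γ(Y, V)).map γ = 0 := Matrix.map_zero _ (map_zero γ)
  -- Each of the equations of a normal form holds on a neighbourhood of `x`.
  obtain ⟨W₁, hx₁, hW₁⟩ := exists_resHom_eq hxV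
    (fun k : Bool × Idx g × Idx g => (h k.1 * h' k.1) k.2.1 k.2.2)
    (fun k => (1 : Matrix (Idx g) (Idx g) Γ(Y, V)) k.2.1 k.2.2) fun k => by
      have : (h k.1 * h' k.1).map γ = (1 : Matrix (Idx g) (Idx g) Γ(Y, V)).map γ := by
        rw [Matrix.map_mul, eh, eh', d.h_mul, e1]
      exact congrFun (congrFun this _) _
  obtain ⟨W₂, hx₂, hW₂⟩ := exists_resHom_eq hxV
    (fun k : Bool × Fin g × Fin g => h k.1 (.inr k.2.1) (.inl k.2.2)) (fun k => 0) fun k => by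
      have h1 := congrFun (congrFun (eh k.1) (.inr k.2.1)) (.inl k.2.2)
      have h2 := congrFun (congrFun (d.h_low k.1) k.2.1) k.2.2
      rw [map_zero]
      exact h1.trans h2
  obtain ⟨W₃, hx₃, hW₃⟩ := exists_resHom_eq hxV
    (fun k : Bool × Fin g × Fin g => h' k.1 (.inr k.2.1) (.inl k.2.2)) (fun k => 0) fun k => by
      have h1 := congrFun (congrFun (eh' k.1) (.inr k.2.1)) (.inl k.2.2)
      have h2 := congrFun (congrFun (d.h'_low k.1) k.2.1) k.2.2
      rw [map_zero]
      exact h1.trans h2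
  obtain ⟨W₄, hx₄, hW₄⟩ := exists_resHom_eq hxV
    (fun k : Idx g × Idx g => (h' true * M' * h false) k.1 k.2)
    (fun k => (Matrix.fromBlocks (Matrix.diagonal D) 1 0 (Matrix.diagonal C)) k.1 k.2)
    fun k => by
      have : (h' true * M' * h false).map γ =
          (Matrix.fromBlocks (Matrix.diagonal D) 1 0 (Matrix.diagonal C)).map γ := by
        rw [Matrix.map_mul, Matrix.map_mul, eh, eh', eM, d.left_eq, Matrix.fromBlocks_map, eD',
          eC', e1', e0']
      exact congrFun (congrFun this _) _
  obtain ⟨W₅, hx₅, hW₅⟩ := exists_resHom_eq hxV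
    (fun k : Idx g × Idx g => (h' false * T' * h true) k.1 k.2)
    (fun k => (Matrix.fromBlocks (-Matrix.diagonal C) 1 0 (-Matrix.diagonal D)) k.1 k.2)
    fun k => by
      have : (h' false * T' * h true).map γ =
          (Matrix.fromBlocks (-Matrix.diagonal C) 1 0 (-Matrix.diagonal D)).map γ := by
        rw [Matrix.map_mul, Matrix.map_mul, eh, eh', eT, d.right_eq, Matrix.fromBlocks_map,
          Matrix.map_neg _ (map_neg γ), Matrix.map_neg _ (map_neg γ), eD', eC', e1', e0']
      exact congrFun (congrFun this _) _
  obtain ⟨W₆, hx₆, hW₆⟩ := exists_resHom_eq hxV (fun i : Fin g => D i * C i)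
    (fun _ => -resHom hVU t) fun i => by
      change γ (D i * C i) = γ _
      rw [map_mul, map_neg, eD, eC, et, d.D_mul_C]
  obtain ⟨W₇, hx₇, hW₇⟩ := exists_resHom_eq hxV
    (fun k : {k : Fin g × Fin g // k.1 ≤ k.2} => D k.1.2) (fun k => q k.1.1 k.1.2 * D k.1.1)
    fun k => by
      change γ (D _) = γ (q _ _ * D _)
      rw [map_mul, eD, eD, eq]
      exact d.D_eq _ _ k.2
  obtain ⟨W₈, hx₈, hW₈⟩ := exists_resHom_eq hxV
    (fun k : {k : Fin g × Fin g // k.1 ≤ k.2} => C k.1.1) (fun k => q k.1.1 k.1.2 * C k.1.2)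
    fun k => by
      change γ (C _) = γ (q _ _ * C _)
      rw [map_mul, eC, eC, eq]
      exact d.C_eq _ _ k.2
  obtain ⟨W, hxW, hW⟩ := exists_le_of_finite (x := x) ![V, W₁, W₂, W₃, W₄, W₅, W₆, W₇, W₈]
    (fun k => by fin_cases k <;> assumption)
  have hWV : W ≤ V := hW 0
  let φ := resHom hWV
  have et' : φ (resHom hVU t) = resHom (hWV.trans hVU) t := resHom_resHom _ _ _
  have eM' : M'.map φ = M.map (resHom (hWV.trans hVU)) := by
    ext a b
    exact resHom_resHom _ _ _
  have eT' : T'.map φ = T.map (resHom (hWV.trans hVU)) := by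
    ext a b
    exact resHom_resHom _ _ _
  have f1 : (1 : Matrix (Idx g) (Idx g) Γ(Y, V)).map φ = 1 :=
    Matrix.map_one _ (map_zero φ) (map_one φ)
  have f1' : (1 : Matrix (Fin g) (Fin g) Γ(Y, V)).map φ = 1 :=
    Matrix.map_one _ (map_zero φ) (map_one φ)
  have f0' : (0 : Matrix (Fin g) (Fin g) Γ(Y, V)).map φ = 0 := Matrix.map_zero _ (map_zero φ)
  have fD : Matrix.diagonal (fun i => φ (D i)) = (Matrix.diagonal D).map φ :=
    (diagonal_map' φ D).symm
  have fC : Matrix.diagonal (fun i => φ (C i)) = (Matrix.diagonal C).map φ :=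
    (diagonal_map' φ C).symm
  refine ⟨W, hWV.trans hVU, hxW, ⟨{
    h := fun e => (h e).map φ
    h' := fun e => (h' e).map φ
    D := fun i => φ (D i)
    C := fun i => φ (C i)
    q := fun i j => φ (q i j)
    h_mul := fun e => ?_
    h_low := fun e => ?_
    h'_low := fun e => ?_
    left_eq := ?_
    right_eq := ?_
    D_mul_C := fun i => ?_
    D_eq := fun i j hij => ?_
    C_eq := fun i j hij => ?_ }⟩⟩
  · rw [← Matrix.map_mul, ← f1]
    ext a b
    exact hW₁ W hWV (hW 1) (e, a, b)
  · ext a b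
    exact (hW₂ W hWV (hW 2) (e, a, b)).trans (map_zero φ)
  · ext a b
    exact (hW₃ W hWV (hW 3) (e, a, b)).trans (map_zero φ)
  · rw [← eM', ← Matrix.map_mul, ← Matrix.map_mul, ← f1', ← f0', fD, fC,
      ← Matrix.fromBlocks_map]
    ext a b
    exact hW₄ W hWV (hW 4) (a, b)
  · rw [← eT', ← Matrix.map_mul, ← Matrix.map_mul, ← f1', ← f0', fD, fC,
      ← Matrix.map_neg _ (map_neg φ), ← Matrix.map_neg _ (map_neg φ), ← Matrix.fromBlocks_map]
    ext a b
    exact hW₅ W hWV (hW 5) (a, b)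
  · rw [← et', ← map_neg, ← map_mul]
    exact hW₆ W hWV (hW 6) i
  · rw [← map_mul]
    exact hW₇ W hWV (hW 7) ⟨(i, j), hij⟩
  · rw [← map_mul]
    exact hW₈ W hWV (hW 8) ⟨(i, j), hij⟩

end Spreading

section Local

theorem isUnit_pullStalk {R : Type} [CommRing R] {Y : Scheme.{0}} (p : Y ⟶ Spec (.of R)) (x : Y)
    {r : R} (h : r ∉ (p x).asIdeal) : IsUnit (pullStalk p x r) := by
  have h1 : p x ∈ (Spec (.of R)).basicOpen ((Scheme.ΓSpecIso (.of R)).inv r) := by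
    rw [basicOpen_eq_of_affine]
    exact h
  have h2 : x ∈ Y.basicOpen (p.appTop ((Scheme.ΓSpecIso (.of R)).inv r)) := by
    rw [← Scheme.preimage_basicOpen_top]
    exact h1
  rw [Scheme.mem_basicOpen_top] at h2
  rw [pullStalk, RingHom.comp_apply, pullFun_top]
  exact h2

theorem IsTorsionFree.pullStalk_mem_nonZeroDivisors {Y : Scheme.{0}} {p : Y ⟶ A1}
    (h : IsTorsionFree p) (x : Y) : pullStalk p x X ∈ nonZeroDivisors (Y.presheaf.stalk x) := by
  refine mem_nonZeroDivisors_iff_right.2 fun s hs => ?_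
  obtain ⟨V, hx, s, rfl⟩ := Y.presheaf.exists_germ_eq s
  have h1 : germHom V hx (tFunOn p V * s) = germHom V hx 0 := by
    rw [map_mul, map_zero, tFunOn_eq_pullFun, mul_comm]
    erw [germ_pullFun]
    exact hs
  obtain ⟨W, hxW, hW⟩ := exists_resHom_eq hx (fun _ : Unit => tFunOn p V * s) (fun _ => 0)
    fun _ => h1
  have h2 := hW (V ⊓ W) inf_le_left inf_le_right ()
  rw [map_zero, map_mul] at h2
  have h3 := h (V ⊓ W) (resHom inf_le_left s) (by
    rw [← tFunOn_map p (inf_le_left : V ⊓ W ≤ V)]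
    exact h2)
  have h4 := germHom_resHom (x := x) (inf_le_left : V ⊓ W ≤ V) ⟨hx, hxW⟩ s
  rw [h3, map_zero] at h4
  exact h4.symm

variable {g N : ℕ} {d : Fin N → ℕ}

/-- Over `μ_{(d_i)}`, the corank of `Π_i` at a point is at most `d_i`. -/
theorem rank_univPi_residue {x : Target g N} (hx : targetToMu g N x ∈ muD g d)
    (i : Fin (N + 1)) :
    2 * g - dExt g d i ≤ (((univPi g N i).map (pullStalk (targetToClosed g N) x)).map
      (IsLocalRing.residue _)).rank := by
  obtain ⟨r, c, h⟩ := hx i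
  apply le_rank_of_det_submatrix_ne_zero _ r c
  have h1 := isUnit_pullStalk (targetToClosed g N) x h
  have h2 := (h1.map (IsLocalRing.residue _)).ne_zero
  rw [RingHom.map_det, RingHom.map_det] at h2
  exact h2

/-- The normal form over the stalk at a point of the target over `μ_{(d_i)}`. -/
theorem nonempty_normalData_stalk (hsum : ∑ i, d i = g) {x : Target g N}
    (hx : targetToMu g N x ∈ muD g d) :
    Nonempty (NormalData (pullStalk (targetToClosed g N) x (muT g N))
      ((univPi g N 0).map (pullStalk (targetToClosed g N) x))
      ((tailProd (univPi g N)).map (pullStalk (targetToClosed g N) x))) := by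
  set ρ := pullStalk (targetToClosed g N) x
  have hs : ∀ (A B : Matrix (Idx g) (Idx g) (MuRing g N)), A * B = muT g N • 1 →
      A.map ρ * B.map ρ = ρ (muT g N) • 1 := fun A B h => by
    rw [← Matrix.map_mul, h]
    ext a b
    simp [Matrix.one_apply, apply_ite ρ]
  refine nonempty_normalData ?_ (toBlocks₂₁_map ρ (univPi_toBlocks₂₁ g N 0))
    (toBlocks₂₁_map ρ (tailProd_univPi_toBlocks₂₁ g N)) (hs _ _ (univPi_mul_tailProd g N))
    (hs _ _ (tailProd_mul_univPi g N)) ?_ ?_ (exists_minor_dvd g N x)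
  · have h := (isTorsionFree_target g N).pullStalk_mem_nonZeroDivisors x
    rw [← targetToClosed_comp] at h
    have e : pullStalk (targetToClosed g N ≫ muClosedToA1 g N) x X = ρ (muT g N) := by
      simp only [ρ, pullStalk, RingHom.comp_apply, muClosedToA1]
      rw [pullFun_comp_SpecMap]
      rfl
    rwa [e] at h
  · refine le_trans ?_ (rank_univPi_residue hx 0)
    simp only [dExt, Fin.cons_zero]
    omega
  · rw [tailProd_map, tailProd_map]
    have h := card_le_rank_prod_add (fun k : Fin N => ((univPi g N k.succ).map ρ).map
      (IsLocalRing.residue _)) d fun i => by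
        have h1 : 2 * g - dExt g d i.succ ≤ (((univPi g N i.succ).map ρ).map
          (IsLocalRing.residue _)).rank := rank_univPi_residue hx i.succ
        have h2 : d i ≤ g := hsum ▸ Finset.single_le_sum (fun _ _ => Nat.zero_le _)
          (Finset.mem_univ i)
        simp only [dExt, Fin.cons_succ] at h1
        rw [Fintype.card_sum, Fintype.card_fin]
        omega
    rw [hsum, Fintype.card_sum, Fintype.card_fin] at h
    simp only [tailProd]
    omega

/-- The tuple over the target in normal form on an affine neighbourhood. -/
theorem exists_normalData (hsum : ∑ i, d i = g) {x : Target g N}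
    (hx : targetToMu g N x ∈ muD g d) :
    ∃ U : (Target g N).Opens, x ∈ U ∧ IsAffineOpen U ∧ (∀ y ∈ U, targetToMu g N y ∈ muD g d) ∧
      Nonempty (NormalData (pullFun (targetToClosed g N) U (muT g N))
        ((univPi g N 0).map (pullFun (targetToClosed g N) U))
        ((tailProd (univPi g N)).map (pullFun (targetToClosed g N) U))) := by
  obtain ⟨n⟩ := nonempty_normalData_stalk hsum hx
  set p := targetToClosed g N
  obtain ⟨V, hV, hxV, ⟨n'⟩⟩ := NormalData.exists_of_germ (U := ⊤) (hx := trivial)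
    (t := pullFun p ⊤ (muT g N)) (M := (univPi g N 0).map (pullFun p ⊤))
    (T := (tailProd (univPi g N)).map (pullFun p ⊤)) n
  obtain ⟨_, ⟨W, hW, rfl⟩, hxW, hWU⟩ :=
    (Target g N).isBasis_affineOpens.exists_subset_of_mem_open
      (show x ∈ V ⊓ targetToMu g N ⁻¹ᵁ muD g d from ⟨hxV, hx⟩)
      (V ⊓ targetToMu g N ⁻¹ᵁ muD g d).2
  have hWV : W ≤ V := fun y hy => (hWU hy).1
  refine ⟨W, hxW, hW, fun y hy => (hWU hy).2, ?_⟩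
  have e : ∀ r, resHom hWV (resHom hV (pullFun p ⊤ r)) = pullFun p W r := fun r => by
    rw [pullFun_res p hV, pullFun_res p hWV]
  have n'' := n'.map (resHom hWV)
  rw [e] at n''
  have e' : ∀ A : Matrix (Idx g) (Idx g) (MuRing g N),
      ((A.map (pullFun p ⊤)).map (resHom hV)).map (resHom hWV) = A.map (pullFun p W) :=
    fun A => by
      ext a b
      exact e _
  rw [e', e'] at n''
  exact ⟨n''⟩

end Local

/-! ### Affine space -/

section AffineSpaces

/-- Affine space is a base change of the spectrum of a polynomial ring over `ℤ`. -/
theorem smooth_affineSpace (n : Type) [Finite n] (S : Scheme.{0}) : Smooth (𝔸(n; S) ↘ S) := by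
  have hpb : IsPullback (𝔸(n; S) ↘ S) (AffineSpace.toSpecMvPoly n S) (terminal.from S)
    (terminal.from (Spec (.of (MvPolynomial n (ULift.{0} ℤ))))) := IsPullback.of_hasPullback _ _
  refine MorphismProperty.of_isPullback (P := @Smooth.{0}) hpb.flip ?_
  have := isIso_of_isTerminal specULiftZIsTerminal.{0} terminalIsTerminal (terminal.from _)
  rw [← terminal.comp_from (Spec.map (CommRingCat.ofHom MvPolynomial.C))]
  have h : Algebra.Smooth (ULift.{0} ℤ) (MvPolynomial n (ULift.{0} ℤ)) := ⟨inferInstance,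
    inferInstance⟩
  have h' : (MvPolynomial.C : ULift.{0} ℤ →+* MvPolynomial n (ULift.{0} ℤ)).Smooth := by
    rw [RingHom.Smooth]
    convert! h
    exact Algebra.algebra_ext _ _ fun _ ↦ rfl
  have h'' : Smooth (Spec.map (CommRingCat.ofHom
      (MvPolynomial.C : ULift.{0} ℤ →+* MvPolynomial n (ULift.{0} ℤ)))) :=
    (HasRingHomProperty.Spec_iff (P := @Smooth.{0})).2 h'
  infer_instance

theorem isUnit_appTop_basicOpen_ι {Y : Scheme.{0}} (F : Γ(Y, ⊤)) :
    IsUnit ((Y.basicOpen F).ι.appTop.hom F) := by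
  have h := RingedSpace.isUnit_res_basicOpen Y.toRingedSpace F
  have hle : (Y.basicOpen F).ι ''ᵁ ⊤ ≤ Y.basicOpen F := by
    rintro _ ⟨y, _, rfl⟩
    exact y.2
  have h2 := IsUnit.map (resHom hle) h
  have h3 := resHom_resHom (Y.basicOpen_le F) hle F
  have h4 : IsUnit (resHom (hle.trans (Y.basicOpen_le F)) F) := by
    rw [← h3]
    exact h2
  exact h4

theorem isTorsionFree_Spec {R : Type} [CommRing R] (p : Spec (.of R) ⟶ A1) (a : R)
    (hp : pullFun p ⊤ X = (Scheme.ΓSpecIso (.of R)).inv.hom a) (ha : ∀ s, a * s = 0 → s = 0) :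
    IsTorsionFree p := by
  refine isTorsionFree_of_isAffine p fun s hs => ?_
  have hinj : Function.Injective (Scheme.ΓSpecIso (.of R)).hom.hom :=
    (Scheme.ΓSpecIso (.of R)).commRingCatIsoToRingEquiv.injective
  apply hinj
  rw [map_zero]
  apply ha
  have ht : tFun p = (Scheme.ΓSpecIso (.of R)).inv.hom a := by
    rw [← hp, pullFun_top]
    rfl
  have ha' : (Scheme.ΓSpecIso (.of R)).hom.hom (tFun p) = a := by
    rw [ht, ← CommRingCat.comp_apply, Iso.inv_hom_id]
    rfl
  rw [← ha', ← map_mul, hs, map_zero]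

/-- An affine space over an affine scheme without `t`-torsion has no `t`-torsion. -/
theorem IsTorsionFree.affineSpace {n : Type} {S : Scheme.{0}} [IsAffine S] {p : S ⟶ A1}
    (h : IsTorsionFree p) : IsTorsionFree ((𝔸(n; S) ↘ S) ≫ p) := by
  let q : Spec (.of Γ(S, ⊤)) ⟶ A1 := S.isoSpec.inv ≫ p
  have hq : IsTorsionFree q := h.comp_openImmersion _
  let a : Γ(S, ⊤) := (Scheme.ΓSpecIso (.of Γ(S, ⊤))).hom.hom (pullFun q ⊤ X)
  have ha : (Scheme.ΓSpecIso (.of Γ(S, ⊤))).inv.hom a = pullFun q ⊤ X := by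
    simp only [a]
    rw [← CommRingCat.comp_apply, Iso.hom_inv_id]
    rfl
  have ha0 : ∀ s, a * s = 0 → s = 0 := fun s hs => by
    have hinj : Function.Injective (Scheme.ΓSpecIso (.of Γ(S, ⊤))).inv.hom :=
      (Scheme.ΓSpecIso (.of Γ(S, ⊤))).symm.commRingCatIsoToRingEquiv.injective
    apply hinj
    rw [map_zero]
    apply hq ⊤
    rw [tFunOn_eq_pullFun, ← ha, ← map_mul, hs, map_zero]
  let r : Spec (.of (MvPolynomial n Γ(S, ⊤))) ⟶ A1 :=
    Spec.map (CommRingCat.ofHom MvPolynomial.C) ≫ q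
  have hr : IsTorsionFree r := by
    refine isTorsionFree_Spec r (MvPolynomial.C a) ?_ fun s hs => ?_
    · rw [← pullFun_appTop, ← ha]
      have := congrArg (fun f => f.hom a) (Scheme.ΓSpecIso_inv_naturality
        (CommRingCat.ofHom (MvPolynomial.C (σ := n) (R := Γ(S, ⊤)))))
      exact this.symm
    · ext m
      have h1 := congrArg (MvPolynomial.coeff m) hs
      rw [MvPolynomial.coeff_C_mul, MvPolynomial.coeff_zero] at h1
      rw [MvPolynomial.coeff_zero]
      exact ha0 _ h1
  have e : (𝔸(n; S) ↘ S) ≫ p = (AffineSpace.isoOfIsAffine n S).hom ≫ r := by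
    rw [← Iso.inv_comp_eq, AffineSpace.isoOfIsAffine_inv_over_assoc]
  rw [e]
  exact hr.comp_openImmersion _

end AffineSpaces

/-! ### Pairings and points of the source -/

section Charts

variable {g N : ℕ} {d : Fin N → ℕ} {S X X' : Scheme.{0}}

/-- Compatibility of `NormalData.form` with composites of ring homomorphisms that are only
propositionally equal. -/
theorem NormalData.form_comp {A B C : Type} [CommRing A] [CommRing B] [CommRing C] {t : A}
    {M T : Matrix (Idx g) (Idx g) A} (n : NormalData t M T) {φ : A →+* B} {ψ : B →+* C}
    {χ : A →+* C} (h : ψ.comp φ = χ) (v : Var g → B) (e : Bool) :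
    (n.map χ).form (fun i => ψ (v i)) e = ((n.map φ).form v e).map ψ := by
  subst h
  rw [← NormalData.form_map]
  rfl

theorem NormalData.coord_comp {A B C : Type} [CommRing A] [CommRing B] [CommRing C] {t : A}
    {M T : Matrix (Idx g) (Idx g) A} (n : NormalData t M T) {φ : A →+* B} {ψ : B →+* C}
    {χ : A →+* C} (h : ψ.comp φ = χ) (J : Bool → Matrix (Idx g) (Idx g) B) (i : Var g) :
    (n.map χ).coord (fun e => (J e).map ψ) i = ψ ((n.map φ).coord J i) := by
  subst h
  rw [← NormalData.coord_map]
  rfl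

theorem hom_comp_appTop {f : X ⟶ S} {k : X' ⟶ X} {f' : X' ⟶ S} (h : k ≫ f = f') :
    k.appTop.hom.comp f.appTop.hom = f'.appTop.hom := by
  subst h
  rw [Scheme.Hom.comp_appTop]
  rfl

theorem map_pullFun_appTop {R : Type} [CommRing R] {p : S ⟶ Spec (.of R)} {f : X ⟶ S}
    {p' : X ⟶ Spec (.of R)} (h : f ≫ p = p') (A : Matrix (Idx g) (Idx g) R) :
    (A.map (pullFun p ⊤)).map f.appTop.hom = A.map (pullFun p' ⊤) := by
  subst h
  ext a b
  exact pullFun_appTop f p _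

/-- The Gram matrices of the pairings classified by a morphism to the source. -/
def pulledForm (m : X ⟶ Source g d) (e : Bool) : Matrix (Idx g) (Idx g) Γ(X, ⊤) :=
  (univForm g N e).map (pullFun (m ≫ sourceToSig g d) ⊤)

theorem pulledForm_comp (k : X' ⟶ X) (m : X ⟶ Source g d) (e : Bool) :
    pulledForm (k ≫ m) e = (pulledForm m e).map k.appTop.hom := by
  rw [pulledForm, pulledForm, map_pullFun_appTop (p' := (k ≫ m) ≫ sourceToSig g d)]
  rw [Category.assoc]

theorem isUnit_det_pulledForm (m : X ⟶ Source g d) (e : Bool) :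
    IsUnit (pulledForm m e).det := by
  have := (isUnit_det_univForm g N e).map (pullFun (m ≫ sourceToSig g d) ⊤)
  rw [RingHom.map_det] at this
  exact this

theorem pullFun_algebraMap (m : X ⟶ Source g d) (r : MuRing g N) :
    pullFun (m ≫ sourceToSig g d) ⊤ (algebraMap (MuRing g N) (SigmaRing g N) r) =
      pullFun ((m ≫ mainMap g d) ≫ targetToClosed g N) ⊤ r := by
  rw [Category.assoc, ← sourceToSig_comp, sigmaClosedToMu, ← Category.assoc, pullFun_comp_SpecMap]

/-- A morphism to the source is determined by its composite to the target and the pairings. -/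
theorem source_hom_ext_of_pulledForm {m₁ m₂ : X ⟶ Source g d}
    (h : m₁ ≫ mainMap g d = m₂ ≫ mainMap g d) (hJ : ∀ e, pulledForm m₁ e = pulledForm m₂ e) :
    m₁ = m₂ := by
  refine source_hom_ext h (hom_ext_of_pullFun (sigmaRing_hom_ext ?_ hJ))
  ext r
  simp only [RingHom.comp_apply]
  rw [pullFun_algebraMap, pullFun_algebraMap, h]

theorem isPairing_pulledForm (m : X ⟶ Source g d) :
    IsPairing ((univPi g N 0).map (pullFun ((m ≫ mainMap g d) ≫ targetToClosed g N) ⊤))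
      ((tailProd (univPi g N)).map (pullFun ((m ≫ mainMap g d) ≫ targetToClosed g N) ⊤))
      (pulledForm m) := by
  have h := (isPairing_univForm g N).map g (pullFun (m ≫ sourceToSig g d) ⊤)
  have e : ∀ A : Matrix (Idx g) (Idx g) (MuRing g N),
      (A.map (algebraMap (MuRing g N) (SigmaRing g N))).map (pullFun (m ≫ sourceToSig g d) ⊤) =
        A.map (pullFun ((m ≫ mainMap g d) ≫ targetToClosed g N) ⊤) := fun A => by
    ext a b
    exact pullFun_algebraMap m _
  rw [e, e] at h
  exact h

/-- The normal form over a scheme with a morphism to the target. -/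
abbrev PulledNormalData (j : S ⟶ Target g N) : Type :=
  NormalData (pullFun (j ≫ targetToClosed g N) ⊤ (muT g N))
    ((univPi g N 0).map (pullFun (j ≫ targetToClosed g N) ⊤))
    ((tailProd (univPi g N)).map (pullFun (j ≫ targetToClosed g N) ⊤))

variable {j : S ⟶ Target g N}

/-- Without `t`-torsion, pairings are determined by their coordinates. -/
theorem form_coord_pulledForm (n : PulledNormalData j) {f : X ⟶ S} {m : X ⟶ Source g d}
    (hm : m ≫ mainMap g d = f ≫ j) (hX : IsTorsionFree ((f ≫ j) ≫ targetToA1 g N)) :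
    (n.map f.appTop.hom).form ((n.map f.appTop.hom).coord (pulledForm m)) = pulledForm m := by
  refine NormalData.form_coord _ ?_ ?_
  · have h := hX.mem_nonZeroDivisors ⊤
    rw [← targetToClosed_comp, tFunOn_eq_pullFun, ← Category.assoc, muClosedToA1,
      pullFun_comp_SpecMap, Category.assoc, ← pullFun_appTop] at h
    exact h
  · have h := isPairing_pulledForm m
    rw [hm] at h
    rw [map_pullFun_appTop (Category.assoc _ _ _).symm,
      map_pullFun_appTop (Category.assoc _ _ _).symm]
    exact h

/-- Morphisms to the source over an open subset on which the tuple has a normal form: the Gram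
matrices of the pairings can be prescribed by their coordinates. -/
theorem exists_source_hom (n : PulledNormalData j)
    (hD : ∀ s, targetToMu g N (j s) ∈ muD g d) (f : X ⟶ S)
    (hX : IsTorsionFree ((f ≫ j) ≫ targetToA1 g N)) (v : Var g → Γ(X, ⊤))
    (hv : ∀ e, IsUnit ((n.map f.appTop.hom).form v e).det) :
    ∃ m : X ⟶ Source g d, m ≫ mainMap g d = f ≫ j ∧
      pulledForm m = (n.map f.appTop.hom).form v := by
  have hJ := (n.map f.appTop.hom).isPairing_form v
  obtain ⟨J, hJe⟩ : ∃ J, J = (n.map f.appTop.hom).form v := ⟨_, rfl⟩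
  rw [← hJe] at hJ hv ⊢
  rw [map_pullFun_appTop (Category.assoc _ _ _).symm,
    map_pullFun_appTop (Category.assoc _ _ _).symm] at hJ
  obtain ⟨σ, hσ, hσ'⟩ := exists_sigmaRing_lift _ hJ hv
  obtain ⟨s, hs⟩ := exists_pullFun_eq σ
  obtain ⟨m, hm, hm'⟩ := exists_source_lift (f ≫ j) hX (fun x => hD (f x)) s (by
    apply hom_ext_of_pullFun
    rw [← hσ, ← hs]
    ext r
    exact pullFun_comp_SpecMap _ _ _ _)
  refine ⟨m, hm, funext fun e => ?_⟩
  rw [pulledForm, hm', hs, hσ']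

/-- Over an open subset on which the tuple has a normal form, the morphism of the theorem has a
section. -/
theorem surjective_of_pulledNormalData [IsOpenImmersion j] (n : PulledNormalData j)
    (hD : ∀ s, targetToMu g N (j s) ∈ muD g d) {Z : Scheme.{0}} {f : Z ⟶ S}
    {i : Z ⟶ Source g d} (hpb : IsPullback f i j (mainMap g d)) : Surjective f := by
  have hX : IsTorsionFree ((𝟙 S ≫ j) ≫ targetToA1 g N) :=
    (isTorsionFree_target g N).comp_openImmersion _
  obtain ⟨m, hm, -⟩ := exists_source_hom n hD (𝟙 S) hX (idVar _ g)
    fun e => (n.map _).isUnit_det_form_idVar e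
  have h := hpb.lift_fst (𝟙 S) m hm.symm
  exact ⟨fun s => ⟨hpb.lift (𝟙 S) m hm.symm s, by
    rw [← Scheme.Hom.comp_apply, h]
    rfl⟩⟩

/-- Over an open subset on which the tuple has a normal form, the coordinates of the universal
pairings identify the source with an open subscheme of affine space. -/
theorem exists_iso_basicOpen [IsAffine S] [IsOpenImmersion j] (n : PulledNormalData j)
    (hD : ∀ s, targetToMu g N (j s) ∈ muD g d) {Z : Scheme.{0}} {f : Z ⟶ S}
    {i : Z ⟶ Source g d} [IsOpenImmersion i] (hpb : IsPullback f i j (mainMap g d))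
    {κ : Type} (ε : κ ≃ Var g) :
    ∃ (F : Γ(𝔸(κ; S), ⊤)) (e : Z ≅ (𝔸(κ; S).basicOpen F).toScheme),
      e.hom ≫ (𝔸(κ; S).basicOpen F).ι ≫ (𝔸(κ; S) ↘ S) = f := by
  let π := 𝔸(κ; S) ↘ S
  let x : Var g → Γ(𝔸(κ; S), ⊤) := fun a => AffineSpace.coord S (ε.symm a)
  let J := (n.map π.appTop.hom).form x
  let F := (J false).det * (J true).det
  let B := 𝔸(κ; S).basicOpen F
  let b : B.toScheme ⟶ S := B.ι ≫ π
  have hS : IsTorsionFree (j ≫ targetToA1 g N) := (isTorsionFree_target g N).comp_openImmersion _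
  have hB : IsTorsionFree ((b ≫ j) ≫ targetToA1 g N) := by
    have h := (hS.affineSpace (n := κ)).comp_openImmersion B.ι
    simpa only [b, π, Category.assoc] using h
  have hZ : IsTorsionFree ((f ≫ j) ≫ targetToA1 g N) := by
    rw [hpb.w, Category.assoc]
    exact (isTorsionFree_source g d).comp_openImmersion i
  let y : Var g → Γ(B.toScheme, ⊤) := fun a => B.ι.appTop.hom (x a)
  have hy : ∀ e, (n.map b.appTop.hom).form y e = (J e).map B.ι.appTop.hom := fun e =>
    n.form_comp (hom_comp_appTop rfl) x e
  have hyu : ∀ e, IsUnit ((n.map b.appTop.hom).form y e).det := fun e => by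
    have h := isUnit_appTop_basicOpen_ι F
    rw [map_mul, IsUnit.mul_iff, RingHom.map_det, RingHom.map_det] at h
    rw [hy]
    cases e
    exacts [h.1, h.2]
  -- Over the basic open subset, the pairings with the standard coordinates are nondegenerate.
  obtain ⟨m, hm, hmJ⟩ := exists_source_hom n hD b hB y hyu
  let inv : B.toScheme ⟶ Z := hpb.lift b m hm.symm
  have hinv1 : inv ≫ f = b := hpb.lift_fst _ _ _
  have hinv2 : inv ≫ i = m := hpb.lift_snd _ _ _
  let z : Var g → Γ(Z, ⊤) := (n.map f.appTop.hom).coord (pulledForm i)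
  have hz : (n.map f.appTop.hom).form z = pulledForm i := form_coord_pulledForm n hpb.w.symm hZ
  -- The coordinates of the universal pairings define the inverse of `inv`.
  let w : Z ⟶ 𝔸(κ; S) := AffineSpace.homOfVector f fun k => z (ε k)
  have hwπ : w ≫ π = f := AffineSpace.homOfVector_over _ _
  have hwx : ∀ a, w.appTop.hom (x a) = z a := fun a => by
    have := AffineSpace.homOfVector_appTop_coord f (fun k => z (ε k)) (ε.symm a)
    rw [Equiv.apply_symm_apply] at this
    exact this
  have hwJ : ∀ e, (J e).map w.appTop.hom = pulledForm i e := fun e => by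
    rw [← hz, ← n.form_comp (hom_comp_appTop hwπ) x e]
    simp only [hwx]
  have hwF : IsUnit (w.appTop.hom F) := by
    rw [map_mul, RingHom.map_det, RingHom.map_det, RingHom.mapMatrix_apply,
      RingHom.mapMatrix_apply, hwJ, hwJ]
    exact (isUnit_det_pulledForm i false).mul (isUnit_det_pulledForm i true)
  let hom : Z ⟶ B.toScheme := IsOpenImmersion.lift B.ι w (by
    rw [Scheme.Opens.range_ι]
    rintro _ ⟨a, rfl⟩
    have h : a ∈ w ⁻¹ᵁ B := by
      rw [Scheme.preimage_basicOpen_top, Scheme.basicOpen_of_isUnit _ hwF]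
      trivial
    exact h)
  have hhom : hom ≫ B.ι = w := IsOpenImmersion.lift_fac _ _ _
  have hhomb : hom ≫ b = f := by rw [← Category.assoc, hhom, hwπ]
  have hhomy : ∀ a, hom.appTop.hom (y a) = z a := fun a => by
    rw [← hwx]
    exact RingHom.congr_fun (hom_comp_appTop hhom) (x a)
  refine ⟨F, ⟨hom, inv, ?_, ?_⟩, hhomb⟩
  · apply hpb.hom_ext
    · rw [Category.assoc, hinv1, hhomb, Category.id_comp]
    · rw [Category.assoc, hinv2, Category.id_comp]
      refine source_hom_ext_of_pulledForm ?_ fun e => ?_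
      · rw [Category.assoc, hm, ← hpb.w, ← Category.assoc, hhomb]
      · rw [pulledForm_comp, hmJ, ← n.form_comp (hom_comp_appTop hhomb) y e, ← hz]
        simp only [hhomy]
  · rw [← cancel_mono B.ι, Category.assoc, hhom, Category.id_comp]
    refine AffineSpace.hom_ext ?_ fun k => ?_
    · exact (Category.assoc _ _ _).trans ((congrArg (inv ≫ ·) hwπ).trans hinv1)
    · have h1 : (inv ≫ w).appTop.hom (AffineSpace.coord S k) = inv.appTop.hom (z (ε k)) := by
        rw [← hom_comp_appTop (rfl : inv ≫ w = inv ≫ w), RingHom.comp_apply, ← hwx]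
        simp only [x, Equiv.symm_apply_apply]
      have h2 : inv.appTop.hom (z (ε k)) = y (ε k) := by
        rw [← n.coord_comp (hom_comp_appTop hinv1) (pulledForm i) (ε k)]
        have h3 : (fun e => (pulledForm i e).map inv.appTop.hom) =
            (n.map b.appTop.hom).form y := by
          funext e
          rw [← pulledForm_comp, hinv2, hmJ]
        rw [h3, NormalData.coord_form]
      refine h1.trans (h2.trans ?_)
      simp only [y, x, Equiv.symm_apply_apply]

end Charts

/-! ### The structure of the morphism -/

section Conclusion

variable {g N : ℕ} {d : Fin N → ℕ}

/-- A normal form over an open subset of the target, on the open subscheme. -/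
theorem nonempty_pulledNormalData {U : (Target g N).Opens}
    (n : NormalData (pullFun (targetToClosed g N) U (muT g N))
      ((univPi g N 0).map (pullFun (targetToClosed g N) U))
      ((tailProd (univPi g N)).map (pullFun (targetToClosed g N) U))) :
    Nonempty (PulledNormalData U.ι) := by
  have hle : (⊤ : U.toScheme.Opens) ≤ U.ι ⁻¹ᵁ U := fun y _ => y.2
  let φ : Γ(Target g N, U) →+* Γ(U.toScheme, ⊤) := (resHom hle).comp (U.ι.app U).hom
  have e : ∀ r, φ (pullFun (targetToClosed g N) U r) =
      pullFun (U.ι ≫ targetToClosed g N) ⊤ r := fun r => by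
    simp only [φ, RingHom.comp_apply]
    rw [pullFun_app, pullFun_res]
  have e' : ∀ A : Matrix (Idx g) (Idx g) (MuRing g N),
      (A.map (pullFun (targetToClosed g N) U)).map φ =
        A.map (pullFun (U.ι ≫ targetToClosed g N) ⊤) := fun A => by
    ext a b
    exact e _
  have n' := n.map φ
  rw [e, e', e'] at n'
  exact ⟨n'⟩

/-- The local structure of the morphism over `μ_{(d_i)}`. -/
theorem exists_chart (hN : 0 < N) (hsum : ∑ i, d i = g) {x : Target g N}
    (hx : targetToMu g N x ∈ muD g d) :
    ∃ U : (Target g N).Opens, x ∈ U ∧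
      (∃ h : Fin (N + 1) → Matrix.GeneralLinearGroup (Idx g) Γ(Target g N, U),
        InParabolic h ∧ InBigCell (translate h (targetPi g N U))) ∧
      Surjective (mainMap g d ∣_ U) ∧
      ∃ (F : Γ(𝔸(Fin (g * (3 * g - 1) / 2); U.toScheme), ⊤))
        (e : (mainMap g d ⁻¹ᵁ U).toScheme ≅
          (𝔸(Fin (g * (3 * g - 1) / 2); U.toScheme).basicOpen F).toScheme),
        e.hom ≫ (𝔸(Fin (g * (3 * g - 1) / 2); U.toScheme).basicOpen F).ι ≫
          (𝔸(Fin (g * (3 * g - 1) / 2); U.toScheme) ↘ U.toScheme) = mainMap g d ∣_ U := by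
  obtain ⟨U, hxU, hU, hUD, ⟨n⟩⟩ := exists_normalData hsum hx
  obtain ⟨n'⟩ := nonempty_pulledNormalData n
  have : IsAffine U.toScheme := hU
  have hpb := isPullback_morphismRestrict (mainMap g d) U
  have hD : ∀ s : U.toScheme, targetToMu g N (U.ι s) ∈ muD g d := fun s => hUD _ s.2
  refine ⟨U, hxU, ?_, surjective_of_pulledNormalData n' hD hpb,
    exists_iso_basicOpen n' hD hpb (Fintype.equivFinOfCardEq (card_var g)).symm⟩
  have n₁ := n
  rw [tailProd_map] at n₁
  exact NormalData.exists_inBigCell (M := targetPi g N U) hN n₁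

theorem smooth_mainMap (hN : 0 < N) (hsum : ∑ i, d i = g) : Smooth (mainMap g d) := by
  choose U hxU _ _ F e he using fun z : Source g d =>
    exists_chart hN hsum (mainMap_mem_muD g d z)
  have : IsZariskiLocalAtSource @Smooth.{0} :=
    HasRingHomProperty.instIsZariskiLocalAtSource (Q := RingHom.Smooth)
  refine (IsZariskiLocalAtSource.iff_of_iSup_eq_top (P := @Smooth.{0})
    (fun z => mainMap g d ⁻¹ᵁ U z) (top_le_iff.1 fun z _ =>
      TopologicalSpace.Opens.mem_iSup.2 ⟨z, hxU z⟩)).2 fun z => ?_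
  have h := smooth_affineSpace (Fin (g * (3 * g - 1) / 2)) (U z).toScheme
  rw [← morphismRestrict_ι, ← he]
  infer_instance

end Conclusion

end Genestier

theorem proposition2p3p6 (g N : ℕ) (hN : 0 < N) (d : Fin N → ℕ) (hd : ∀ i, 0 < d i)
    (hsum : ∑ i, d i = g) :
    Smooth (Genestier.mainMap g d) ∧
    ∀ x : Genestier.Target g N, Genestier.targetToMu g N x ∈ Genestier.muD g d →
      ∃ U : (Genestier.Target g N).Opens, x ∈ U ∧
        (∃ h : Fin (N + 1) → Matrix.GeneralLinearGroup (Genestier.Idx g) Γ(Genestier.Target g N, U),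
          Genestier.InParabolic h ∧
          Genestier.InBigCell (Genestier.translate h (Genestier.targetPi g N U))) ∧
        Surjective (Genestier.mainMap g d ∣_ U) ∧
        ∃ (F : Γ(𝔸(Fin (g * (3 * g - 1) / 2); U.toScheme), ⊤))
          (e : (Genestier.mainMap g d ⁻¹ᵁ U).toScheme ≅
            (𝔸(Fin (g * (3 * g - 1) / 2); U.toScheme).basicOpen F).toScheme),
          e.hom ≫ (𝔸(Fin (g * (3 * g - 1) / 2); U.toScheme).basicOpen F).ι ≫
            (𝔸(Fin (g * (3 * g - 1) / 2); U.toScheme) ↘ U.toScheme)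
            = Genestier.mainMap g d ∣_ U :=
  ⟨Genestier.smooth_mainMap hN hsum, fun _ hx => Genestier.exists_chart hN hsum hx⟩
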